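/- Let $G$ be the simply connected simple algebraic group over $\mathbb C$ of type $B_n$, with Chevalley generators $e_i,f_i$ and simple coroots $h_i=[e_i,f_i]$ of its Lie algebra ($i=1,\dots,n$; Cartan integers $a_{ij}=\alpha_j(h_i)$, $\alpha_n$ the short simple root, so $a_{n,n-1}=-2$), maximal torus $T$, opposite maximal unipotent subgroups $U^{\pm}$, fundamental weights $\Lambda_i$, and Weyl group $W$ generated by the simple reflections $s_i$, with longest element $w_0$. Put $x_i(t)=\exp(te_i)$, $y_i(t)=\exp(tf_i)$, and let $\alpha_i^\vee(c)=\phi_i(\mathrm{diag}(c,c^{-1}))$, where $\phi_i:SL_2(\mathbb C)\to G$ is the homomorphism sending $\begin{pmatrix}1&t\\0&1\end{pmatrix}$ to $x_i(t)$ and $\begin{pmatrix}1&0\\t&1\end{pmatrix}$ to $y_i(t)$. Put $\mathbf y_i(c)=y_i(c)\,\alpha_i^\vee(c^{-1})$ and $\overline{s}_i=x_i(-1)y_i(1)x_i(-1)$, and for $w\in W$ put $\overline w=\overline{s}_{i_1}\cdots\overline{s}_{i_l}$, where $s_{i_1}\cdots s_{i_l}$ is any reduced expression of $w$. For a dominant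 weight $\mu$ let $\Delta_\mu$ be the regular function on $G$ with $\Delta_\mu(u^-tu^+)=\mu(t)$ for $u^\pm\in U^\pm$, $t\in T$; for $u,v\in W$ the generalized minor is $\Delta_{u\mu,v\mu}(g)=\Delta_\mu(\overline u^{\,-1}g\,\overline v)$. For $c=(c^{(p)}_i)_{1\le p,i\le n}\in(\mathbb C^\times)^{n^2}$ let $$\Theta^-_{\mathbf i_0}(c)=\prod_{p=1}^{n}\bigl(\mathbf y_1(c^{(p)}_1)\,\mathbf y_2(c^{(p)}_2)\cdots\mathbf y_n(c^{(p)}_n)\bigr),$$ the factors being taken in the order $p=1,2,\dots,n$ from left to right; this corresponds to the reduced word $\mathbf i_0=(1\,2\cdots n)^n$ of $w_0$. **Theorem.** For every $k\in\{1,\dots,n-1\}$ and every $c\in(\mathbb C^\times)^{n^2}$, $$\Delta_{w_0s_k\Lambda_k,\,\Lambda_k}\bigl(\Theta^-_{\mathbf i_0}(c)\bigr)=\frac1{c^{(k)}_1}+\sum_{j=1}^{k-1}\frac{c^{(j)}_{k-j}}{c^{(j)}_{k-j+1}}.$$ -/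

import Mathlib

namespace TypeB

/-! Type `B_n` over `ℂ`.  The index set `I = {1, …, n}` is `Fin n`, so `i : Fin n` stands for the
index `i + 1`; the last node (`i + 1 = n`) is the short simple root. -/

/-- The Cartan matrix `a i j = ⟨h_i, α_j⟩` of type `B_n`. -/
def cartan (n : ℕ) (i j : Fin n) : ℤ :=
  if i = j then 2
  else if i.val + 1 = n ∧ j.val + 1 = i.val then -2
  else if j.val + 1 = i.val ∨ i.val + 1 = j.val then -1
  else 0

section Weyl

/-- The weight lattice `P`; the weight `λ` has coordinates `λ i = ⟨h_i, λ⟩`, so that the standard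
basis consists of the fundamental weights. -/
abbrev Weight (n : ℕ) := Fin n → ℤ

variable {n : ℕ}

/-- The fundamental weight `Λ_k`. -/
def fundWeight (k : Fin n) : Weight n := Pi.single k 1

/-- The simple root `α_j`. -/
def simpleRoot (j : Fin n) : Weight n := fun i => cartan n i j

theorem proj_simpleRoot (i : Fin n) :
    (LinearMap.proj i : Weight n →ₗ[ℤ] ℤ) (simpleRoot i) = 2 := by
  simp [simpleRoot, cartan]

/-- The simple reflection `s_i λ = λ - ⟨h_i, λ⟩ α_i`. -/
def simpleReflection (i : Fin n) : Weight n ≃ₗ[ℤ] Weight n :=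
  Module.reflection (proj_simpleRoot i)

variable (n) in
/-- The Weyl group, acting (faithfully) on the weight lattice. -/
def weylGroup : Subgroup (Weight n ≃ₗ[ℤ] Weight n) :=
  Subgroup.closure (Set.range simpleReflection)

/-- The simple reflection as an element of the Weyl group. -/
def simple (i : Fin n) : weylGroup n :=
  ⟨simpleReflection i, Subgroup.subset_closure ⟨i, rfl⟩⟩

/-- The Weyl group element `s_{i_1} ⋯ s_{i_l}` of a word. -/
def wordProd (ω : List (Fin n)) : weylGroup n := (ω.map simple).prod

theorem simple_mul_self (i : Fin n) : simple i * simple i = 1 := by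
  apply Subtype.ext
  apply LinearEquiv.ext
  intro x
  exact Module.involutive_reflection (proj_simpleRoot i) x

theorem exists_wordProd (w : weylGroup n) : ∃ ω : List (Fin n), wordProd ω = w := by
  obtain ⟨w, hw⟩ := w
  induction hw using Subgroup.closure_induction with
  | mem x hx =>
    obtain ⟨i, rfl⟩ := hx
    exact ⟨[i], by simp [wordProd, simple]⟩
  | one => exact ⟨[], rfl⟩
  | mul x y hx hy ihx ihy =>
    obtain ⟨a, ha⟩ := ihx
    obtain ⟨b, hb⟩ := ihy
    refine ⟨a ++ b, ?_⟩
    have h : wordProd (a ++ b) = wordProd a * wordProd b := by simp [wordProd]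
    rw [h, ha, hb]
    rfl
  | inv x hx ih =>
    obtain ⟨a, ha⟩ := ih
    refine ⟨a.reverse, ?_⟩
    have h : ∀ a : List (Fin n), wordProd a.reverse * wordProd a = 1 := by
      intro a
      induction a with
      | nil => simp [wordProd]
      | cons i t iht =>
        have h1 : wordProd (i :: t).reverse = wordProd t.reverse * simple i := by
          simp [wordProd]
        have h2 : wordProd (i :: t) = simple i * wordProd t := by simp [wordProd]
        rw [h1, h2, mul_assoc, ← mul_assoc (simple i), simple_mul_self, one_mul, iht]
    have h3 := eq_inv_of_mul_eq_one_left (h a)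
    rw [h3, ha]
    rfl

/-- The length of a Weyl group element: the least length of a word for it. -/
noncomputable def length (w : weylGroup n) : ℕ :=
  sInf {l | ∃ ω : List (Fin n), wordProd ω = w ∧ ω.length = l}

theorem exists_reduced (w : weylGroup n) :
    ∃ ω : List (Fin n), wordProd ω = w ∧ ω.length = length w := by
  obtain ⟨ω, hω⟩ := exists_wordProd w
  exact Nat.sInf_mem (s := {l | ∃ ω : List (Fin n), wordProd ω = w ∧ ω.length = l})
    ⟨ω.length, ω, hω, rfl⟩

/-- A reduced word of a Weyl group element. -/
noncomputable def reducedWord (w : weylGroup n) : List (Fin n) := (exists_reduced w).choose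

/-- `w` is the longest element of the Weyl group. -/
def IsLongest (w : weylGroup n) : Prop := ∀ w' : weylGroup n, length w' ≤ length w

end Weyl

section Representation

attribute [local instance] LieRing.ofAssociativeRing

variable {n : ℕ}

/-- Index set of the basis of the vector representation `V(Λ_1)`: `inl j` is `v_j`,
`inr (inl ())` is `v_0`, `inr (inr j)` is `v_{j̄}`. -/
abbrev VecIdx (n : ℕ) := Fin n ⊕ Unit ⊕ Fin n

/-- Index set of the basis of the spin representation `V(Λ_n)`: the sign vectors
`(ε_1, …, ε_n)`, with `true` for `+`. -/
abbrev SpinIdx (n : ℕ) := Fin n → Bool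

/-- Index set of the basis of `V(Λ_1) ⊕ V(Λ_n)`. -/
abbrev Idx (n : ℕ) := VecIdx n ⊕ SpinIdx n

/-- `f_i` on the vector representation (column `b` holds `f_i v_b`):
`f_i v_i = v_{i+1}`, `f_i v_{\overline{i+1}} = v_{\bar i}` for `i < n`, and
`f_n v_n = v_0`, `f_n v_0 = 2 v_{\bar n}`. -/
def vecF (i : Fin n) : Matrix (VecIdx n) (VecIdx n) ℂ :=
  Matrix.of fun a b =>
    match b, a with
    | .inl j, .inl k => if j = i ∧ k.val = i.val + 1 then 1 else 0
    | .inr (.inr j), .inr (.inr k) => if j.val = i.val + 1 ∧ k = i then 1 else 0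
    | .inl j, .inr (.inl _) => if i.val + 1 = n ∧ j = i then 1 else 0
    | .inr (.inl _), .inr (.inr k) => if i.val + 1 = n ∧ k = i then 2 else 0
    | _, _ => 0

/-- `e_i` on the vector representation:
`e_i v_{i+1} = v_i`, `e_i v_{\bar i} = v_{\overline{i+1}}` for `i < n`, and
`e_n v_0 = 2 v_n`, `e_n v_{\bar n} = v_0`. -/
def vecE (i : Fin n) : Matrix (VecIdx n) (VecIdx n) ℂ :=
  Matrix.of fun a b =>
    match b, a with
    | .inl j, .inl k => if j.val = i.val + 1 ∧ k = i then 1 else 0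
    | .inr (.inr j), .inr (.inr k) => if j = i ∧ k.val = i.val + 1 then 1 else 0
    | .inr (.inl _), .inl k => if i.val + 1 = n ∧ k = i then 2 else 0
    | .inr (.inr j), .inr (.inl _) => if i.val + 1 = n ∧ j = i then 1 else 0
    | _, _ => 0

/-- `f_i` on the spin representation: it turns `(+,-)` in positions `i, i+1` into `(-,+)` for
`i < n`, and `+` in position `n` into `-` for `i = n`; all other basis vectors are killed. -/
def spinF (i : Fin n) : Matrix (SpinIdx n) (SpinIdx n) ℂ :=
  Matrix.of fun a b =>
    if h : i.val + 1 < n then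
      if b i = true ∧ b ⟨i.val + 1, h⟩ = false ∧
          a = Function.update (Function.update b i false) ⟨i.val + 1, h⟩ true then 1 else 0
    else
      if b i = true ∧ a = Function.update b i false then 1 else 0

/-- `e_i` on the spin representation: it turns `(-,+)` in positions `i, i+1` into `(+,-)` for
`i < n`, and `-` in position `n` into `+` for `i = n`; all other basis vectors are killed. -/
def spinE (i : Fin n) : Matrix (SpinIdx n) (SpinIdx n) ℂ :=
  Matrix.of fun a b =>
    if h : i.val + 1 < n then
      if b i = false ∧ b ⟨i.val + 1, h⟩ = true ∧
          a = Function.update (Function.update b i true) ⟨i.val + 1, h⟩ false then 1 else 0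
    else
      if b i = false ∧ a = Function.update b i true then 1 else 0

/-- The Chevalley generator `e_i` acting on `V(Λ_1) ⊕ V(Λ_n)`. -/
def genE (i : Fin n) : Matrix (Idx n) (Idx n) ℂ := Matrix.fromBlocks (vecE i) 0 0 (spinE i)

/-- The Chevalley generator `f_i` acting on `V(Λ_1) ⊕ V(Λ_n)`. -/
def genF (i : Fin n) : Matrix (Idx n) (Idx n) ℂ := Matrix.fromBlocks (vecF i) 0 0 (spinF i)

/-- The simple coroot `h_i = [e_i, f_i]`. -/
def genH (i : Fin n) : Matrix (Idx n) (Idx n) ℂ := ⁅genE i, genF i⁆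

variable (n) in
/-- The simple Lie algebra `𝔤` of type `B_n`, generated by the `e_i`, `f_i` in the faithful
representation `V(Λ_1) ⊕ V(Λ_n)`. -/
def lieAlg : LieSubalgebra ℂ (Matrix (Idx n) (Idx n) ℂ) :=
  LieSubalgebra.lieSpan ℂ (Matrix (Idx n) (Idx n) ℂ) (Set.range genE ∪ Set.range genF)

/-- The weight space `𝔤_α` (a root space if `α` is a root). -/
def rootSpace (α : Weight n) : Set (Matrix (Idx n) (Idx n) ℂ) :=
  {x | x ∈ lieAlg n ∧ ∀ i, ⁅genH i, x⁆ = (α i : ℂ) • x}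

/-- `α` is a nonzero combination of simple roots with nonnegative integer coefficients. -/
def IsPositive (α : Weight n) : Prop :=
  α ≠ 0 ∧ ∃ m : Fin n → ℕ, α = ∑ j, (m j : ℤ) • simpleRoot j

end Representation

section Group

variable {n : ℕ}

/-- The ambient group `GL(V(Λ_1) ⊕ V(Λ_n))`. -/
abbrev Ambient (n : ℕ) := (Matrix (Idx n) (Idx n) ℂ)ˣ

/-- The exponential of a matrix, as an invertible matrix. -/
noncomputable def expUnit (x : Matrix (Idx n) (Idx n) ℂ) : Ambient n := (Matrix.isUnit_exp x).unit

variable (n) in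
/-- The simply connected simple algebraic group `G` (that is, `Spin_{2n+1}(ℂ)`) of type `B_n`, as
the Chevalley group generated by all `exp (t e_i)`, `exp (t f_i)` in the representation
`V(Λ_1) ⊕ V(Λ_n)`, whose weights generate the whole weight lattice `P`. -/
noncomputable def grp : Subgroup (Ambient n) :=
  Subgroup.closure {g | ∃ (i : Fin n) (t : ℂ), g = expUnit (t • genE i) ∨ g = expUnit (t • genF i)}

/-- `x_i(t) = exp (t e_i)`. -/
noncomputable def x (i : Fin n) (t : ℂ) : grp n :=
  ⟨expUnit (t • genE i), Subgroup.subset_closure ⟨i, t, Or.inl rfl⟩⟩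

/-- `y_i(t) = exp (t f_i)`. -/
noncomputable def y (i : Fin n) (t : ℂ) : grp n :=
  ⟨expUnit (t • genF i), Subgroup.subset_closure ⟨i, t, Or.inr rfl⟩⟩

/-- `α_i^∨(c) = φ_i(diag(c, c⁻¹))`, where `φ_i : SL₂ → G` sends the elementary upper and lower
unitriangular matrices with entry `t` to `x_i(t)` and `y_i(t)`.  In `SL₂`, with
`x t = !![1, t; 0, 1]` and `y t = !![1, 0; t, 1]`,
`diag(c, c⁻¹) = x c * y (-c⁻¹) * x c * x (-1) * y 1 * x (-1)`. -/
noncomputable def coroot (i : Fin n) (c : ℂˣ) : grp n :=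
  x i (c : ℂ) * y i (-(c : ℂ)⁻¹) * x i (c : ℂ) * x i (-1) * y i 1 * x i (-1)

/-- The element `∏ α_i^∨(c_i)` of the maximal torus `T`; as `G` is simply connected, every element
of `T` has exactly one such expression. -/
noncomputable def torus (c : Fin n → ℂˣ) : grp n := (List.ofFn fun i => coroot i (c i)).prod

variable (n) in
/-- `U = U⁺`, generated by the root subgroups `exp 𝔤_α` for positive `α`. -/
noncomputable def unipPos : Subgroup (Ambient n) :=
  Subgroup.closure {g | ∃ α, IsPositive α ∧ ∃ z ∈ rootSpace α, g = expUnit z}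

variable (n) in
/-- `U⁻`, generated by the root subgroups `exp 𝔤_{-α}` for positive `α`. -/
noncomputable def unipNeg : Subgroup (Ambient n) :=
  Subgroup.closure {g | ∃ α, IsPositive α ∧ ∃ z ∈ rootSpace (-α), g = expUnit z}

/-- Regular functions on `G`: polynomials in the matrix entries (the determinant is `1` on `G`). -/
def IsRegular (f : grp n → ℂ) : Prop :=
  ∃ p : MvPolynomial (Idx n × Idx n) ℂ,
    ∀ g : grp n, f g = MvPolynomial.eval (fun ab => (g : Ambient n).val ab.1 ab.2) p

/-- `D` is the principal minor `Δ_μ`: the regular function on `G` with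
`Δ_μ (u⁻ t u⁺) = μ(t)` for `u^± ∈ U^±`, `t ∈ T`.  Here `μ(∏ α_i^∨(c_i)) = ∏ c_i ^ ⟨h_i, μ⟩`. -/
def IsPrincipalMinor (μ : Weight n) (D : grp n → ℂ) : Prop :=
  IsRegular D ∧
    ∀ (g : grp n) (c : Fin n → ℂˣ), ∀ u ∈ unipNeg n, ∀ v ∈ unipPos n,
      (g : Ambient n) = u * (torus c : Ambient n) * v → D g = ∏ i, (c i : ℂ) ^ μ i

open Classical in
/-- The principal minor `Δ_μ` (for dominant `μ`). -/
noncomputable def principalMinor (μ : Weight n) : grp n → ℂ :=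
  if h : ∃ D, IsPrincipalMinor μ D then h.choose else 0

/-- `\bar s_i = x_i(-1) y_i(1) x_i(-1)`. -/
noncomputable def sBar (i : Fin n) : grp n := x i (-1) * y i 1 * x i (-1)

/-- The representative `\bar w = \bar s_{i_1} ⋯ \bar s_{i_l}` of `w`, for a reduced word
`i_1 ⋯ i_l` of `w`. -/
noncomputable def lift (w : weylGroup n) : grp n := ((reducedWord w).map sBar).prod

open Classical in
/-- The generalized minor `Δ_{γ,δ}(g) = Δ_μ(\bar u⁻¹ g \bar v)`, where `γ = u μ`, `δ = v μ` with
`u, v` in the Weyl group. -/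
noncomputable def genMinor (μ γ δ : Weight n) (g : grp n) : ℂ :=
  if h : (∃ u : weylGroup n, u.1 μ = γ) ∧ ∃ v : weylGroup n, v.1 μ = δ then
    principalMinor μ ((lift h.1.choose)⁻¹ * g * lift h.2.choose)
  else 0

/-- `𝐲_i(c) = y_i(c) α_i^∨(c⁻¹)`. -/
noncomputable def yBold (i : Fin n) (c : ℂˣ) : grp n := y i (c : ℂ) * coroot i c⁻¹

/-- `Θ⁻_{𝐢₀}(c)` for `𝐢₀ = (1 2 ⋯ n)^n`: the product over `p = 1, …, n` (in this order) of
`𝐲_1(c^{(p)}_1) 𝐲_2(c^{(p)}_2) ⋯ 𝐲_n(c^{(p)}_n)`.  The variable `c^{(p)}_i` is `c p i`, with both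
indices shifted to start from `0`. -/
noncomputable def theta (c : Fin n → Fin n → ℂˣ) : grp n :=
  (List.ofFn fun p => (List.ofFn fun i => yBold i (c p i)).prod).prod

end Group

end TypeB

/-! Indices here start from 1, as in the theorem. For k < n one has Λ_k = ε_1 + … + ε_k, and v_1 ∧ …
∧ v_k is a highest weight vector of weight Λ_k in the k-th exterior power of the vector
representation V(Λ_1). So Δ_{Λ_k} is the leading k × k minor in V(Λ_1). Since w₀ acts as −1, the
weight w₀ s_k Λ_k is −(ε_1 + … + ε_{k−1} + ε_{k+1}), and the generalized minor is, without any sign,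
the minor of Θ⁻ with rows v_{\overline{k+1}}, v_{\overline{k−1}}, …, v_{\bar 1} and columns v_1, …,
v_k.

Principal minors, Weyl group elements and reduced words are all chosen arbitrarily in the
definitions, so this identification needs two independence statements. `IsPrincipalMinor.unique` is
the density of the open cell U⁻TU⁺, obtained from the identity theorem along entire curves.
`det_signWord` says that the lift of w along any reduced word carries v_1 ∧ … ∧ v_k to the wedge of
the basis vectors of weight in w{ε_1, …, ε_k}, in increasing order and with sign +1. It rests on the
exchange condition, proved in the model of signed permutations.

The minor is then computed block by block. Let b_p(j) be the row v_{\bar j} of the product of the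
blocks p, …, n, and put c^{(p)}_0 = 1. One block gives c^{(p)}_{j−1} b_p(j) = c^{(p)}_j (b_{p+1}(j)
+ b_p(j+1)) for j < n (`block_bar`). The entries of b_p(j) in the columns m < p vanish, and the
entry in column p is 1 / c^{(p)}_{j−1} (`thetaTail_bar_step`). Row operations based on the relation
clear column p below the top row (`stairMinor_succ`). Expansion along that column leaves one ratio
c^{(p)}_{i}/c^{(p)}_{i+1} plus the same kind of minor, one size smaller, for p + 1; the ratio is
multiplied by a minor without a gap in its rows, which equals 1 (`stairMinor_eq_one`). The last 1 ×
1 minor is 1 / c^{(k)}_1. -/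

namespace TypeB

/-! ### Identities of SL₂ for exponentials of nilpotent matrices -/

section SlTwo

variable {α β : Type*} [Fintype α] [DecidableEq α] [Fintype β] [DecidableEq β]

/-- The exponential of `a • e` when `e ^ 3 = 0`. -/
noncomputable def expQuad (e : Matrix α α ℂ) (a : ℂ) : Matrix α α ℂ :=
  1 + a • e + (a ^ 2 / 2) • (e * e)

/-- The diagonal matrix with entries `c ^ d b`. -/
noncomputable def diagPow (d : α → ℤ) (c : ℂ) : Matrix α α ℂ :=
  Matrix.diagonal fun b => c ^ d b

/-- `e`, `f` span with `diag d` a copy of `𝔰𝔩₂` whose simple constituents have dimension at most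
`3`, and the identities of `SL₂` hold for the exponentials. -/
structure IsSlTwo (e f : Matrix α α ℂ) (d : α → ℤ) : Prop where
  e_cube : e * e * e = 0
  f_cube : f * f * f = 0
  bracket : e * f - f * e = Matrix.diagonal fun b => (d b : ℂ)
  weyl : ∀ c : ℂ, c ≠ 0 → expQuad e c * expQuad f (-c⁻¹) * expQuad e c * expQuad e (-1) *
    expQuad f 1 * expQuad e (-1) = diagPow d c
  gauss : ∀ a t : ℂ, 1 + a * t ≠ 0 → expQuad e a * expQuad f t =
    expQuad f (t / (1 + a * t)) * diagPow d (1 + a * t) * expQuad e (a / (1 + a * t))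

theorem expQuad_fromBlocks (e : Matrix α α ℂ) (e' : Matrix β β ℂ) (a : ℂ) :
    expQuad (Matrix.fromBlocks e 0 0 e') a =
      Matrix.fromBlocks (expQuad e a) 0 0 (expQuad e' a) := by
  simp only [expQuad, Matrix.fromBlocks_multiply, Matrix.fromBlocks_smul, ← Matrix.fromBlocks_one,
    Matrix.fromBlocks_add]
  simp

theorem IsSlTwo.fromBlocks {e f : Matrix α α ℂ} {d : α → ℤ} {e' f' : Matrix β β ℂ} {d' : β → ℤ}
    (h : IsSlTwo e f d) (h' : IsSlTwo e' f' d') :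
    IsSlTwo (Matrix.fromBlocks e 0 0 e') (Matrix.fromBlocks f 0 0 f') (Sum.elim d d') := by
  have hd : ∀ c, diagPow (Sum.elim d d') c =
      Matrix.fromBlocks (diagPow d c) 0 0 (diagPow d' c) := by
    intro c
    rw [diagPow, diagPow, diagPow, Matrix.fromBlocks_diagonal]
    congr 1
    ext (b | b) <;> rfl
  constructor
  · simp [Matrix.fromBlocks_multiply, h.e_cube, h'.e_cube]
  · simp [Matrix.fromBlocks_multiply, h.f_cube, h'.f_cube]
  · simp only [Matrix.fromBlocks_multiply, sub_eq_add_neg,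
      Matrix.fromBlocks_neg, Matrix.fromBlocks_add]
    simp only [Matrix.mul_zero, Matrix.zero_mul, add_zero, zero_add, neg_zero, ← sub_eq_add_neg,
      h.bracket, h'.bracket, Matrix.fromBlocks_diagonal]
    congr 1
    ext (b | b) <;> rfl
  · intro c hc
    simp only [expQuad_fromBlocks, Matrix.fromBlocks_multiply, Matrix.mul_zero, Matrix.zero_mul,
      add_zero, zero_add, hd, h.weyl c hc, h'.weyl c hc]
  · intro a t hat
    simp only [expQuad_fromBlocks, Matrix.fromBlocks_multiply, Matrix.mul_zero, Matrix.zero_mul,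
      add_zero, zero_add, hd, h.gauss a t hat, h'.gauss a t hat]

/-! ### Sums of trivial and two-dimensional representations of SL₂ -/

section Small

variable {e f : Matrix α α ℂ}

/-- The copy of the algebra of `2 × 2` matrices spanned by `e`, `f`, `ef`, `fe`. -/
def unitsTwo (e f : Matrix α α ℂ) (A : Matrix (Fin 2) (Fin 2) ℂ) : Matrix α α ℂ :=
  A 0 0 • (e * f) + A 0 1 • e + A 1 0 • f + A 1 1 • (f * e)

theorem unitsTwo_mul (he : e * e = 0) (hf : f * f = 0) (hefe : e * f * e = e)
    (hfef : f * e * f = f) (A B : Matrix (Fin 2) (Fin 2) ℂ) :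
    unitsTwo e f A * unitsTwo e f B = unitsTwo e f (A * B) := by
  have h1 : ∀ z, e * (e * z) = 0 := fun z => by rw [← mul_assoc, he, zero_mul]
  have h2 : ∀ z, f * (f * z) = 0 := fun z => by rw [← mul_assoc, hf, zero_mul]
  have h3 : e * (f * e) = e := by rw [← mul_assoc, hefe]
  have h4 : f * (e * f) = f := by rw [← mul_assoc, hfef]
  simp only [unitsTwo, add_mul, mul_add, smul_mul_assoc, mul_smul_comm, mul_assoc, he, hf, h1, h2,
    h3, h4, Matrix.mul_apply, Fin.sum_univ_two, mul_zero]
  module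

/-- The multiplicative map `unitsTwo` sends 1 to the idempotent ef + fe only. Adding the
complementary idempotent makes it unital, so every identity between 2 × 2 matrices transfers. -/
theorem one_add_unitsTwo_mul (he : e * e = 0) (hf : f * f = 0) (hefe : e * f * e = e)
    (hfef : f * e * f = f) (A B : Matrix (Fin 2) (Fin 2) ℂ) :
    (1 + unitsTwo e f (A - 1)) * (1 + unitsTwo e f (B - 1)) = 1 + unitsTwo e f (A * B - 1) := by
  have h : A * B - 1 = (A - 1) * (B - 1) + (A - 1) + (B - 1) := by noncomm_ring
  have hadd : ∀ A B, unitsTwo e f (A + B) = unitsTwo e f A + unitsTwo e f B := by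
    intro A B
    simp only [unitsTwo, Matrix.add_apply]
    module
  rw [h, hadd, hadd, ← unitsTwo_mul he hf hefe hfef]
  noncomm_ring

theorem expQuad_e_two (he : e * e = 0) (a : ℂ) :
    expQuad e a = 1 + unitsTwo e f (!![1, a; 0, 1] - 1) := by
  simp [expQuad, unitsTwo, he]

theorem expQuad_f_two (hf : f * f = 0) (a : ℂ) :
    expQuad f a = 1 + unitsTwo e f (!![1, 0; a, 1] - 1) := by
  simp [expQuad, unitsTwo, hf]

/-- All weights being −1, 0 or 1, the torus element is the image of diag(c, c⁻¹), and both SL₂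
identities become computations with 2 × 2 matrices. -/
theorem isSlTwo_of_small (he : e * e = 0) (hf : f * f = 0) (hefe : e * f * e = e)
    (hfef : f * e * f = f) {d : α → ℤ} (hd : ∀ b, d b = -1 ∨ d b = 0 ∨ d b = 1)
    (hef : e * f = Matrix.diagonal fun b => if d b = 1 then 1 else 0)
    (hfe : f * e = Matrix.diagonal fun b => if d b = -1 then 1 else 0) : IsSlTwo e f d := by
  have hD : ∀ c : ℂ, c ≠ 0 → diagPow d c = 1 + unitsTwo e f (!![c, 0; 0, c⁻¹] - 1) := by
    intro c hc
    simp only [diagPow, unitsTwo, hef, hfe]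
    ext a b
    by_cases hab : a = b
    · subst hab
      rcases hd a with h | h | h <;> simp [h]
    · simp [hab]
  have hm := one_add_unitsTwo_mul he hf hefe hfef
  constructor
  · rw [he, zero_mul]
  · rw [hf, zero_mul]
  · rw [hef, hfe, Matrix.diagonal_sub]
    congr 1
    ext b
    rcases hd b with h | h | h <;> simp [h]
  · intro c hc
    simp only [hD c hc, expQuad_e_two (f := f) he, expQuad_f_two (e := e) hf, hm]
    congr 3
    ext i j
    fin_cases i <;> fin_cases j <;> simp [Matrix.mul_apply, Fin.sum_univ_two] <;> field_simp <;>
      ring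
  · intro a t hat
    have hat' : 1 + t * a ≠ 0 := by rwa [mul_comm t]
    simp only [hD _ hat, expQuad_e_two (f := f) he, expQuad_f_two (e := e) hf, hm]
    congr 3
    ext i j
    fin_cases i <;> fin_cases j <;> simp [Matrix.mul_apply, Fin.sum_univ_two] <;> field_simp <;>
      ring

end Small

/-! ### Raising and lowering operators given by an involution of the weights -/

section PartialInvolution

variable {σ : α → α} {d : α → ℤ}

/-- The raising operator attached to an involution that negates weights. -/
def raise (σ : α → α) (d : α → ℤ) : Matrix α α ℂ :=
  Matrix.of fun a b => if d b = -1 ∧ a = σ b then 1 else 0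

/-- The lowering operator attached to an involution that negates weights. -/
def lower (σ : α → α) (d : α → ℤ) : Matrix α α ℂ :=
  Matrix.of fun a b => if d b = 1 ∧ a = σ b then 1 else 0

theorem mul_raise_apply (A : Matrix α α ℂ) (a : α) (b : α) :
    (A * raise σ d) a b = if d b = -1 then A a (σ b) else 0 := by
  simp only [Matrix.mul_apply, raise, Matrix.of_apply]
  split_ifs with h <;> simp [h]

theorem mul_lower_apply (A : Matrix α α ℂ) (a : α) (b : α) :
    (A * lower σ d) a b = if d b = 1 then A a (σ b) else 0 := by
  simp only [Matrix.mul_apply, lower, Matrix.of_apply]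
  split_ifs with h <;> simp [h]

theorem raise_mul_lower (hσ : ∀ b, σ (σ b) = b) (hdσ : ∀ b, d (σ b) = -d b) :
    raise σ d * lower σ d = Matrix.diagonal fun b => if d b = 1 then 1 else 0 := by
  ext a b
  rw [mul_lower_apply]
  by_cases hab : a = b
  · subst hab
    simp +contextual [raise, hσ, hdσ]
  · simp [raise, hab, hσ]

theorem lower_mul_raise (hσ : ∀ b, σ (σ b) = b) (hdσ : ∀ b, d (σ b) = -d b) :
    lower σ d * raise σ d = Matrix.diagonal fun b => if d b = -1 then 1 else 0 := by
  ext a b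
  rw [mul_raise_apply]
  by_cases hab : a = b
  · subst hab
    simp +contextual [lower, hσ, hdσ]
  · simp [lower, hab, hσ]

theorem raise_mul_raise (hdσ : ∀ b, d (σ b) = -d b) : raise σ d * raise σ d = 0 := by
  ext a b
  rw [mul_raise_apply]
  split_ifs with h
  · simp [raise, hdσ, h]
  · simp

theorem lower_mul_lower (hdσ : ∀ b, d (σ b) = -d b) : lower σ d * lower σ d = 0 := by
  ext a b
  rw [mul_lower_apply]
  split_ifs with h
  · simp [lower, hdσ, h]
  · simp

theorem raise_mul_lower_mul_raise (hσ : ∀ b, σ (σ b) = b) (hdσ : ∀ b, d (σ b) = -d b) :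
    raise σ d * lower σ d * raise σ d = raise σ d := by
  rw [raise_mul_lower hσ hdσ]
  ext a b
  simp only [Matrix.diagonal_mul, raise, Matrix.of_apply]
  split_ifs with h1 h2 h2 <;> simp_all

theorem lower_mul_raise_mul_lower (hσ : ∀ b, σ (σ b) = b) (hdσ : ∀ b, d (σ b) = -d b) :
    lower σ d * raise σ d * lower σ d = lower σ d := by
  rw [lower_mul_raise hσ hdσ]
  ext a b
  simp only [Matrix.diagonal_mul, lower, Matrix.of_apply]
  split_ifs with h1 h2 h2 <;> simp_all

theorem isSlTwo_raise_lower (hσ : ∀ b, σ (σ b) = b) (hdσ : ∀ b, d (σ b) = -d b)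
    (hd : ∀ b, d b = -1 ∨ d b = 0 ∨ d b = 1) :
    IsSlTwo (raise σ d) (lower σ d) d := by
  exact isSlTwo_of_small (raise_mul_raise hdσ) (lower_mul_lower hdσ)
    (raise_mul_lower_mul_raise hσ hdσ) (lower_mul_raise_mul_lower hσ hdσ) hd
    (raise_mul_lower hσ hdσ) (lower_mul_raise hσ hdσ)

end PartialInvolution

/-! ### The adjoint representation of SL₂ as a block -/

section Adjoint

/-- The copy of the algebra of `3 × 3` matrices on the basis vectors indexed by the range of `ι`. -/
def unitsThree (ι : Fin 3 → α) (A : Matrix (Fin 3) (Fin 3) ℂ) : Matrix α α ℂ :=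
  (Matrix.of fun a m => if a = ι m then (1 : ℂ) else 0) * A *
    (Matrix.of fun m a => if a = ι m then (1 : ℂ) else 0)

variable {ι : Fin 3 → α}

theorem unitsThree_apply (A : Matrix (Fin 3) (Fin 3) ℂ) (a b : α) :
    unitsThree ι A a b =
      ∑ m', (∑ m, if a = ι m then A m m' else 0) * if b = ι m' then 1 else 0 := by
  simp [unitsThree, Matrix.mul_apply]

theorem unitsThree_mul (hι : Function.Injective ι) (A B : Matrix (Fin 3) (Fin 3) ℂ) :
    unitsThree ι A * unitsThree ι B = unitsThree ι (A * B) := by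
  have h : (Matrix.of fun (m : Fin 3) (a : α) => if a = ι m then (1 : ℂ) else 0) *
      (Matrix.of fun (a : α) (m : Fin 3) => if a = ι m then (1 : ℂ) else 0) = 1 := by
    ext m m'
    simp [Matrix.mul_apply, Matrix.one_apply, hι.eq_iff, eq_comm]
  simp only [unitsThree]
  rw [Matrix.mul_assoc, ← Matrix.mul_assoc _ (_ * B), ← Matrix.mul_assoc _ _ B, h, Matrix.one_mul]
  simp only [Matrix.mul_assoc]

theorem unitsThree_add (A B : Matrix (Fin 3) (Fin 3) ℂ) :
    unitsThree ι (A + B) = unitsThree ι A + unitsThree ι B := by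
  simp [unitsThree, Matrix.mul_add, Matrix.add_mul]

theorem one_add_unitsThree_mul (hι : Function.Injective ι) (A B : Matrix (Fin 3) (Fin 3) ℂ) :
    (1 + unitsThree ι (A - 1)) * (1 + unitsThree ι (B - 1)) = 1 + unitsThree ι (A * B - 1) := by
  have h : A * B - 1 = (A - 1) * (B - 1) + (A - 1) + (B - 1) := by noncomm_ring
  rw [h, unitsThree_add, unitsThree_add, ← unitsThree_mul hι]
  noncomm_ring

theorem unitsThree_smul (c : ℂ) (A : Matrix (Fin 3) (Fin 3) ℂ) :
    unitsThree ι (c • A) = c • unitsThree ι A := by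
  simp [unitsThree]

theorem expQuad_unitsThree (hι : Function.Injective ι) (A : Matrix (Fin 3) (Fin 3) ℂ) (a : ℂ) :
    expQuad (unitsThree ι A) a = 1 + unitsThree ι (expQuad A a - 1) := by
  rw [expQuad, unitsThree_mul hι, expQuad, add_assoc, add_assoc, add_sub_cancel_left,
    unitsThree_add, unitsThree_smul, unitsThree_smul]

theorem expQuad_raiseThree (a : ℂ) : expQuad !![0, 2, 0; 0, 0, 1; 0, 0, 0] a =
    !![1, 2 * a, a ^ 2; 0, 1, a; 0, 0, 1] := by
  ext i j
  fin_cases i <;> fin_cases j <;> simp [expQuad, mul_comm, mul_div_cancel₀]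

theorem expQuad_lowerThree (a : ℂ) : expQuad !![0, 0, 0; 1, 0, 0; 0, 2, 0] a =
    !![1, 0, 0; a, 1, 0; a ^ 2, 2 * a, 1] := by
  ext i j
  fin_cases i <;> fin_cases j <;> simp [expQuad, mul_comm, mul_div_cancel₀]

/-- The constant off the block is x = 1 for torus elements and x = 0 for the coroot. -/
theorem diagonal_eq_unitsThree (hι : Function.Injective ι) {v : α → ℂ} (w : Fin 3 → ℂ)
    (hw : ∀ m, v (ι m) = w m) (x : ℂ) (hv : ∀ b, b ∉ Set.range ι → v b = x) :
    Matrix.diagonal v = x • 1 + unitsThree ι (Matrix.diagonal w - x • 1) := by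
  ext a b
  have hr : ∀ b, b ∉ Set.range ι → ∀ m, b ≠ ι m := fun b hb m h => hb ⟨m, h.symm⟩
  by_cases hb : b ∈ Set.range ι
  · obtain ⟨m, rfl⟩ := hb
    by_cases ha : a ∈ Set.range ι
    · obtain ⟨m', rfl⟩ := ha
      by_cases hmm : m' = m
      · subst hmm
        simp [unitsThree_apply, hι.eq_iff, hw]
      · simp [unitsThree_apply, hι.eq_iff, hmm]
    · have := hr a ha
      simp [unitsThree_apply, this]
  · have h1 := hr b hb
    by_cases hab : a = b
    · subst hab
      simp [unitsThree_apply, h1, hv a hb]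
    · simp [unitsThree_apply, h1, hab]

/-- The block is the adjoint representation, with torus eigenvalues c², 1, c⁻²; the identities
transfer from 3 × 3 matrices as in the two-dimensional case. -/
theorem isSlTwo_unitsThree (hι : Function.Injective ι) {d : α → ℤ} (h0 : d (ι 0) = 2)
    (h1 : d (ι 1) = 0) (h2 : d (ι 2) = -2) (hd : ∀ b, b ∉ Set.range ι → d b = 0) :
    IsSlTwo (unitsThree ι !![0, 2, 0; 0, 0, 1; 0, 0, 0])
      (unitsThree ι !![0, 0, 0; 1, 0, 0; 0, 2, 0]) d := by
  have hz : unitsThree ι 0 = 0 := by simp [unitsThree]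
  have hD : ∀ c : ℂ, diagPow d c = 1 + unitsThree ι (!![c ^ 2, 0, 0; 0, 1, 0; 0, 0, c⁻¹ ^ 2] - 1) := by
    intro c
    have := diagonal_eq_unitsThree hι (v := fun b => c ^ d b) ![c ^ 2, 1, c⁻¹ ^ 2]
      (by intro m; fin_cases m <;> simp [h0, h1, h2]) 1
      (by intro b hb; simp [hd b hb])
    rw [diagPow, this, one_smul, one_smul]
    congr 3
    ext i j
    fin_cases i <;> fin_cases j <;> simp
  constructor
  · rw [unitsThree_mul hι, unitsThree_mul hι, ← hz]
    congr 1
    ext i j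
    fin_cases i <;> fin_cases j <;> simp
  · rw [unitsThree_mul hι, unitsThree_mul hι, ← hz]
    congr 1
    ext i j
    fin_cases i <;> fin_cases j <;> simp
  · have := diagonal_eq_unitsThree hι (v := fun b => (d b : ℂ)) ![2, 0, -2]
      (by intro m; fin_cases m <;> simp [h0, h1, h2]) 0
      (by intro b hb; simp [hd b hb])
    rw [this, unitsThree_mul hι, unitsThree_mul hι, sub_eq_iff_eq_add, zero_smul, zero_add,
      ← unitsThree_add]
    congr 1
    ext i j
    fin_cases i <;> fin_cases j <;> simp
  · intro c hc
    simp only [hD c, expQuad_unitsThree hι, expQuad_raiseThree, expQuad_lowerThree,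
      one_add_unitsThree_mul hι]
    congr 3
    ext i j
    fin_cases i <;> fin_cases j <;> simp <;> field_simp <;> ring
  · intro a t hat
    have hat' : 1 + t * a ≠ 0 := by rwa [mul_comm t]
    simp only [hD _, expQuad_unitsThree hι, expQuad_raiseThree, expQuad_lowerThree,
      one_add_unitsThree_mul hι]
    congr 3
    ext i j
    fin_cases i <;> fin_cases j <;> simp <;> field_simp <;> ring

end Adjoint

end SlTwo

/-! ### Weights and Chevalley generators of the vector and spin representations -/

variable {n : ℕ}

/-- The coordinates `⟨h_i, wt v⟩` for the basis vectors of `V(Λ_1)`. -/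
def vecWt (i : Fin n) : VecIdx n → ℤ
  | .inl j => if j = i then (if i.val + 1 < n then 1 else 2) else if j.val = i.val + 1 then -1 else 0
  | .inr (.inl _) => 0
  | .inr (.inr j) =>
    -(if j = i then (if i.val + 1 < n then 1 else 2) else if j.val = i.val + 1 then -1 else 0)

/-- The coordinates `⟨h_i, wt v⟩` for the basis vectors of `V(Λ_n)`. -/
def spinWt (i : Fin n) (b : SpinIdx n) : ℤ :=
  if h : i.val + 1 < n then
    (if b i then 1 else 0) - (if b ⟨i.val + 1, h⟩ then 1 else 0)
  else if b i then 1 else -1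

/-- The weight of a basis vector of `V(Λ_1) ⊕ V(Λ_n)`. -/
def wt (b : Idx n) : Weight n := fun i => Sum.elim (vecWt i) (spinWt i) b

/-- The permutation of the index set `I` attached to a simple reflection. -/
def nodeSwap (i : Fin n) : Equiv.Perm (Fin n) :=
  if h : i.val + 1 < n then Equiv.swap i ⟨i.val + 1, h⟩ else 1

/-- The permutation of the weights of `V(Λ_1)` attached to a simple reflection. -/
def vecSwap (i : Fin n) : VecIdx n → VecIdx n
  | .inl j => if i.val + 1 < n then .inl (nodeSwap i j) else if j = i then .inr (.inr j) else .inl j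
  | .inr (.inl u) => .inr (.inl u)
  | .inr (.inr j) =>
    if i.val + 1 < n then .inr (.inr (nodeSwap i j)) else if j = i then .inl j else .inr (.inr j)

/-- The permutation of the weights of `V(Λ_n)` attached to a simple reflection. -/
def spinSwap (i : Fin n) (b : SpinIdx n) : SpinIdx n :=
  if i.val + 1 < n then b ∘ nodeSwap i else Function.update b i (!b i)

theorem nodeSwap_nodeSwap (i j : Fin n) : nodeSwap i (nodeSwap i j) = j := by
  unfold nodeSwap
  split_ifs <;> simp

theorem nodeSwap_apply {i : Fin n} (h : i.val + 1 < n) (j : Fin n) :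
    nodeSwap i j = if j = i then ⟨i.val + 1, h⟩ else if j.val = i.val + 1 then i else j := by
  simp [nodeSwap, h, Equiv.swap_apply_def, Fin.ext_iff]

theorem vecSwap_vecSwap (i : Fin n) (b : VecIdx n) : vecSwap i (vecSwap i b) = b := by
  rcases b with j | u | j
  · unfold vecSwap
    by_cases h : i.val + 1 < n
    · simp [h, nodeSwap_nodeSwap]
    · by_cases hj : j = i <;> simp [h, hj]
  · rfl
  · unfold vecSwap
    by_cases h : i.val + 1 < n
    · simp [h, nodeSwap_nodeSwap]
    · by_cases hj : j = i <;> simp [h, hj]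

theorem spinSwap_spinSwap (i : Fin n) (b : SpinIdx n) : spinSwap i (spinSwap i b) = b := by
  unfold spinSwap
  split_ifs with h
  · ext j
    simp [nodeSwap_nodeSwap]
  · simp

theorem vecWt_inr (i j : Fin n) : vecWt i (.inr (.inr j)) = -vecWt i (.inl j) := rfl

theorem vecWt_nodeSwap {i : Fin n} (h : i.val + 1 < n) (j : Fin n) :
    vecWt i (.inl (nodeSwap i j)) = -vecWt i (.inl j) := by
  have hi : (⟨i.val + 1, h⟩ : Fin n) ≠ i := by simp [Fin.ext_iff]
  by_cases h1 : j = i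
  · simp [vecWt, nodeSwap_apply h, h, h1, hi]
  · by_cases h2 : j.val = i.val + 1
    · simp [vecWt, nodeSwap_apply h, h, h1, h2]
    · simp [vecWt, nodeSwap_apply h, h1, h2]

theorem vecWt_vecSwap (i : Fin n) (b : VecIdx n) : vecWt i (vecSwap i b) = -vecWt i b := by
  rcases b with j | u | j
  · by_cases h : i.val + 1 < n
    · simp only [vecSwap, h, if_true, vecWt_nodeSwap h]
    · by_cases hj : j = i
      · simp [vecSwap, h, hj, vecWt_inr]
      · have : j.val ≠ i.val + 1 := by omega
        simp [vecSwap, vecWt, h, hj, this]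
  · rfl
  · by_cases h : i.val + 1 < n
    · simp only [vecSwap, h, if_true, vecWt_inr, vecWt_nodeSwap h]
    · by_cases hj : j = i
      · simp [vecSwap, h, hj, vecWt_inr]
      · have : j.val ≠ i.val + 1 := by omega
        simp [vecSwap, vecWt, h, hj, this]

theorem spinWt_spinSwap (i : Fin n) (b : SpinIdx n) : spinWt i (spinSwap i b) = -spinWt i b := by
  by_cases h : i.val + 1 < n
  · have hi : (⟨i.val + 1, h⟩ : Fin n) ≠ i := by simp [Fin.ext_iff]
    simp [spinSwap, spinWt, h, nodeSwap_apply h, hi]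
  · simp only [spinSwap, spinWt, h]
    cases b i <;> simp

theorem vecE_eq_raise {i : Fin n} (h : i.val + 1 < n) : vecE i = raise (vecSwap i) (vecWt i) := by
  have hn : i.val + 1 ≠ n := by omega
  ext a b
  rcases b with j | u | j <;> rcases a with k | u' | k <;>
    simp only [vecE, raise, Matrix.of_apply, vecSwap, vecWt, h, hn, nodeSwap_apply h] <;>
    simp [Fin.ext_iff]
  all_goals split_ifs <;> simp_all

theorem vecF_eq_lower {i : Fin n} (h : i.val + 1 < n) : vecF i = lower (vecSwap i) (vecWt i) := by
  have hn : i.val + 1 ≠ n := by omega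
  ext a b
  rcases b with j | u | j <;> rcases a with k | u' | k <;>
    simp only [vecF, lower, Matrix.of_apply, vecSwap, vecWt, h, hn, nodeSwap_apply h] <;>
    simp [Fin.ext_iff]
  all_goals split_ifs <;> simp_all

theorem spinE_eq_raise (i : Fin n) : spinE i = raise (spinSwap i) (spinWt i) := by
  ext a b
  by_cases h : i.val + 1 < n
  · simp only [spinE, raise, Matrix.of_apply, spinSwap, spinWt, h, dif_pos, if_true]
    have hi : (⟨i.val + 1, h⟩ : Fin n) ≠ i := by simp [Fin.ext_iff]
    cases h1 : b i <;> cases h2 : b ⟨i.val + 1, h⟩ <;> simp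
    congr 1
    apply propext
    apply Eq.congr_right
    ext j
    simp only [Function.update_apply, Function.comp_apply, nodeSwap_apply h, Fin.ext_iff]
    split_ifs <;> simp_all
  · simp only [spinE, raise, Matrix.of_apply, spinSwap, spinWt, h]
    cases h1 : b i <;> simp

theorem spinF_eq_lower (i : Fin n) : spinF i = lower (spinSwap i) (spinWt i) := by
  ext a b
  by_cases h : i.val + 1 < n
  · simp only [spinF, lower, Matrix.of_apply, spinSwap, spinWt, h, dif_pos, if_true]
    have hi : (⟨i.val + 1, h⟩ : Fin n) ≠ i := by simp [Fin.ext_iff]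
    cases h1 : b i <;> cases h2 : b ⟨i.val + 1, h⟩ <;> simp
    congr 1
    apply propext
    apply Eq.congr_right
    ext j
    simp only [Function.update_apply, Function.comp_apply, nodeSwap_apply h, Fin.ext_iff]
    split_ifs <;> simp_all
  · simp only [spinF, lower, Matrix.of_apply, spinSwap, spinWt, h]
    cases h1 : b i <;> simp

/-- The basis vectors `v_n`, `v_0`, `v_{n̄}`. -/
def shortNode (i : Fin n) : Fin 3 → VecIdx n := ![.inl i, .inr (.inl ()), .inr (.inr i)]

theorem shortNode_injective (i : Fin n) : Function.Injective (shortNode i) := by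
  intro a b h
  fin_cases a <;> fin_cases b <;> simp_all [shortNode]

theorem vecE_eq_unitsThree {i : Fin n} (h : i.val + 1 = n) :
    vecE i = unitsThree (shortNode i) !![0, 2, 0; 0, 0, 1; 0, 0, 0] := by
  ext a b
  rw [unitsThree_apply]
  rcases b with j | u | j <;> rcases a with k | u' | k <;>
    simp [vecE, shortNode, Fin.sum_univ_three, h, and_comm] <;> omega

theorem vecF_eq_unitsThree {i : Fin n} (h : i.val + 1 = n) :
    vecF i = unitsThree (shortNode i) !![0, 0, 0; 1, 0, 0; 0, 2, 0] := by
  ext a b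
  rw [unitsThree_apply]
  rcases b with j | u | j <;> rcases a with k | u' | k <;>
    simp [vecF, shortNode, Fin.sum_univ_three, h, and_comm] <;> omega

/-- For a long simple root all weights are −1, 0 or 1 and the reflection permutes the basis. For the
short one, v_n, v_0, v_{n̄} span an adjoint block and all other basis vectors are fixed. -/
theorem isSlTwo_vec (i : Fin n) : IsSlTwo (vecE i) (vecF i) (vecWt i) := by
  by_cases h : i.val + 1 < n
  · rw [vecE_eq_raise h, vecF_eq_lower h]
    refine isSlTwo_raise_lower (vecSwap_vecSwap i) (vecWt_vecSwap i) ?_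
    rintro (j | u | j) <;> simp only [vecWt, h, if_true]
    · split_ifs <;> simp
    · simp
    · split_ifs <;> simp
  · have h' : i.val + 1 = n := by omega
    rw [vecE_eq_unitsThree h', vecF_eq_unitsThree h']
    refine isSlTwo_unitsThree (shortNode_injective i) ?_ ?_ ?_ ?_
    · simp [shortNode, vecWt, h]
    · simp [shortNode, vecWt]
    · simp [shortNode, vecWt, h]
    · have hlast : ∀ j : Fin n, j.val ≠ i.val + 1 := by omega
      rintro (j | u | j) hb
      · have : j ≠ i := fun hj => hb ⟨0, by simp [shortNode, hj]⟩
        simp [vecWt, this, hlast]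
      · rfl
      · have : j ≠ i := fun hj => hb ⟨2, by simp [shortNode, hj]⟩
        simp [vecWt, this, hlast]

theorem isSlTwo_spin (i : Fin n) : IsSlTwo (spinE i) (spinF i) (spinWt i) := by
  rw [spinE_eq_raise, spinF_eq_lower]
  refine isSlTwo_raise_lower (spinSwap_spinSwap i) (spinWt_spinSwap i) ?_
  intro b
  unfold spinWt
  split_ifs <;> simp

theorem isSlTwo_gen (i : Fin n) : IsSlTwo (genE i) (genF i) (fun b => wt b i) := by
  have := (isSlTwo_vec i).fromBlocks (isSlTwo_spin i)
  convert this using 1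
  · rfl
  · rfl
  · ext (b | b) <;> rfl

/-! ### Exponentials of matrices with vanishing cube -/

section Exponential

variable {α : Type*} [Fintype α] [DecidableEq α]

theorem hasSum_exp_matrix (z : Matrix α α ℂ) :
    HasSum (fun m : ℕ => ((m.factorial : ℂ)⁻¹) • z ^ m) (NormedSpace.exp z) := by
  let _ : SeminormedRing (Matrix α α ℂ) := Matrix.linftyOpSemiNormedRing
  let _ : NormedRing (Matrix α α ℂ) := Matrix.linftyOpNormedRing
  let _ : NormedAlgebra ℂ (Matrix α α ℂ) := Matrix.linftyOpNormedAlgebra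
  exact NormedSpace.exp_series_hasSum_exp' (𝕂 := ℂ) z

theorem hasSum_exp_matrix_apply (z : Matrix α α ℂ) (a b : α) :
    HasSum (fun m : ℕ => ((m.factorial : ℂ)⁻¹) * (z ^ m) a b) (NormedSpace.exp z a b) :=
  ((hasSum_exp_matrix z).map (Matrix.entryAddMonoidHom ℂ a b)
    (continuous_id.matrix_elem a b))

theorem exp_smul_eq_expQuad {e : Matrix α α ℂ} (he : e * e * e = 0) (a : ℂ) :
    NormedSpace.exp (a • e) = expQuad e a := by
  refine (hasSum_exp_matrix (a • e)).unique ?_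
  have h : ∀ m ∉ Finset.range 3, ((m.factorial : ℂ)⁻¹) • (a • e) ^ m = 0 := by
    intro m hm
    have hm : 3 ≤ m := by simpa using hm
    have : e ^ 3 = 0 := by rw [pow_succ, pow_two, he]
    rw [smul_pow, pow_eq_zero_of_le hm this, smul_zero, smul_zero]
  convert hasSum_sum_of_ne_finset_zero h using 1
  · simp only [Finset.sum_range_succ, Finset.sum_range_zero, expQuad, smul_smul, pow_two, smul_mul_smul_comm]
    simp [div_eq_inv_mul]
  · infer_instance

theorem diagonal_mul_expQuad {v : α → ℂ} {f : Matrix α α ℂ} {r : ℂ}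
    (h : Matrix.diagonal v * f = r • (f * Matrix.diagonal v)) (a : ℂ) :
    Matrix.diagonal v * expQuad f a = expQuad f (r * a) * Matrix.diagonal v := by
  have h2 : Matrix.diagonal v * (f * f) = (r * r) • (f * f * Matrix.diagonal v) := by
    rw [← mul_assoc, h, smul_mul_assoc, mul_assoc, h, mul_smul_comm, smul_smul, mul_assoc]
  simp only [expQuad, mul_add, add_mul, mul_one, one_mul, mul_smul_comm, smul_mul_assoc, h, h2,
    smul_smul]
  congr 2 <;> ring_nf

theorem Commute.expQuad {e f : Matrix α α ℂ} (h : Commute e f) (a t : ℂ) :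
    Commute (expQuad e a) (expQuad f t) := by
  unfold TypeB.expQuad
  have he : ∀ z, Commute e z → Commute (1 + a • e + (a ^ 2 / 2) • (e * e)) z := fun z hz =>
    ((Commute.one_left z).add_left (hz.smul_left a)).add_left ((hz.mul_left hz).smul_left _)
  exact (((Commute.one_right _).add_right ((he f h).smul_right t)).add_right
    (((he f h).mul_right (he f h)).smul_right _))

end Exponential

/-! ### Chevalley relations in the group -/

theorem x_val (i : Fin n) (t : ℂ) : (x i t : Ambient n).val = expQuad (genE i) t :=
  exp_smul_eq_expQuad (isSlTwo_gen i).e_cube t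

theorem y_val (i : Fin n) (t : ℂ) : (y i t : Ambient n).val = expQuad (genF i) t :=
  exp_smul_eq_expQuad (isSlTwo_gen i).f_cube t

theorem coroot_val (i : Fin n) (c : ℂˣ) :
    (coroot i c : Ambient n).val = diagPow (fun b => wt b i) (c : ℂ) := by
  rw [← (isSlTwo_gen i).weyl c c.ne_zero]
  simp only [coroot, Subgroup.coe_mul, Units.val_mul, x_val, y_val]

theorem grp_ext {g h : grp n} (H : (g : Ambient n).val = (h : Ambient n).val) : g = h :=
  Subtype.ext (Units.ext H)

/-- Gauss decomposition in the SL₂ of node i; the pivot 1 + a t is given as a unit because it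
becomes the argument of the coroot. -/
theorem x_mul_y_same (i : Fin n) (a t : ℂ) (c : ℂˣ) (hc : (c : ℂ) = 1 + a * t) :
    x i a * y i t = y i (t / c) * coroot i c * x i (a / c) := by
  apply grp_ext
  simp only [Subgroup.coe_mul, Units.val_mul, coroot_val, x_val, y_val, hc]
  exact (isSlTwo_gen i).gauss a t (hc ▸ c.ne_zero)

theorem vecWt_inl_eq {i : Fin n} (h : i.val + 1 < n) (m : Fin n) :
    vecWt m (.inl i) = vecWt m (.inl ⟨i.val + 1, h⟩) + cartan n m i := by
  simp only [vecWt, cartan, Fin.ext_iff]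
  split_ifs <;> omega

theorem vecWt_inl_last {i : Fin n} (h : i.val + 1 = n) (m : Fin n) :
    vecWt m (.inl i) = cartan n m i := by
  simp only [vecWt, cartan, Fin.ext_iff]
  split_ifs <;> omega

theorem vecWt_of_vecE_ne_zero {i : Fin n} {a b : VecIdx n} (h : vecE i a b ≠ 0) (m : Fin n) :
    vecWt m a = vecWt m b + cartan n m i := by
  rcases b with j | u | j <;> rcases a with k | u' | k <;> simp [vecE] at h
  · obtain ⟨h1, rfl⟩ := h
    rw [vecWt_inl_eq (h1 ▸ j.isLt)]
    congr 3
    exact Fin.ext h1.symm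
  · obtain ⟨h1, rfl⟩ := h
    rw [vecWt_inl_last h1, vecWt]
    ring
  · obtain ⟨h1, rfl⟩ := h
    rw [vecWt_inr, vecWt_inl_last h1, vecWt]
    ring
  · obtain ⟨rfl, h1⟩ := h
    have hj : j.val + 1 < n := by omega
    have : k = ⟨j.val + 1, hj⟩ := Fin.ext h1
    rw [vecWt_inr, vecWt_inr, vecWt_inl_eq hj, ← this]
    ring

theorem spinSwap_apply_of_lt {i : Fin n} (h : i.val + 1 < n) (b : SpinIdx n) (m : Fin n) :
    spinSwap i b m = if m = i then b ⟨i.val + 1, h⟩ else if m.val = i.val + 1 then b i else b m := by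
  simp only [spinSwap, h, if_true, Function.comp_apply, nodeSwap_apply h]
  split_ifs <;> rfl

theorem spinSwap_apply_of_not_lt {i : Fin n} (h : ¬ i.val + 1 < n) (b : SpinIdx n) (m : Fin n) :
    spinSwap i b m = if m = i then !b i else b m := by
  simp only [spinSwap, h, if_false, Function.update_apply]

/-- The sign `±1` of a boolean. -/
def boolSign (s : Bool) : ℤ := if s then 1 else -1

theorem two_mul_spinWt_of_lt {i : Fin n} (h : i.val + 1 < n) (b : SpinIdx n) :
    2 * spinWt i b = boolSign (b i) - boolSign (b ⟨i.val + 1, h⟩) := by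
  simp only [spinWt, h, boolSign, dif_pos]
  split_ifs <;> simp

theorem spinWt_of_not_lt {i : Fin n} (h : ¬ i.val + 1 < n) (b : SpinIdx n) :
    spinWt i b = boolSign (b i) := by
  simp only [spinWt, h, boolSign, dif_neg, not_false_iff]

theorem boolSign_spinSwap {i : Fin n} {b : SpinIdx n} (h : spinWt i b = -1) (m : Fin n) :
    boolSign (spinSwap i b m) =
      boolSign (b m) + (if m = i then 2 else if m.val = i.val + 1 then -2 else 0) := by
  by_cases hi : i.val + 1 < n
  · rw [spinSwap_apply_of_lt hi]
    have h2 := two_mul_spinWt_of_lt hi b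
    rw [h] at h2
    split_ifs with h3 h4
    · subst h3; omega
    · have : m = ⟨i.val + 1, hi⟩ := Fin.ext h4
      subst this; omega
    · simp
  · rw [spinSwap_apply_of_not_lt hi]
    rw [spinWt_of_not_lt hi] at h
    have : m.val ≠ i.val + 1 := by omega
    split_ifs with h3
    · subst h3
      cases hb : b m <;> simp_all [boolSign]
    · simp

theorem spinWt_spinSwap_eq {i : Fin n} {b : SpinIdx n} (h : spinWt i b = -1) (m : Fin n) :
    spinWt m (spinSwap i b) = spinWt m b + cartan n m i := by
  by_cases hm : m.val + 1 < n
  · have h1 := two_mul_spinWt_of_lt hm b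
    have h2 := two_mul_spinWt_of_lt hm (spinSwap i b)
    rw [boolSign_spinSwap h, boolSign_spinSwap h] at h2
    simp only [Fin.ext_iff] at h2
    simp only [cartan, Fin.ext_iff]
    split_ifs at h2 ⊢ <;> omega
  · rw [spinWt_of_not_lt hm, spinWt_of_not_lt hm, boolSign_spinSwap h]
    simp only [cartan, Fin.ext_iff]
    split_ifs <;> omega

theorem wt_of_genE_ne_zero {i : Fin n} {a b : Idx n} (h : genE i a b ≠ 0) :
    wt a = wt b + simpleRoot i := by
  funext m
  rcases a with a | a <;> rcases b with b | b
  · exact vecWt_of_vecE_ne_zero h m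
  · exact absurd rfl h
  · exact absurd rfl h
  · have h' : spinE i a b ≠ 0 := h
    rw [spinE_eq_raise] at h'
    simp only [raise, Matrix.of_apply, ne_eq, ite_eq_right_iff, one_ne_zero, imp_false,
      not_not] at h'
    obtain ⟨h1, rfl⟩ := h'
    exact spinWt_spinSwap_eq h1 m

/-- Since e_i and f_i have transposed supports, the weight shift of f_i follows from that of e_i. -/
theorem genF_eq_zero_iff (i : Fin n) (a b : Idx n) : genF i a b = 0 ↔ genE i b a = 0 := by
  rcases a with a | a <;> rcases b with b | b
  · change vecF i a b = 0 ↔ vecE i b a = 0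
    rcases b with j | u | j <;> rcases a with k | u' | k <;> simp [vecE, vecF] <;> tauto
  · exact Iff.rfl
  · exact Iff.rfl
  · change spinF i a b = 0 ↔ spinE i b a = 0
    rw [spinE_eq_raise, spinF_eq_lower]
    simp only [raise, lower, Matrix.of_apply, ite_eq_right_iff, one_ne_zero, imp_false, not_and]
    constructor
    · rintro h h1 rfl
      exact h (by rw [spinWt_spinSwap, h1, neg_neg]) (spinSwap_spinSwap i a).symm
    · rintro h h1 rfl
      exact h (by rw [spinWt_spinSwap, h1]) (spinSwap_spinSwap i b).symm

theorem vecE_mul_vecF {i j : Fin n} (h : i ≠ j) : vecE i * vecF j = 0 := by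
  ext a b
  rw [Matrix.mul_apply]
  refine Finset.sum_eq_zero fun c _ => ?_
  rw [Fin.ne_iff_vne] at h
  rcases a with a | a | a <;> rcases c with c | c | c <;> rcases b with b | b | b <;>
    simp [vecE, vecF, Fin.ext_iff] <;> omega

theorem vecF_mul_vecE {i j : Fin n} (h : i ≠ j) : vecF j * vecE i = 0 := by
  ext a b
  rw [Matrix.mul_apply]
  refine Finset.sum_eq_zero fun c _ => ?_
  rw [Fin.ne_iff_vne] at h
  rcases a with a | a | a <;> rcases c with c | c | c <;> rcases b with b | b | b <;>
    simp [vecE, vecF, Fin.ext_iff] <;> omega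

theorem boolSign_injective : Function.Injective boolSign := by
  intro s t
  cases s <;> cases t <;> simp [boolSign]

theorem boolSign_spinSwap_of_one {i : Fin n} {b : SpinIdx n} (h : spinWt i b = 1) (m : Fin n) :
    boolSign (spinSwap i b m) =
      boolSign (b m) - (if m = i then 2 else if m.val = i.val + 1 then -2 else 0) := by
  have := boolSign_spinSwap (i := i) (b := spinSwap i b) (by rw [spinWt_spinSwap, h]) m
  rw [spinSwap_spinSwap] at this
  omega

theorem spinWt_spinSwap_of_one {i : Fin n} {b : SpinIdx n} (h : spinWt i b = 1) (m : Fin n) :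
    spinWt m (spinSwap i b) = spinWt m b - cartan n m i := by
  have := spinWt_spinSwap_eq (i := i) (b := spinSwap i b) (by rw [spinWt_spinSwap, h]) m
  rw [spinSwap_spinSwap] at this
  omega

theorem abs_spinWt_le (i : Fin n) (b : SpinIdx n) : -1 ≤ spinWt i b ∧ spinWt i b ≤ 1 := by
  unfold spinWt
  split_ifs <;> simp

theorem cartan_nonpos {i j : Fin n} (h : i ≠ j) : cartan n i j ≤ 0 := by
  simp only [cartan, h, if_false]
  split_ifs <;> omega

theorem cartan_eq_zero_symm {i j : Fin n} (h : cartan n i j = 0) : cartan n j i = 0 := by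
  simp only [cartan, Fin.ext_iff] at h ⊢
  split_ifs at h ⊢ <;> omega

/-- Either product is nonzero on a basis vector only if its h_j-weight is 1, its h_i-weight is −1
and a_{ij} = 0: weights lie in [−1, 1] and a_{ij}, a_{ji} ≤ 0 leave no other room. In that case both
products make the same sign changes. -/
theorem commute_spinE_spinF {i j : Fin n} (h : i ≠ j) : Commute (spinE i) (spinF j) := by
  ext a b
  rw [spinE_eq_raise, spinF_eq_lower, mul_lower_apply, mul_raise_apply]
  simp only [raise, lower, Matrix.of_apply, ← ite_and]
  have hi := abs_spinWt_le i b
  have hj := abs_spinWt_le j b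
  by_cases hb : spinWt j b = 1 ∧ spinWt i b = -1 ∧ cartan n i j = 0
  · obtain ⟨h1, h2, h3⟩ := hb
    have h4 := spinWt_spinSwap_of_one h1 i
    have h5 := spinWt_spinSwap_eq h2 j
    rw [h2, h3, sub_zero] at h4
    rw [h1, cartan_eq_zero_symm h3, add_zero] at h5
    have h6 : spinSwap i (spinSwap j b) = spinSwap j (spinSwap i b) := by
      funext m
      apply boolSign_injective
      rw [boolSign_spinSwap h4, boolSign_spinSwap_of_one h1, boolSign_spinSwap_of_one h5,
        boolSign_spinSwap h2]
      ring
    simp only [h1, h2, h4, h5, h6]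
  · rw [if_neg, if_neg]
    · rintro ⟨h1, h2, -⟩
      rw [spinWt_spinSwap_eq h1] at h2
      have := cartan_nonpos h.symm
      exact hb ⟨by omega, h1, cartan_eq_zero_symm (by omega)⟩
    · rintro ⟨h1, h2, -⟩
      rw [spinWt_spinSwap_of_one h1] at h2
      have := cartan_nonpos h
      exact hb ⟨h1, by omega, by omega⟩

theorem commute_genE_genF {i j : Fin n} (h : i ≠ j) : Commute (genE i) (genF j) := by
  rw [Commute, SemiconjBy, genE, genF, Matrix.fromBlocks_multiply, Matrix.fromBlocks_multiply]
  simp [vecE_mul_vecF h, vecF_mul_vecE h, (commute_spinE_spinF h).eq]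

theorem wt_of_genF_ne_zero {i : Fin n} {a b : Idx n} (h : genF i a b ≠ 0) :
    wt a = wt b - simpleRoot i := by
  rw [wt_of_genE_ne_zero (fun h' => h ((genF_eq_zero_iff i a b).2 h')), add_sub_cancel_right]

theorem coroot_mul_y (i j : Fin n) (c : ℂˣ) (a : ℂ) :
    coroot i c * y j a = y j ((c : ℂ) ^ (-cartan n i j) * a) * coroot i c := by
  apply grp_ext
  simp only [Subgroup.coe_mul, Units.val_mul, coroot_val, y_val]
  refine diagonal_mul_expQuad ?_ a
  ext u v
  simp only [Matrix.diagonal_mul, Matrix.smul_apply, Matrix.mul_diagonal, smul_eq_mul]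
  by_cases h : genF j u v = 0
  · simp [h]
  · have := congrFun (wt_of_genF_ne_zero h) i
    rw [this, Pi.sub_apply, sub_eq_add_neg, zpow_add₀ c.ne_zero, simpleRoot]
    ring

theorem x_mul_y_of_ne {i j : Fin n} (h : i ≠ j) (a t : ℂ) : x i a * y j t = y j t * x i a := by
  apply grp_ext
  simp only [Subgroup.coe_mul, Units.val_mul, x_val, y_val]
  exact Commute.expQuad (commute_genE_genF h) a t

/-! ### Weights in the coordinates ½ ε_j and the dominance order -/

section Epsilon

/-- The coordinates `2 ⟨h_i, λ⟩` of the weight `λ = ½ ∑ x_j ε_j`. -/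
def epsPairing (n : ℕ) : (Fin n → ℤ) →+ (Fin n → ℤ) where
  toFun x i := if h : i.val + 1 < n then x i - x ⟨i.val + 1, h⟩ else 2 * x i
  map_zero' := by ext i; simp
  map_add' x y := by
    ext i
    simp only [Pi.add_apply]
    split_ifs <;> ring

theorem epsPairing_of_lt (x : Fin n → ℤ) {i : Fin n} (h : i.val + 1 < n) :
    epsPairing n x i = x i - x ⟨i.val + 1, h⟩ := by
  simp [epsPairing, h]

theorem epsPairing_of_not_lt (x : Fin n → ℤ) {i : Fin n} (h : ¬ i.val + 1 < n) :
    epsPairing n x i = 2 * x i := by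
  simp [epsPairing, h]

theorem epsPairing_injective : Function.Injective (epsPairing n) := by
  rw [injective_iff_map_eq_zero]
  intro x hx
  have key : ∀ m : ℕ, ∀ i : Fin n, i.val + 1 + m = n → x i = 0 := by
    intro m
    induction m with
    | zero =>
      intro i hi
      have := congrFun hx i
      rw [epsPairing_of_not_lt x (by omega)] at this
      simpa using this
    | succ m ih =>
      intro i hi
      have := congrFun hx i
      rw [epsPairing_of_lt x (by omega), ih ⟨i.val + 1, by omega⟩ (by simp; omega)] at this
      simpa using this
  funext i
  exact key (n - (i.val + 1)) i (by omega)

/-- The simple root `α_i` in the basis `½ ε_j`. -/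
def epsRoot (i : Fin n) : Fin n → ℤ := fun m =>
  if m = i then 2 else if m.val = i.val + 1 then -2 else 0

theorem epsPairing_epsRoot (i : Fin n) : epsPairing n (epsRoot i) = (2 : ℤ) • simpleRoot i := by
  ext m
  by_cases h : m.val + 1 < n
  · rw [epsPairing_of_lt _ h]
    simp only [epsRoot, simpleRoot, cartan, Pi.smul_apply, smul_eq_mul, Fin.ext_iff]
    split_ifs <;> omega
  · rw [epsPairing_of_not_lt _ h]
    simp only [epsRoot, simpleRoot, cartan, Pi.smul_apply, smul_eq_mul, Fin.ext_iff]
    split_ifs <;> omega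

/-- The weight of a basis vector of `V(Λ_1)` in the basis `½ ε_j`. -/
def vecEps : VecIdx n → Fin n → ℤ
  | .inl j => Pi.single j 2
  | .inr (.inl _) => 0
  | .inr (.inr j) => -Pi.single j 2

/-- The weight of a basis vector of `V(Λ_1) ⊕ V(Λ_n)` in the basis `½ ε_j`. -/
def idxEps : Idx n → Fin n → ℤ
  | .inl b => vecEps b
  | .inr b => fun j => boolSign (b j)

theorem epsPairing_single (j : Fin n) :
    epsPairing n (Pi.single j 2) = (2 : ℤ) • wt (.inl (.inl j)) := by
  ext m
  by_cases h : m.val + 1 < n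
  · rw [epsPairing_of_lt _ h]
    simp only [wt, Sum.elim_inl, vecWt, Pi.single_apply, Pi.smul_apply, smul_eq_mul, Fin.ext_iff]
    split_ifs <;> omega
  · rw [epsPairing_of_not_lt _ h]
    simp only [wt, Sum.elim_inl, vecWt, Pi.single_apply, Pi.smul_apply, smul_eq_mul, Fin.ext_iff]
    split_ifs <;> omega

theorem epsPairing_idxEps (b : Idx n) : epsPairing n (idxEps b) = (2 : ℤ) • wt b := by
  rcases b with (j | u | j) | b
  · exact epsPairing_single j
  · ext m
    simp [idxEps, vecEps, wt, vecWt]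
  · have := epsPairing_single j
    simp only [idxEps, vecEps, map_neg, this]
    ext m
    simp [wt, vecWt_inr]
  · ext m
    by_cases h : m.val + 1 < n
    · rw [epsPairing_of_lt _ h]
      exact (two_mul_spinWt_of_lt h b).symm
    · rw [epsPairing_of_not_lt _ h]
      exact congrArg (2 * ·) (spinWt_of_not_lt h b).symm

theorem idxEps_eq_of_isPositive {a b : Idx n} (h : IsPositive (wt b - wt a)) :
    ∃ m : Fin n → ℕ, idxEps b = idxEps a + ∑ j, (m j : ℤ) • epsRoot j := by
  obtain ⟨-, m, hm⟩ := h
  refine ⟨m, epsPairing_injective ?_⟩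
  rw [map_add, map_sum, epsPairing_idxEps, epsPairing_idxEps]
  simp only [map_zsmul, epsPairing_epsRoot]
  rw [← sub_eq_iff_eq_add', ← smul_sub, hm, Finset.smul_sum]
  exact Finset.sum_congr rfl fun j _ => smul_comm _ _ _

/-- Partial sums of coordinates act as multiples of the fundamental coweights: they isolate one
coefficient of a combination of simple roots. -/
theorem sum_Iic_epsRoot (r j : Fin n) :
    ∑ m ∈ Finset.Iic r, epsRoot j m = if j = r then 2 else 0 := by
  have h : ∀ m, epsRoot j m = (if m = j then 2 else 0) - (if m.val = j.val + 1 then 2 else 0) := by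
    intro m
    simp only [epsRoot, Fin.ext_iff]
    split_ifs <;> omega
  simp only [h, Finset.sum_sub_distrib, Finset.sum_ite_eq', Finset.mem_Iic]
  by_cases hj : j.val + 1 < n
  · have : ∀ m : Fin n, (m.val = j.val + 1) ↔ m = ⟨j.val + 1, hj⟩ := by simp [Fin.ext_iff]
    simp only [this, Finset.sum_ite_eq', Finset.mem_Iic]
    simp only [Fin.le_def, Fin.ext_iff]
    split_ifs <;> omega
  · have : ∀ m : Fin n, ¬ m.val = j.val + 1 := by omega
    simp only [this, if_false, Finset.sum_const_zero, Fin.le_def, Fin.ext_iff]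
    split_ifs <;> omega

/-- The sum of the first j coordinates of wt b must be at least that of ε_j. This leaves only v_{j'}
with j' ≤ j among the vector weights; the spin weights differ from ε_j by a parity. -/
theorem exists_lt_of_isPositive {j : Fin n} {b : Idx n}
    (h : IsPositive (wt b - wt (.inl (.inl j)))) : ∃ j' < j, b = .inl (.inl j') := by
  obtain ⟨m, hm⟩ := idxEps_eq_of_isPositive h
  have hsum : ∑ r ∈ Finset.Iic j, idxEps b r = 2 + 2 * m j := by
    rw [hm]
    simp only [Pi.add_apply, Finset.sum_add_distrib, Finset.sum_apply, Pi.smul_apply, smul_eq_mul]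
    rw [Finset.sum_comm]
    simp only [← Finset.mul_sum, sum_Iic_epsRoot]
    simp [idxEps, vecEps, Pi.single_apply, mul_comm]
  rcases b with (j' | u | j') | b
  · have hle : j' ≤ j := by
      by_contra hlt
      simp [idxEps, vecEps, Pi.single_apply, hlt] at hsum
      omega
    refine ⟨j', lt_of_le_of_ne hle ?_, rfl⟩
    rintro rfl
    exact h.1 (sub_self _)
  · simp [idxEps, vecEps] at hsum
    omega
  · simp [idxEps, vecEps, Pi.single_apply] at hsum
    split_ifs at hsum <;> omega
  · exfalso
    have h1 := congrFun hm j
    simp only [Pi.add_apply, Finset.sum_apply, Pi.smul_apply, smul_eq_mul, idxEps, vecEps,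
      Pi.single_eq_same] at h1
    -- Simple roots have even coordinates in this basis, while spin weights have odd ones.
    have h2 : (2 : ℤ) ∣ ∑ r, (m r : ℤ) * epsRoot r j := by
      refine Finset.dvd_sum fun r _ => Dvd.dvd.mul_left ?_ _
      unfold epsRoot
      split_ifs <;> decide
    unfold boolSign at h1
    split_ifs at h1 <;> omega

end Epsilon

/-! ### The leading minor is a principal minor -/

section Minor

/-- The row and column indices of the leading minor. -/
def topIdx (k : Fin n) (j : Fin (k.val + 1)) : Idx n := .inl (.inl ⟨j.val, by omega⟩)

/-- The leading minor of size `k + 1` in `V(Λ_1)`. -/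
noncomputable def leadingMinor (k : Fin n) (A : Matrix (Idx n) (Idx n) ℂ) : ℂ :=
  (A.submatrix (topIdx k) (topIdx k)).det

theorem topIdx_injective (k : Fin n) : Function.Injective (topIdx k) := by
  intro a b h
  simpa [topIdx, Fin.ext_iff] using h

/-- The rows of `A` at `v_1, …, v_n` are lower unitriangular. -/
def IsLowerUnitri (A : Matrix (Idx n) (Idx n) ℂ) : Prop :=
  ∀ (j : Fin n) (b : Idx n), (∀ j' < j, b ≠ .inl (.inl j')) →
    A (.inl (.inl j)) b = (1 : Matrix (Idx n) (Idx n) ℂ) (.inl (.inl j)) b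

/-- A row v_j of A with j ≤ k meets only columns v_{j'} with j' ≤ j, so the leading block of A * g
is the product of the leading blocks, the first one being unitriangular. -/
theorem leadingMinor_mul_left {A : Matrix (Idx n) (Idx n) ℂ} (hA : IsLowerUnitri A) (k : Fin n)
    (g : Matrix (Idx n) (Idx n) ℂ) : leadingMinor k (A * g) = leadingMinor k g := by
  have h : (A * g).submatrix (topIdx k) (topIdx k) =
      A.submatrix (topIdx k) (topIdx k) * g.submatrix (topIdx k) (topIdx k) := by
    ext a b
    simp only [Matrix.submatrix_apply, Matrix.mul_apply]
    refine (Fintype.sum_of_injective (topIdx k) (topIdx_injective k) _ _ ?_ fun _ => rfl).symm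
    intro c hc
    rw [topIdx, hA, Matrix.one_apply_ne, zero_mul]
    · rintro rfl
      exact hc ⟨a, rfl⟩
    · rintro j' hj' rfl
      exact hc ⟨⟨j'.val, by have := Fin.lt_def.1 hj'; simp at this; omega⟩, rfl⟩
  rw [leadingMinor, h, Matrix.det_mul, Matrix.det_of_isLowerTriangular, leadingMinor,
    Finset.prod_eq_one, one_mul]
  · intro a _
    rw [Matrix.submatrix_apply, topIdx, hA, Matrix.one_apply_eq]
    intro j' hj' h
    simp only [Sum.inl.injEq] at h
    exact absurd h hj'.ne'
  · intro a b hab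
    rw [Matrix.submatrix_apply, topIdx, topIdx, hA, Matrix.one_apply_ne]
    · intro h
      simp only [Sum.inl.injEq, Fin.mk.injEq] at h
      exact hab.ne (congrArg OrderDual.toDual (Fin.ext h.symm))
    · intro j' hj' h
      simp only [Sum.inl.injEq] at h
      subst h
      exact absurd (Fin.lt_def.1 hj') (not_lt.2 (le_of_lt hab))

theorem leadingMinor_transpose (k : Fin n) (g : Matrix (Idx n) (Idx n) ℂ) :
    leadingMinor k g.transpose = leadingMinor k g := by
  rw [leadingMinor, leadingMinor, ← Matrix.det_transpose]
  rfl

/-- By `exists_lt_of_isPositive`, each factor z moves row v_j strictly up the list v_1, …, v_n, so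
only the zeroth power contributes at the remaining columns. -/
theorem isLowerUnitri_exp {z : Matrix (Idx n) (Idx n) ℂ}
    (hz : ∀ a b, z a b ≠ 0 → IsPositive (wt b - wt a)) : IsLowerUnitri (NormedSpace.exp z) := by
  have hpow : ∀ (m : ℕ) (j : Fin n) (b : Idx n), (z ^ (m + 1)) (.inl (.inl j)) b ≠ 0 →
      ∃ j' < j, b = .inl (.inl j') := by
    intro m
    induction m with
    | zero =>
      intro j b hb
      rw [zero_add, pow_one] at hb
      exact exists_lt_of_isPositive (hz _ _ hb)
    | succ m ih =>
      intro j b hb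
      rw [pow_succ', Matrix.mul_apply] at hb
      obtain ⟨c, -, hc⟩ := Finset.exists_ne_zero_of_sum_ne_zero hb
      obtain ⟨j', hj', rfl⟩ := exists_lt_of_isPositive (hz _ _ (left_ne_zero_of_mul hc))
      obtain ⟨j'', hj'', rfl⟩ := ih j' b (right_ne_zero_of_mul hc)
      exact ⟨j'', hj''.trans hj', rfl⟩
  intro j b hb
  refine (hasSum_exp_matrix_apply z _ b).unique ?_
  convert hasSum_single (0 : ℕ) ?_ using 1
  · simp
  · intro m hm
    obtain ⟨m, rfl⟩ := Nat.exists_eq_succ_of_ne_zero hm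
    rw [mul_eq_zero]
    right
    by_contra h
    obtain ⟨j', hj', h'⟩ := hpow m j b h
    exact hb j' hj' h'

attribute [local instance] LieRing.ofAssociativeRing

theorem genH_eq (i : Fin n) : genH i = Matrix.diagonal fun b => (wt b i : ℂ) := by
  rw [genH, LieRing.of_associative_ring_bracket]
  exact (isSlTwo_gen i).bracket

theorem bracket_genH_apply (i : Fin n) (z : Matrix (Idx n) (Idx n) ℂ) (a b : Idx n) :
    ⁅genH i, z⁆ a b = ((wt a i - wt b i : ℤ) : ℂ) * z a b := by
  rw [genH_eq, LieRing.of_associative_ring_bracket, Matrix.sub_apply, Matrix.diagonal_mul,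
    Matrix.mul_diagonal]
  push_cast
  ring

theorem wt_sub_of_mem_rootSpace {α : Weight n} {z : Matrix (Idx n) (Idx n) ℂ}
    (hz : z ∈ rootSpace α) {a b : Idx n} (h : z a b ≠ 0) : wt a - wt b = α := by
  funext i
  have := congrFun (congrFun (hz.2 i) a) b
  rw [bracket_genH_apply, Matrix.smul_apply, smul_eq_mul] at this
  exact_mod_cast mul_right_cancel₀ h this

theorem leadingMinor_mul_of_mem_unipNeg {u : Ambient n} (hu : u ∈ unipNeg n) (k : Fin n) :
    ∀ g, leadingMinor k (u.val * g) = leadingMinor k g := by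
  induction hu using Subgroup.closure_induction with
  | mem u hu =>
    obtain ⟨α, hα, z, hz, rfl⟩ := hu
    refine leadingMinor_mul_left (isLowerUnitri_exp ?_) k
    intro a b hab
    have := wt_sub_of_mem_rootSpace hz hab
    rwa [← neg_sub, this, neg_neg]
  | one => simp
  | mul u v _ _ hu hv =>
    intro g
    rw [Units.val_mul, mul_assoc, hu, hv]
  | inv u _ hu =>
    intro g
    rw [← hu, ← mul_assoc, Units.mul_inv, one_mul]

/-- Transposition negates the root of a root vector and preserves the minor, which reduces the claim
to left multiplication. -/
theorem leadingMinor_mul_of_mem_unipPos {u : Ambient n} (hu : u ∈ unipPos n) (k : Fin n) :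
    ∀ g, leadingMinor k (g * u.val) = leadingMinor k g := by
  induction hu using Subgroup.closure_induction with
  | mem u hu =>
    obtain ⟨α, hα, z, hz, rfl⟩ := hu
    intro g
    rw [← leadingMinor_transpose, Matrix.transpose_mul, ← leadingMinor_transpose k g]
    refine leadingMinor_mul_left ?_ k _
    have : (expUnit z).val.transpose = NormedSpace.exp z.transpose := (Matrix.exp_transpose z).symm
    rw [this]
    refine isLowerUnitri_exp ?_
    intro a b hab
    rwa [wt_sub_of_mem_rootSpace hz hab]
  | one => simp
  | mul u v _ _ hu hv =>
    intro g
    rw [Units.val_mul, ← mul_assoc, hv, hu]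
  | inv u _ hu =>
    intro g
    rw [← hu, mul_assoc, Units.inv_mul, mul_one]

theorem torus_val (c : Fin n → ℂˣ) :
    (torus c : Ambient n).val = Matrix.diagonal fun b => ∏ i, (c i : ℂ) ^ wt b i := by
  have h : ∀ L : List (Fin n), ((L.map fun i => coroot i (c i)).prod : Ambient n).val =
      Matrix.diagonal fun b => (L.map fun i => (c i : ℂ) ^ wt b i).prod := by
    intro L
    induction L with
    | nil => simp
    | cons i L ih =>
      simp only [List.map_cons, List.prod_cons, Subgroup.coe_mul, Units.val_mul, ih, coroot_val,
        diagPow, Matrix.diagonal_mul_diagonal]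
  rw [torus, List.ofFn_eq_map, h]
  simp only [← List.ofFn_eq_map, List.prod_ofFn]

theorem zpow_sum_of_ne_zero {ι : Type*} {c : ℂ} (hc : c ≠ 0) (s : Finset ι) (f : ι → ℤ) :
    c ^ (∑ j ∈ s, f j) = ∏ j ∈ s, c ^ f j := by
  classical
  induction s using Finset.induction_on with
  | empty => simp
  | insert a s ha ih => rw [Finset.sum_insert ha, Finset.prod_insert ha, zpow_add₀ hc, ih]

/-- The fundamental weight `Λ_k`, `k < n`, in the basis `½ ε_j`. -/
def fundEps (k : Fin n) : Fin n → ℤ := fun m => if m ≤ k then 2 else 0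

theorem epsPairing_fundEps {k : Fin n} (hk : k.val + 1 < n) :
    epsPairing n (fundEps k) = (2 : ℤ) • fundWeight k := by
  ext m
  by_cases h : m.val + 1 < n
  · rw [epsPairing_of_lt _ h]
    simp only [fundEps, fundWeight, Pi.single_apply, Pi.smul_apply, smul_eq_mul, Fin.ext_iff,
      Fin.le_def]
    split_ifs <;> omega
  · rw [epsPairing_of_not_lt _ h]
    simp only [fundEps, fundWeight, Pi.single_apply, Pi.smul_apply, smul_eq_mul, Fin.ext_iff,
      Fin.le_def]
    split_ifs <;> omega

theorem sum_idxEps_topIdx (k : Fin n) : ∑ j, idxEps (topIdx k j) = fundEps k := by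
  ext m
  simp only [Finset.sum_apply, idxEps, vecEps, topIdx, fundEps, Pi.single_apply]
  split_ifs with h
  · rw [Finset.sum_eq_single ⟨m.val, Nat.lt_succ_of_le (Fin.le_def.1 h)⟩]
    · simp
    · intro b _ hb
      rw [if_neg]
      rintro rfl
      exact hb rfl
    · simp
  · refine Finset.sum_eq_zero fun b _ => if_neg ?_
    rintro rfl
    exact h (Fin.le_def.2 (Nat.lt_succ_iff.1 b.isLt))

/-- The bound on k matters: at the last node the weights ε_1, …, ε_n sum to 2Λ_n. -/
theorem sum_wt_topIdx {k : Fin n} (hk : k.val + 1 < n) (i : Fin n) :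
    ∑ j, wt (topIdx k j) i = fundWeight k i := by
  have h : (2 : ℤ) • ∑ j, wt (topIdx k j) = (2 : ℤ) • fundWeight k := by
    rw [← epsPairing_fundEps hk, ← sum_idxEps_topIdx, map_sum, Finset.smul_sum]
    exact Finset.sum_congr rfl fun j _ => (epsPairing_idxEps _).symm
  have := congrFun h i
  simp only [Pi.smul_apply, smul_eq_mul, Finset.sum_apply] at this
  omega

theorem leadingMinor_torus {k : Fin n} (hk : k.val + 1 < n) (c : Fin n → ℂˣ) :
    leadingMinor k (torus c : Ambient n).val = ∏ i, (c i : ℂ) ^ fundWeight k i := by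
  rw [torus_val, leadingMinor, Matrix.submatrix_diagonal _ _ (topIdx_injective k),
    Matrix.det_diagonal]
  simp only [Function.comp_apply]
  rw [Finset.prod_comm]
  refine Finset.prod_congr rfl fun i _ => ?_
  rw [← sum_wt_topIdx hk]
  exact (zpow_sum_of_ne_zero (c i).ne_zero _ _).symm

theorem isRegular_leadingMinor (k : Fin n) :
    IsRegular fun g : grp n => leadingMinor k (g : Ambient n).val := by
  refine ⟨(Matrix.of fun a b => MvPolynomial.X (topIdx k a, topIdx k b)).det, fun g => ?_⟩
  rw [RingHom.map_det]
  refine congrArg Matrix.det ?_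
  ext a b
  simp [Matrix.submatrix_apply]

theorem isPrincipalMinor_leadingMinor {k : Fin n} (hk : k.val + 1 < n) :
    IsPrincipalMinor (fundWeight k) fun g : grp n => leadingMinor k (g : Ambient n).val := by
  refine ⟨isRegular_leadingMinor k, ?_⟩
  intro g c u hu v hv h
  dsimp only
  rw [h, Units.val_mul, Units.val_mul, leadingMinor_mul_of_mem_unipPos hv,
    leadingMinor_mul_of_mem_unipNeg hu, leadingMinor_torus hk]

end Minor

/-! ### Uniqueness of principal minors by analytic continuation -/

section Uniqueness

open Filter Topology

attribute [local instance] LieRing.ofAssociativeRing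

theorem genE_mem_rootSpace (i : Fin n) (t : ℂ) : t • genE i ∈ rootSpace (simpleRoot i) := by
  refine ⟨(lieAlg n).smul_mem t (LieSubalgebra.subset_lieSpan (Or.inl ⟨i, rfl⟩)), fun m => ?_⟩
  ext a b
  rw [bracket_genH_apply]
  simp only [Matrix.smul_apply, smul_eq_mul]
  by_cases h : genE i a b = 0
  · simp [h]
  · rw [wt_of_genE_ne_zero h, Pi.add_apply, add_sub_cancel_left]

theorem genF_mem_rootSpace (i : Fin n) (t : ℂ) : t • genF i ∈ rootSpace (-simpleRoot i) := by
  refine ⟨(lieAlg n).smul_mem t (LieSubalgebra.subset_lieSpan (Or.inr ⟨i, rfl⟩)), fun m => ?_⟩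
  ext a b
  rw [bracket_genH_apply]
  simp only [Matrix.smul_apply, smul_eq_mul]
  by_cases h : genF i a b = 0
  · simp [h]
  · rw [wt_of_genF_ne_zero h, Pi.sub_apply, sub_sub_cancel_left, Pi.neg_apply]

theorem isPositive_simpleRoot (i : Fin n) : IsPositive (simpleRoot i) := by
  refine ⟨fun h => ?_, Pi.single i 1, ?_⟩
  · have := congrFun h i
    simp [simpleRoot, cartan] at this
  · rw [Finset.sum_eq_single i] <;> simp +contextual

theorem x_mem_unipPos (i : Fin n) (t : ℂ) : (x i t : Ambient n) ∈ unipPos n :=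
  Subgroup.subset_closure ⟨_, isPositive_simpleRoot i, _, genE_mem_rootSpace i t, rfl⟩

theorem y_mem_unipNeg (i : Fin n) (t : ℂ) : (y i t : Ambient n) ∈ unipNeg n :=
  Subgroup.subset_closure ⟨_, isPositive_simpleRoot i, _, genF_mem_rootSpace i t, rfl⟩

/-- `b` belongs to `T U⁺`. -/
def IsBorel (b : grp n) : Prop :=
  ∃ (c : Fin n → ℂˣ) (v : grp n), (v : Ambient n) ∈ unipPos n ∧ b = torus c * v

theorem isBorel_one : IsBorel (1 : grp n) := by
  refine ⟨1, 1, one_mem _, grp_ext ?_⟩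
  rw [mul_one, torus_val]
  simp

theorem IsBorel.coroot_mul {b : grp n} (hb : IsBorel b) (i : Fin n) (d : ℂˣ) :
    IsBorel (coroot i d * b) := by
  obtain ⟨c, v, hv, rfl⟩ := hb
  refine ⟨c * Pi.mulSingle i d, v, hv, ?_⟩
  rw [← mul_assoc]
  congr 1
  apply grp_ext
  rw [Subgroup.coe_mul, Units.val_mul, torus_val, torus_val, coroot_val, diagPow,
    Matrix.diagonal_mul_diagonal]
  congr 1
  funext b
  simp only [Pi.mul_apply, Units.val_mul, mul_zpow, Finset.prod_mul_distrib]
  rw [mul_comm]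
  congr 1
  rw [Finset.prod_eq_single i] <;> simp +contextual

theorem torus_mul_x (c : Fin n → ℂˣ) (i : Fin n) (a : ℂ) :
    torus c * x i a = x i ((∏ m, (c m : ℂ) ^ cartan n m i) * a) * torus c := by
  apply grp_ext
  simp only [Subgroup.coe_mul, Units.val_mul, torus_val, x_val]
  refine diagonal_mul_expQuad ?_ a
  ext u v
  simp only [Matrix.diagonal_mul, Matrix.smul_apply, Matrix.mul_diagonal, smul_eq_mul]
  by_cases h : genE i u v = 0
  · simp [h]
  · rw [wt_of_genE_ne_zero h]
    simp only [Pi.add_apply, zpow_add₀ (c _).ne_zero, simpleRoot, Finset.prod_mul_distrib]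
    ring

theorem IsBorel.x_mul {b : grp n} (hb : IsBorel b) (i : Fin n) (a : ℂ) :
    IsBorel (x i a * b) := by
  obtain ⟨c, v, hv, rfl⟩ := hb
  have hne : ∏ m, (c m : ℂ) ^ cartan n m i ≠ 0 :=
    Finset.prod_ne_zero_iff.2 fun m _ => zpow_ne_zero _ (c m).ne_zero
  refine ⟨c, x i ((∏ m, (c m : ℂ) ^ cartan n m i)⁻¹ * a) * v,
    mul_mem (x_mem_unipPos _ _) hv, ?_⟩
  rw [← mul_assoc, ← mul_assoc, torus_mul_x, mul_inv_cancel_left₀ hne]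

/-- The product of the `y_i(t(s))` over the pairs `(i, t)` of a list. -/
noncomputable def negProd (L : List (Fin n × (ℂ → ℂ))) (s : ℂ) : grp n :=
  (L.map fun p => y p.1 (p.2 s)).prod

theorem negProd_cons (p : Fin n × (ℂ → ℂ)) (L : List (Fin n × (ℂ → ℂ))) (s : ℂ) :
    negProd (p :: L) s = y p.1 (p.2 s) * negProd L s := by
  simp [negProd]

theorem negProd_mem (L : List (Fin n × (ℂ → ℂ))) (s : ℂ) :
    (negProd L s : Ambient n) ∈ unipNeg n := by
  induction L with
  | nil => exact one_mem _
  | cons p L ih =>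
    rw [negProd_cons]
    exact mul_mem (y_mem_unipNeg _ _) ih

theorem coroot_mul_negProd (L : List (Fin n × (ℂ → ℂ))) (i : Fin n) (c : ℂ → ℂ) (s : ℂ) (u : ℂˣ)
    (hu : (u : ℂ) = c s) : coroot i u * negProd L s =
      negProd (L.map fun p => (p.1, fun s => c s ^ (-cartan n i p.1) * p.2 s)) s * coroot i u := by
  induction L with
  | nil => simp [negProd]
  | cons p L ih =>
    rw [List.map_cons, negProd_cons, negProd_cons, ← mul_assoc, coroot_mul_y, mul_assoc, ih, hu,
      mul_assoc]

/-- The positive factor is pushed to the right through the y's: it commutes with those of other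
nodes, and passes one of its own node by the Gauss decomposition, leaving a coroot that is carried
along. As a vanishes at 0, every pivot 1 + a t is 1 at s = 0, hence nonzero nearby, and the new
parameters stay continuous there. -/
theorem exists_x_mul_negProd (L : List (Fin n × (ℂ → ℂ))) (hL : ∀ p ∈ L, ContinuousAt p.2 0)
    (i : Fin n) (a : ℂ → ℂ) (ha : ContinuousAt a 0) (ha0 : a 0 = 0) :
    ∃ L' : List (Fin n × (ℂ → ℂ)), (∀ p ∈ L', ContinuousAt p.2 0) ∧ ∀ᶠ s in 𝓝 0, ∀ b, IsBorel b →
      ∃ b', IsBorel b' ∧ x i (a s) * (negProd L s * b) = negProd L' s * b' := by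
  induction L generalizing a with
  | nil =>
    refine ⟨[], by simp, Eventually.of_forall fun s b hb => ⟨_, hb.x_mul i (a s), ?_⟩⟩
    simp [negProd]
  | cons p L ih =>
    obtain ⟨j, t⟩ := p
    have hL' : ∀ p ∈ L, ContinuousAt p.2 0 := fun p hp => hL p (List.mem_cons_of_mem _ hp)
    have ht : ContinuousAt t 0 := hL (j, t) (List.mem_cons_self ..)
    by_cases hij : i = j
    · subst hij
      set c : ℂ → ℂ := fun s => 1 + a s * t s with hc
      have hcc : ContinuousAt c 0 := continuousAt_const.add (ha.mul ht)
      have hc0 : c 0 ≠ 0 := by simp [hc, ha0]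
      obtain ⟨L', h1, h2⟩ := ih hL' (fun s => a s / c s) (ha.div hcc hc0) (by simp [ha0])
      refine ⟨(i, fun s => t s / c s) ::
        L'.map fun p => (p.1, fun s => c s ^ (-cartan n i p.1) * p.2 s), ?_, ?_⟩
      · intro p hp
        rcases List.mem_cons.1 hp with rfl | hp
        · exact ht.div hcc hc0
        · obtain ⟨q, hq, rfl⟩ := List.mem_map.1 hp
          exact (hcc.zpow₀ _ (Or.inl hc0)).mul (h1 q hq)
      · filter_upwards [h2, hcc.eventually_ne hc0] with s hs hcs b hb
        obtain ⟨b', hb', hbb⟩ := hs b hb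
        refine ⟨_, hb'.coroot_mul i (Units.mk0 (c s) hcs), ?_⟩
        rw [negProd_cons, negProd_cons, mul_assoc, ← mul_assoc,
          x_mul_y_same i (a s) (t s) (Units.mk0 (c s) hcs) rfl]
        simp only [Units.val_mk0, mul_assoc]
        rw [hbb, ← mul_assoc (coroot _ _), coroot_mul_negProd L' i c s _ rfl, mul_assoc]
    · obtain ⟨L', h1, h2⟩ := ih hL' a ha ha0
      refine ⟨(j, t) :: L', ?_, ?_⟩
      · intro p hp
        rcases List.mem_cons.1 hp with rfl | hp
        · exact ht
        · exact h1 p hp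
      · filter_upwards [h2] with s hs b hb
        obtain ⟨b', hb', hbb⟩ := hs b hb
        refine ⟨b', hb', ?_⟩
        rw [negProd_cons, negProd_cons, mul_assoc, ← mul_assoc, x_mul_y_of_ne hij, mul_assoc, hbb,
          mul_assoc]

/-- `g` lies at parameter `1` on a curve in `G` with entire matrix coefficients which lies in the
open cell `U⁻ T U⁺` for small parameters. -/
def OnCellCurve (g : grp n) : Prop :=
  ∃ γ : ℂ → grp n, γ 1 = g ∧
    (∀ a b, Differentiable ℂ fun s => (γ s : Ambient n).val a b) ∧
    ∃ L : List (Fin n × (ℂ → ℂ)), (∀ p ∈ L, ContinuousAt p.2 0) ∧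
      ∀ᶠ s in 𝓝 0, ∃ b, IsBorel b ∧ γ s = negProd L s * b

theorem differentiable_expQuad_mul {e : Matrix (Idx n) (Idx n) ℂ} {t : ℂ}
    {M : ℂ → Matrix (Idx n) (Idx n) ℂ} (hM : ∀ a b, Differentiable ℂ fun s => M s a b)
    (a b : Idx n) : Differentiable ℂ fun s => (expQuad e (s * t) * M s) a b := by
  simp only [Matrix.mul_apply]
  refine Differentiable.fun_sum fun c _ => Differentiable.fun_mul ?_ (hM c b)
  simp only [expQuad, Matrix.add_apply, Matrix.smul_apply, smul_eq_mul]
  fun_prop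

theorem OnCellCurve.y_mul {g : grp n} (hg : OnCellCurve g) (i : Fin n) (t : ℂ) :
    OnCellCurve (y i t * g) := by
  obtain ⟨γ, rfl, hd, L, hL, hc⟩ := hg
  refine ⟨fun s => y i (s * t) * γ s, by simp only [one_mul], ?_, (i, fun s => s * t) :: L, ?_, ?_⟩
  · intro a b
    simp only [Subgroup.coe_mul, Units.val_mul, y_val]
    exact differentiable_expQuad_mul hd a b
  · intro p hp
    rcases List.mem_cons.1 hp with rfl | hp
    · exact (continuous_id.mul continuous_const).continuousAt
    · exact hL p hp
  · filter_upwards [hc] with s hs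
    obtain ⟨b, hb, h⟩ := hs
    exact ⟨b, hb, by rw [h, negProd_cons, mul_assoc]⟩

theorem OnCellCurve.x_mul {g : grp n} (hg : OnCellCurve g) (i : Fin n) (t : ℂ) :
    OnCellCurve (x i t * g) := by
  obtain ⟨γ, rfl, hd, L, hL, hc⟩ := hg
  obtain ⟨L', hL', h⟩ := exists_x_mul_negProd L hL i (fun s => s * t)
    (continuous_id.mul continuous_const).continuousAt (zero_mul t)
  refine ⟨fun s => x i (s * t) * γ s, by simp only [one_mul], ?_, L', hL', ?_⟩
  · intro a b
    simp only [Subgroup.coe_mul, Units.val_mul, x_val]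
    exact differentiable_expQuad_mul hd a b
  · filter_upwards [hc, h] with s hs h
    obtain ⟨b, hb, hγ⟩ := hs
    obtain ⟨b', hb', h'⟩ := h b hb
    exact ⟨b', hb', by rw [hγ, h']⟩

theorem expQuad_mul_neg {i : Fin n} (t : ℂ) :
    (expUnit (t • genE i))⁻¹ = expUnit ((-t) • genE i) ∧
      (expUnit (t • genF i))⁻¹ = expUnit ((-t) • genF i) := by
  constructor <;>
  · apply Units.ext
    rw [Matrix.coe_units_inv, neg_smul]
    exact (Matrix.exp_neg _).symm

/-- Write g as a word in the generators x_i(t), y_i(t) and replace each t by s t. The curve starts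
at the identity, which lies in the cell. -/
theorem onCellCurve (g : grp n) : OnCellCurve g := by
  obtain ⟨g, hg⟩ := g
  induction hg using Subgroup.closure_induction_left with
  | one =>
    refine ⟨fun _ => 1, rfl, fun a b => differentiable_const _, [], by simp,
      Eventually.of_forall fun s => ⟨1, isBorel_one, by simp [negProd]⟩⟩
  | mul_left u hu v hv ih =>
    obtain ⟨i, t, rfl | rfl⟩ := hu
    · exact ih.x_mul i t
    · exact ih.y_mul i t
  | inv_mul_cancel u hu v hv ih =>
    obtain ⟨i, t, rfl | rfl⟩ := hu
    · convert ih.x_mul i (-t) using 1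
      exact Subtype.ext (congrArg (· * v) (expQuad_mul_neg t).1)
    · convert ih.y_mul i (-t) using 1
      exact Subtype.ext (congrArg (· * v) (expQuad_mul_neg t).2)

theorem IsRegular.differentiable_comp {f : grp n → ℂ} (hf : IsRegular f) {γ : ℂ → grp n}
    (hγ : ∀ a b, Differentiable ℂ fun s => (γ s : Ambient n).val a b) :
    Differentiable ℂ fun s => f (γ s) := by
  obtain ⟨p, hp⟩ := hf
  simp only [hp]
  clear hp
  induction p using MvPolynomial.induction_on with
  | C c => simp
  | add p q hp hq => simpa using hp.fun_add hq
  | mul_X p ab hp => simpa using hp.fun_mul (hγ ab.1 ab.2)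

/-- Along the curve both functions are entire, and near s = 0 both are given by the same character
of the torus part; so they agree at s = 1. -/
theorem IsPrincipalMinor.unique {μ : Weight n} {D D' : grp n → ℂ} (h : IsPrincipalMinor μ D)
    (h' : IsPrincipalMinor μ D') : D = D' := by
  funext g
  obtain ⟨γ, rfl, hd, L, hL, hc⟩ := onCellCurve g
  have h1 : AnalyticOnNhd ℂ (fun s => D (γ s)) Set.univ :=
    fun s _ => (h.1.differentiable_comp hd).analyticAt s
  have h2 : AnalyticOnNhd ℂ (fun s => D' (γ s)) Set.univ :=
    fun s _ => (h'.1.differentiable_comp hd).analyticAt s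
  refine congrFun (h1.eq_of_eventuallyEq h2 (z₀ := 0) ?_) 1
  filter_upwards [hc] with s hs
  obtain ⟨b, ⟨c, v, hv, rfl⟩, hb⟩ := hs
  have hb' : (γ s : Ambient n) = negProd L s * (torus c : Ambient n) * v := by
    rw [hb, Subgroup.coe_mul, Subgroup.coe_mul, mul_assoc]
  rw [h.2 (γ s) c _ (negProd_mem L s) _ hv hb', h'.2 (γ s) c _ (negProd_mem L s) _ hv hb']

theorem principalMinor_fundWeight {k : Fin n} (hk : k.val + 1 < n) (g : grp n) :
    principalMinor (fundWeight k) g = leadingMinor k (g : Ambient n).val := by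
  have h : ∃ D, IsPrincipalMinor (fundWeight k) D := ⟨_, isPrincipalMinor_leadingMinor hk⟩
  rw [principalMinor, dif_pos h]
  exact congrFun (h.choose_spec.unique (isPrincipalMinor_leadingMinor hk)) g

end Uniqueness

/-! ### The Weyl group as signed permutations -/

section SignedPermutation

/-- The simple reflection in the coordinates `½ ε_j`. -/
def epsReflection (i : Fin n) : (Fin n → ℤ) →+ (Fin n → ℤ) where
  toFun x j := if i.val + 1 < n then x (nodeSwap i j) else if j = i then -x j else x j
  map_zero' := by ext; simp
  map_add' x y := by
    ext
    simp only [Pi.add_apply]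
    split_ifs <;> ring

/-- The action of a word in the simple reflections in the coordinates `½ ε_j`. -/
def epsAct : List (Fin n) → (Fin n → ℤ) →+ (Fin n → ℤ)
  | [] => AddMonoidHom.id _
  | i :: ω => (epsReflection i).comp (epsAct ω)

theorem epsAct_cons (i : Fin n) (ω : List (Fin n)) (v : Fin n → ℤ) :
    epsAct (i :: ω) v = epsReflection i (epsAct ω v) := rfl

theorem epsAct_append (ω ω' : List (Fin n)) (v : Fin n → ℤ) :
    epsAct (ω ++ ω') v = epsAct ω (epsAct ω' v) := by
  induction ω with
  | nil => rfl
  | cons i ω ih => rw [List.cons_append, epsAct_cons, ih, epsAct_cons]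

theorem epsAct_reverse_cons (i : Fin n) (ω : List (Fin n)) (v : Fin n → ℤ) :
    epsAct (i :: ω).reverse v = epsAct ω.reverse (epsReflection i v) := by
  rw [List.reverse_cons, epsAct_append]
  rfl

theorem epsReflection_of_lt {i : Fin n} (h : i.val + 1 < n) (v : Fin n → ℤ) :
    epsReflection i v = v ∘ nodeSwap i := by
  ext j
  simp [epsReflection, h]

theorem epsReflection_of_not_lt {i : Fin n} (h : ¬ i.val + 1 < n) (v : Fin n → ℤ) :
    epsReflection i v = fun j => if j = i then -v j else v j := by
  ext j
  simp [epsReflection, h]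

theorem epsReflection_epsReflection (i : Fin n) (v : Fin n → ℤ) :
    epsReflection i (epsReflection i v) = v := by
  by_cases h : i.val + 1 < n
  · ext j
    simp [epsReflection_of_lt h, nodeSwap_nodeSwap]
  · ext j
    rw [epsReflection_of_not_lt h, epsReflection_of_not_lt h]
    dsimp only
    split_ifs <;> simp

theorem dot_epsReflection (i : Fin n) (v w : Fin n → ℤ) :
    epsReflection i v ⬝ᵥ w = v ⬝ᵥ epsReflection i w := by
  by_cases h : i.val + 1 < n
  · rw [epsReflection_of_lt h, epsReflection_of_lt h]
    simp only [dotProduct, Function.comp_apply]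
    rw [← Equiv.sum_comp (nodeSwap i)]
    simp only [nodeSwap_nodeSwap]
  · rw [epsReflection_of_not_lt h, epsReflection_of_not_lt h]
    refine Finset.sum_congr rfl fun j _ => ?_
    dsimp only
    split_ifs <;> ring

theorem dot_epsAct (ω : List (Fin n)) (v w : Fin n → ℤ) :
    epsAct ω.reverse v ⬝ᵥ w = v ⬝ᵥ epsAct ω w := by
  induction ω generalizing v with
  | nil => rfl
  | cons i ω ih => rw [epsAct_reverse_cons, ih, dot_epsReflection, epsAct_cons]

theorem dot_epsReflection_self (i : Fin n) (v w : Fin n → ℤ) :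
    epsReflection i v ⬝ᵥ epsReflection i w = v ⬝ᵥ w := by
  rw [dot_epsReflection, epsReflection_epsReflection]

theorem dot_epsAct_self (ω : List (Fin n)) (v w : Fin n → ℤ) :
    epsAct ω v ⬝ᵥ epsAct ω w = v ⬝ᵥ w := by
  induction ω with
  | nil => rfl
  | cons i ω ih => rw [epsAct_cons, epsAct_cons, dot_epsReflection_self, ih]

/-- The direction of the simple root `α_i`: `ε_i - ε_{i+1}` for `i < n`, and `ε_n` for `i = n`. -/
def epsDir (i : Fin n) : Fin n → ℤ := fun m =>
  if m = i then 1 else if m.val = i.val + 1 then -1 else 0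

theorem epsDir_dot_of_lt {i : Fin n} (h : i.val + 1 < n) (v : Fin n → ℤ) :
    epsDir i ⬝ᵥ v = v i - v ⟨i.val + 1, h⟩ := by
  have : epsDir i = Pi.single i 1 - Pi.single ⟨i.val + 1, h⟩ 1 := by
    ext m
    simp only [epsDir, Pi.sub_apply, Pi.single_apply, Fin.ext_iff]
    split_ifs <;> omega
  rw [this, sub_dotProduct, single_one_dotProduct, single_one_dotProduct]

theorem epsDir_of_not_lt {i : Fin n} (h : ¬ i.val + 1 < n) : epsDir i = Pi.single i 1 := by
  ext m
  simp only [epsDir, Pi.single_apply, Fin.ext_iff]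
  split_ifs <;> omega

theorem epsDir_dot_of_not_lt {i : Fin n} (h : ¬ i.val + 1 < n) (v : Fin n → ℤ) :
    epsDir i ⬝ᵥ v = v i := by
  rw [epsDir_of_not_lt h, single_one_dotProduct]

theorem epsDir_dot_self (i : Fin n) :
    epsDir i ⬝ᵥ epsDir i = if i.val + 1 < n then 2 else 1 := by
  split_ifs with h
  · rw [epsDir_dot_of_lt h]
    simp [epsDir, Fin.ext_iff]
  · rw [epsDir_dot_of_not_lt h]
    simp [epsDir]

/-- The reflection along a vector of square length `1` or `2`. -/
def reflectAlong (v w : Fin n → ℤ) : Fin n → ℤ :=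
  if v ⬝ᵥ v = 1 then w - (2 * (v ⬝ᵥ w)) • v else w - (v ⬝ᵥ w) • v

theorem reflectAlong_epsDir (i : Fin n) (w : Fin n → ℤ) :
    reflectAlong (epsDir i) w = epsReflection i w := by
  rw [reflectAlong, epsDir_dot_self]
  by_cases h : i.val + 1 < n
  · rw [if_pos h, if_neg (by decide), epsDir_dot_of_lt h, epsReflection_of_lt h]
    ext m
    simp only [Function.comp_apply, nodeSwap_apply h, Pi.sub_apply, Pi.smul_apply, epsDir,
      smul_eq_mul]
    split_ifs with h1 h2
    · subst h1; ring
    · have : m = ⟨i.val + 1, h⟩ := Fin.ext h2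
      subst this; ring
    · ring
  · rw [if_neg h, if_pos rfl, epsDir_dot_of_not_lt h, epsReflection_of_not_lt h, epsDir_of_not_lt h]
    ext m
    simp only [Pi.sub_apply, Pi.smul_apply, Pi.single_apply, smul_eq_mul]
    split_ifs with h1
    · subst h1; ring
    · ring

theorem reflectAlong_epsReflection (i : Fin n) (v w : Fin n → ℤ) :
    reflectAlong (epsReflection i v) (epsReflection i w) = epsReflection i (reflectAlong v w) := by
  simp only [reflectAlong, dot_epsReflection_self]
  split_ifs <;> rw [map_sub, map_zsmul]

end SignedPermutation

/-! ### Positive roots as lexicographically positive short vectors, and the exchange condition -/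

section Lex

/-- The first nonzero coordinate is positive. -/
def LexPos (v : Fin n → ℤ) : Prop := ∃ a, 0 < v a ∧ ∀ b < a, v b = 0

theorem LexPos.add {v w : Fin n → ℤ} (hv : LexPos v) (hw : LexPos w) : LexPos (v + w) := by
  obtain ⟨a, ha, ha'⟩ := hv
  obtain ⟨b, hb, hb'⟩ := hw
  rcases lt_trichotomy a b with h | rfl | h
  · exact ⟨a, by simp [hb' a h, ha], fun c hc => by simp [ha' c hc, hb' c (hc.trans h)]⟩
  · exact ⟨a, add_pos ha hb, fun c hc => by simp [ha' c hc, hb' c hc]⟩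
  · exact ⟨b, by simp [ha' b h, hb], fun c hc => by simp [hb' c hc, ha' c (hc.trans h)]⟩

theorem lexPos_or_neg {v : Fin n → ℤ} (hv : v ≠ 0) : LexPos v ∨ LexPos (-v) := by
  have h : ∃ m : ℕ, ∃ a : Fin n, a.val = m ∧ v a ≠ 0 := by
    obtain ⟨a, ha⟩ := Function.ne_iff.1 hv
    exact ⟨a.val, a, rfl, ha⟩
  classical
  obtain ⟨a, ha, hva⟩ := Nat.find_spec h
  have hmin : ∀ b < a, v b = 0 := by
    intro b hb
    by_contra hvb
    exact Nat.find_min h (ha ▸ hb : b.val < Nat.find h) ⟨b, rfl, hvb⟩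
  rcases lt_or_gt_of_ne hva with h' | h'
  · exact Or.inr ⟨a, by simpa using h', fun b hb => by simp [hmin b hb]⟩
  · exact Or.inl ⟨a, h', hmin⟩

theorem LexPos.not_neg {v : Fin n → ℤ} (hv : LexPos v) : ¬ LexPos (-v) := by
  rintro ⟨b, hb, hb'⟩
  obtain ⟨a, ha, ha'⟩ := hv
  rw [Pi.neg_apply] at hb
  rcases lt_trichotomy a b with h | rfl | h
  · have := hb' a h
    simp at this
    omega
  · omega
  · have := ha' b h
    omega

theorem sq_add_sq_le {v : Fin n → ℤ} {a b : Fin n} (hab : a ≠ b) : v a * v a + v b * v b ≤ v ⬝ᵥ v := by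
  rw [← Finset.sum_pair (f := fun j => v j * v j) hab]
  exact Finset.sum_le_sum_of_subset_of_nonneg (Finset.subset_univ _)
    fun j _ _ => mul_self_nonneg _

theorem sq_add_sq_add_sq_le {v : Fin n → ℤ} {a b c : Fin n} (hab : a ≠ b) (hac : a ≠ c)
    (hbc : b ≠ c) : v a * v a + (v b * v b + v c * v c) ≤ v ⬝ᵥ v := by
  rw [← Finset.sum_pair (f := fun j => v j * v j) hbc,
    ← Finset.sum_insert (f := fun j => v j * v j) (by simp [hab, hac])]
  exact Finset.sum_le_sum_of_subset_of_nonneg (Finset.subset_univ _)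
    fun j _ _ => mul_self_nonneg _

/-- A simple reflection keeps every positive root positive except its own simple root; positive
roots are here the lexicographically positive integer vectors of square length at most 2. A swap of
neighbours spoils positivity only if the leading entry is at i and the next entry is negative, and a
sign change at n only if the leading entry is at n. -/
theorem eq_epsDir_of_lexPos {v : Fin n → ℤ} (hv : LexPos v) (h2 : v ⬝ᵥ v ≤ 2) (i : Fin n)
    (hi : ¬ LexPos (epsReflection i v)) : reflectAlong v = reflectAlong (epsDir i) := by
  obtain ⟨a, ha, ha'⟩ := hv
  by_cases h : i.val + 1 < n
  · rw [epsReflection_of_lt h] at hi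
    set i' : Fin n := ⟨i.val + 1, h⟩ with hi'
    have hii : i ≠ i' := by simp [hi', Fin.ext_iff]
    have hsw : ∀ j, (v ∘ nodeSwap i) j = if j = i then v i' else if j = i' then v i else v j := by
      intro j
      simp only [Function.comp_apply, nodeSwap_apply h, hi', Fin.ext_iff]
      split_ifs <;> rfl
    by_cases hai : a = i
    · subst hai
      by_cases hv' : v i' < 0
      · have h3 : 1 ≤ v a * v a := by nlinarith
        have h4 : 1 ≤ v i' * v i' := by nlinarith
        have h5 := sq_add_sq_le (v := v) hii
        have h6 : v a = 1 := by nlinarith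
        have h7 : v i' = -1 := by nlinarith
        have : v = epsDir a := by
          ext m
          by_cases hm : m = a
          · simp [epsDir, hm, h6]
          · by_cases hm' : m = i'
            · rw [hm', h7, epsDir, if_neg hii.symm, if_pos rfl]
            · have hm'' : m.val ≠ a.val + 1 := fun hc => hm' (Fin.ext hc)
              -- The entries 1 and −1 already exhaust the square length 2.
              have h8 := sq_add_sq_add_sq_le (v := v) hm hm' hii
              have h9 : v m * v m = 0 := le_antisymm (by linarith) (mul_self_nonneg _)
              rw [mul_self_eq_zero.1 h9, epsDir, if_neg hm, if_neg hm'']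
        rw [this]
      · exfalso
        rcases lt_or_eq_of_le (not_lt.1 hv') with hpos | hzero
        · refine hi ⟨a, by rw [hsw, if_pos rfl]; exact hpos, fun b hb => ?_⟩
          rw [hsw, if_neg hb.ne, if_neg, ha' b hb]
          rintro rfl
          exact absurd (Fin.lt_def.1 hb) (by simp [hi'])
        · refine hi ⟨i', by rw [hsw, if_neg hii.symm, if_pos rfl]; exact ha, fun b hb => ?_⟩
          rw [hsw]
          split_ifs with h3 h4
          · exact hzero.symm
          · exact absurd h4 hb.ne
          · refine ha' b (lt_of_le_of_ne ?_ h3)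
            have := Fin.lt_def.1 hb
            exact Fin.le_def.2 (by simp [hi'] at this; omega)
    · exfalso
      by_cases hai' : a = i'
      · refine hi ⟨i, by rw [hsw, if_pos rfl, ← hai']; exact ha, fun b hb => ?_⟩
        have hbi' : b < i' := hb.trans (Fin.lt_def.2 (by simp [hi']))
        rw [hsw, if_neg hb.ne, if_neg hbi'.ne, ha' b (hai' ▸ hbi')]
      · refine hi ⟨a, by rw [hsw, if_neg hai, if_neg hai']; exact ha, fun b hb => ?_⟩
        rw [hsw]
        have e1 : a.val ≠ i.val := fun hc => hai (Fin.ext hc)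
        have e2 : a.val ≠ i.val + 1 := fun hc => hai' (Fin.ext hc)
        have e3 := Fin.lt_def.1 hb
        split_ifs with h3 h4
        · subst h3
          exact ha' _ (Fin.lt_def.2 (by simp [hi']; omega))
        · subst h4
          exact ha' _ (Fin.lt_def.2 (by simp [hi'] at e3; omega))
        · exact ha' b hb
  · rw [epsReflection_of_not_lt h] at hi
    have hai : a = i := by
      by_contra hai
      refine hi ⟨a, by simpa [hai] using ha, fun b hb => ?_⟩
      simp [ha' b hb]
    subst hai
    have hv : v = v a • epsDir a := by
      ext m
      rw [epsDir_of_not_lt h]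
      by_cases hm : m = a
      · simp [hm]
      · have := ha' m (lt_of_le_of_ne (Fin.le_def.2 (by omega)) hm)
        simp [hm, this]
    have h1 : v a = 1 := by
      rw [hv, smul_dotProduct, dotProduct_smul, epsDir_dot_self, if_neg h] at h2
      simp only [smul_eq_mul, mul_one] at h2
      nlinarith
    rw [hv, h1, one_smul]

/-- The exchange condition. -/
theorem exists_shorter (ω : List (Fin n)) (v : Fin n → ℤ) (hv : LexPos v) (h2 : v ⬝ᵥ v ≤ 2)
    (h : ¬ LexPos (epsAct ω.reverse v)) :
    ∃ ω' : List (Fin n), ω'.length < ω.length ∧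
      ∀ w, reflectAlong v (epsAct ω w) = epsAct ω' w := by
  induction ω generalizing v with
  | nil => exact absurd hv h
  | cons j ω ih =>
    rw [epsAct_reverse_cons] at h
    by_cases hj : LexPos (epsReflection j v)
    · obtain ⟨ω', h1, h3⟩ := ih (epsReflection j v) hj (by rwa [dot_epsReflection_self]) h
      refine ⟨j :: ω', by simpa using h1, fun w => ?_⟩
      rw [epsAct_cons, epsAct_cons, ← h3, ← reflectAlong_epsReflection, epsReflection_epsReflection]
    -- The vector loses its positivity at this letter, so its reflection is s_j and cancels it.
    · refine ⟨ω, by simp, fun w => ?_⟩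
      rw [eq_epsDir_of_lexPos hv h2 j hj, reflectAlong_epsDir, epsAct_cons,
        epsReflection_epsReflection]

theorem epsDir_dot_self_le (i : Fin n) : epsDir i ⬝ᵥ epsDir i ≤ 2 := by
  rw [epsDir_dot_self]
  split_ifs <;> decide

theorem lexPos_epsDir (i : Fin n) : LexPos (epsDir i) := by
  refine ⟨i, by simp [epsDir], fun b hb => ?_⟩
  have := Fin.lt_def.1 hb
  rw [epsDir, if_neg hb.ne, if_neg (by omega)]

/-- The leading entry v_a contributes 2 v_a if a ≤ k, and all other entries together at least −2
(v·v − v_a²); as v_a ≥ 1 and v·v ≤ 2, the total is nonnegative. If a > k everything vanishes. -/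
theorem LexPos.dot_fundEps_nonneg {v : Fin n → ℤ} (hv : LexPos v) (h2 : v ⬝ᵥ v ≤ 2) (k : Fin n) :
    0 ≤ v ⬝ᵥ fundEps k := by
  obtain ⟨a, ha, ha'⟩ := hv
  have h : ∀ m, -(v m * v m) * 2 ≤ v m * fundEps k m := by
    intro m
    unfold fundEps
    split_ifs <;> nlinarith [sq_nonneg (v m), Int.le_self_sq (-v m)]
  by_cases hak : a ≤ k
  · have h3 : v a * fundEps k a + ∑ m ∈ Finset.univ.erase a, v m * fundEps k m = v ⬝ᵥ fundEps k :=
      Finset.add_sum_erase _ (fun m => v m * fundEps k m) (Finset.mem_univ a)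
    have h4 : v a * v a + ∑ m ∈ Finset.univ.erase a, v m * v m = v ⬝ᵥ v :=
      Finset.add_sum_erase _ (fun m => v m * v m) (Finset.mem_univ a)
    have h5 := Finset.sum_le_sum fun m (_ : m ∈ Finset.univ.erase a) => h m
    rw [← Finset.sum_mul, Finset.sum_neg_distrib] at h5
    have h6 : fundEps k a = 2 := if_pos hak
    rw [h6] at h3
    nlinarith
  · refine le_of_eq (Finset.sum_eq_zero fun m _ => ?_).symm
    by_cases hm : m ≤ k
    · rw [ha' m (lt_of_le_of_lt hm (not_le.1 hak)), zero_mul]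
    · rw [fundEps, if_neg hm, mul_zero]

end Lex

/-! ### Reduced words and the longest element -/

section WeylGroup

theorem epsReflection_eq {x : Fin n → ℤ} {lam : Weight n}
    (h : epsPairing n x = (2 : ℤ) • lam) (i : Fin n) :
    epsReflection i x = x - lam i • epsRoot i := by
  have hi := congrFun h i
  by_cases hl : i.val + 1 < n
  · rw [epsReflection_of_lt hl]
    rw [epsPairing_of_lt _ hl, Pi.smul_apply, smul_eq_mul] at hi
    ext m
    simp only [Function.comp_apply, nodeSwap_apply hl, Pi.sub_apply, Pi.smul_apply, epsRoot,
      smul_eq_mul]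
    split_ifs with h1 h2
    · subst h1; omega
    · have : m = ⟨i.val + 1, hl⟩ := Fin.ext h2
      subst this; omega
    · ring
  · rw [epsReflection_of_not_lt hl]
    rw [epsPairing_of_not_lt _ hl, Pi.smul_apply, smul_eq_mul] at hi
    ext m
    have : m.val ≠ i.val + 1 := by omega
    simp only [Pi.sub_apply, Pi.smul_apply, epsRoot, smul_eq_mul, this, if_false]
    split_ifs with h1
    · subst h1; omega
    · ring

theorem epsPairing_epsReflection {x : Fin n → ℤ} {lam : Weight n}
    (h : epsPairing n x = (2 : ℤ) • lam) (i : Fin n) :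
    epsPairing n (epsReflection i x) = (2 : ℤ) • (simple i).1 lam := by
  rw [epsReflection_eq h, map_sub, map_zsmul, h, epsPairing_epsRoot]
  change _ = (2 : ℤ) • simpleReflection i lam
  rw [simpleReflection, Module.reflection_apply, smul_sub, smul_comm (lam i)]
  rfl

theorem wordProd_cons (i : Fin n) (ω : List (Fin n)) :
    wordProd (i :: ω) = simple i * wordProd ω := by
  simp [wordProd]

theorem epsPairing_epsAct {x : Fin n → ℤ} {lam : Weight n}
    (h : epsPairing n x = (2 : ℤ) • lam) (ω : List (Fin n)) :
    epsPairing n (epsAct ω x) = (2 : ℤ) • (wordProd ω).1 lam := by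
  induction ω with
  | nil => exact h
  | cons i ω ih =>
    rw [epsAct_cons, epsPairing_epsReflection ih, wordProd_cons]
    rfl

/-- The coordinates `½ ε_j` of a weight. -/
theorem exists_epsPairing_eq (lam : Weight n) : ∃ x, epsPairing n x = (2 : ℤ) • lam := by
  have h : ∀ k : Fin n, ∃ x, epsPairing n x = (2 : ℤ) • fundWeight k := by
    intro k
    by_cases hk : k.val + 1 < n
    · exact ⟨_, epsPairing_fundEps hk⟩
    · refine ⟨fun _ => 1, ?_⟩
      ext m
      by_cases hm : m.val + 1 < n
      · have : m ≠ k := by rintro rfl; exact hk hm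
        rw [epsPairing_of_lt _ hm]
        simp [fundWeight, this]
      · have : m = k := Fin.ext (by omega)
        rw [epsPairing_of_not_lt _ hm]
        simp [fundWeight, this]
  choose e he using h
  refine ⟨∑ k, lam k • e k, ?_⟩
  simp only [map_sum, map_zsmul, he]
  ext m
  simp [fundWeight, Pi.single_apply, mul_comm]

theorem wordProd_eq_iff {ω ω' : List (Fin n)} :
    wordProd ω = wordProd ω' ↔ ∀ x, epsAct ω x = epsAct ω' x := by
  constructor
  · intro h x
    -- An arbitrary integer vector need not be the coordinate vector of a weight, but its double
    -- always is.
    have hx : epsPairing n ((2 : ℤ) • x) = (2 : ℤ) • epsPairing n x := map_zsmul _ _ _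
    have := epsPairing_injective
      ((epsPairing_epsAct hx ω).trans (h ▸ (epsPairing_epsAct hx ω').symm))
    rw [map_zsmul, map_zsmul] at this
    exact smul_right_injective _ (two_ne_zero : (2 : ℤ) ≠ 0) this
  · intro h
    apply Subtype.ext
    apply LinearEquiv.ext
    intro lam
    obtain ⟨x, hx⟩ := exists_epsPairing_eq lam
    have := (epsPairing_epsAct hx ω).symm.trans (h x ▸ epsPairing_epsAct hx ω')
    exact smul_right_injective _ (two_ne_zero : (2 : ℤ) ≠ 0) this

theorem length_wordProd_le (ω : List (Fin n)) : length (wordProd ω) ≤ ω.length :=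
  Nat.sInf_le ⟨ω, rfl, rfl⟩

/-- If s_i ω is reduced then ω⁻¹ α_i is a positive root, for otherwise the exchange condition
shortens the word; positive roots pair nonnegatively with Λ_k. -/
theorem epsDir_dot_nonneg_of_reduced {i : Fin n} {ω : List (Fin n)}
    (h : (i :: ω).length = length (wordProd (i :: ω))) (k : Fin n) :
    0 ≤ epsDir i ⬝ᵥ epsAct ω (fundEps k) := by
  rw [← dot_epsAct]
  by_cases hpos : LexPos (epsAct ω.reverse (epsDir i))
  · exact hpos.dot_fundEps_nonneg (by rw [dot_epsAct_self]; exact epsDir_dot_self_le i) k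
  · exfalso
    obtain ⟨ω', h1, h2⟩ := exists_shorter ω _ (lexPos_epsDir i) (epsDir_dot_self_le i) hpos
    have : wordProd (i :: ω) = wordProd ω' := wordProd_eq_iff.2 fun x => by
      rw [← h2, reflectAlong_epsDir, epsAct_cons]
    have h3 := length_wordProd_le ω'
    rw [← this, ← h, List.length_cons] at h3
    omega

theorem reduced_tail {i : Fin n} {ω : List (Fin n)}
    (h : (i :: ω).length = length (wordProd (i :: ω))) : ω.length = length (wordProd ω) := by
  obtain ⟨ω', h1, h2⟩ := exists_reduced (wordProd ω)
  have h3 := length_wordProd_le ω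
  have h4 := length_wordProd_le (i :: ω')
  rw [wordProd_cons, h1, ← wordProd_cons, ← h] at h4
  simp only [List.length_cons] at h4
  omega

/-- Maximal length forces w⁻¹ to make every simple root negative, hence also every ε_i, as a sum of
simple roots. So ε_i goes to −ε_{π(i)}, and negativity on ε_i − ε_{i+1} makes π increasing, that is,
the identity. -/
theorem epsAct_eq_neg_of_isLongest {ω : List (Fin n)} (hω : IsLongest (wordProd ω))
    (x : Fin n → ℤ) : epsAct ω x = -x := by
  have hneg : ∀ i, LexPos (-epsAct ω.reverse (epsDir i)) := by
    intro i
    have hne : epsAct ω.reverse (epsDir i) ≠ 0 := by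
      intro h0
      have h1 := dot_epsAct_self ω.reverse (epsDir i) (epsDir i)
      rw [h0, zero_dotProduct, epsDir_dot_self] at h1
      split_ifs at h1 <;> omega
    -- If ω⁻¹ α_i were positive, (s_i ω)⁻¹ α_i would be negative, and exchange in a reduced word of
    -- s_i ω would give a strictly shorter word for ω, so s_i ω would be longer than the longest
    -- element.
    refine (lexPos_or_neg hne).resolve_left fun hpos => ?_
    obtain ⟨ω₂, h1, h2⟩ := exists_reduced (wordProd (i :: ω))
    have h3 := wordProd_eq_iff.1 h1
    have h4 : epsAct ω₂.reverse (epsDir i) = -epsAct ω.reverse (epsDir i) := by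
      have hr : epsReflection i (epsDir i) = -epsDir i := by
        rw [← reflectAlong_epsDir, reflectAlong, epsDir_dot_self]
        by_cases hl : i.val + 1 < n
        · rw [if_pos hl, if_neg (by decide)]
          module
        · rw [if_neg hl, if_pos rfl]
          module
      have : ∀ w, epsAct ω₂.reverse (epsDir i) ⬝ᵥ w = (-epsAct ω.reverse (epsDir i)) ⬝ᵥ w := by
        intro w
        rw [dot_epsAct, h3, ← dot_epsAct, epsAct_reverse_cons, hr, map_neg]
      exact dotProduct_eq _ _ this
    obtain ⟨ω', h5, h6⟩ := exists_shorter ω₂ _ (lexPos_epsDir i) (epsDir_dot_self_le i)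
      (h4 ▸ hpos.not_neg)
    have h7 : wordProd ω = wordProd ω' := wordProd_eq_iff.2 fun w => by
      rw [← h6, reflectAlong_epsDir, h3, epsAct_cons, epsReflection_epsReflection]
    have h8 := length_wordProd_le ω'
    have h9 := hω (wordProd (i :: ω))
    rw [← h7] at h8
    omega
  have hpos : ∀ m : ℕ, ∀ i : Fin n, i.val + 1 + m = n →
      LexPos (-epsAct ω.reverse (Pi.single i 1)) := by
    intro m
    induction m with
    | zero =>
      intro i hi
      have := hneg i
      rwa [epsDir_of_not_lt (by omega)] at this
    | succ m ih =>
      intro i hi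
      have hl : i.val + 1 < n := by omega
      have := (hneg i).add (ih ⟨i.val + 1, hl⟩ (by simp; omega))
      rw [← neg_add, ← map_add] at this
      have he : (Pi.single i 1 : Fin n → ℤ) = epsDir i + Pi.single ⟨i.val + 1, hl⟩ 1 := ?_
      · rwa [he]
      ext b
      simp only [epsDir, Pi.add_apply, Pi.single_apply, Fin.ext_iff]
      split_ifs <;> omega
  have hunit : ∀ i : Fin n, ∃ a, epsAct ω.reverse (Pi.single i 1) = -Pi.single a 1 := by
    intro i
    obtain ⟨a, ha, -⟩ := hpos (n - (i.val + 1)) i (by omega)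
    have h1 := dot_epsAct_self ω.reverse (Pi.single i 1) (Pi.single i 1)
    rw [single_one_dotProduct, Pi.single_eq_same] at h1
    refine ⟨a, ?_⟩
    set v := epsAct ω.reverse (Pi.single i 1)
    rw [Pi.neg_apply] at ha
    ext b
    by_cases hb : b = a
    · subst hb
      have : v b * v b ≤ 1 := h1 ▸ Finset.single_le_sum (f := fun j => v j * v j)
        (fun j _ => mul_self_nonneg _) (Finset.mem_univ b)
      rw [Pi.neg_apply, Pi.single_eq_same]
      nlinarith
    · have h2 := sq_add_sq_le (v := v) hb
      have h3 : v b * v b = 0 := le_antisymm (by nlinarith) (mul_self_nonneg _)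
      simp [hb, mul_self_eq_zero.1 h3]
  choose π hπ using hunit
  have hlt : ∀ (i : Fin n) (h : i.val + 1 < n), π i < π ⟨i.val + 1, h⟩ := by
    intro i h
    have he : epsDir i = Pi.single i 1 - Pi.single ⟨i.val + 1, h⟩ 1 := by
      ext m
      simp only [epsDir, Pi.sub_apply, Pi.single_apply, Fin.ext_iff]
      split_ifs <;> omega
    obtain ⟨a, ha, ha'⟩ := hneg i
    rw [he, map_sub, hπ, hπ] at ha ha'
    simp only [Pi.neg_apply, Pi.sub_apply, Pi.single_apply] at ha ha'
    have h1 : a = π i := by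
      by_contra hc
      split_ifs at ha <;> omega
    subst h1
    by_contra hc
    rcases lt_or_eq_of_le (not_lt.1 hc) with h2 | h2
    · have := ha' _ h2
      simp [h2.ne] at this
    · rw [h2] at ha
      simp at ha
  have hmono : StrictMono π := by
    cases n with
    | zero => exact fun a => a.elim0
    | succ n =>
      rw [Fin.strictMono_iff_lt_succ]
      intro i
      exact hlt i.castSucc (by simp)
  have hid : π = id := hmono.eq_id
  refine dotProduct_eq _ _ fun w => ?_
  have hw : epsAct ω.reverse w = -w := by
    have : w = ∑ i, w i • (Pi.single i 1 : Fin n → ℤ) := by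
      ext m
      simp [Pi.single_apply]
    rw [this]
    simp only [map_sum, map_zsmul, hπ, hid, id, smul_neg, Finset.sum_neg_distrib]
  rw [dotProduct_comm, ← dot_epsAct, hw, neg_dotProduct, dotProduct_comm, neg_dotProduct]

end WeylGroup

/-! ### Staircase minors of an array satisfying the block recursion -/

section Determinant

variable (b : ℕ → ℕ → ℕ → ℂ) (C : ℕ → ℕ → ℂ)

/-- The minor with columns `p, …, p + s`, first row `r`, and rows `b p (s - 1), …, b p 0` below. -/
noncomputable def stairMinor (s p : ℕ) (r : ℕ → ℂ) : ℂ :=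
  (Matrix.of (Fin.cons (fun m => r (p + m.val)) fun (a : Fin s) (m : Fin (s + 1)) =>
    b p (s - 1 - a.val) (p + m.val)) : Matrix (Fin (s + 1)) (Fin (s + 1)) ℂ).det

theorem stairMinor_add_smul (s p : ℕ) (r r' : ℕ → ℂ) (x : ℂ) :
    stairMinor b s p (fun m => r m + x * r' m) = stairMinor b s p r + x * stairMinor b s p r' := by
  have h : ∀ r : ℕ → ℂ, stairMinor b s p r = (Matrix.updateRow (Matrix.of (Fin.cons
      (fun _ => (0 : ℂ)) fun (a : Fin s) (m : Fin (s + 1)) => b p (s - 1 - a.val) (p + m.val)) :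
      Matrix (Fin (s + 1)) (Fin (s + 1)) ℂ) 0 fun m => r (p + m.val)).det := by
    intro r
    rw [stairMinor]
    congr 1
    ext a m
    refine Fin.cases ?_ (fun a => ?_) a
    · simp
    · simp [Matrix.updateRow_apply]
  rw [h, h, h, ← Matrix.det_updateRow_smul, ← Matrix.det_updateRow_add]
  rfl

variable {b C}

/-- From each row b p j below the top one subtracts the multiple of the row above it that the
recursion (or `hr`, for the second row) provides. What remains is C p (j+1) / C p j times a row for
p + 1, which vanishes in column p. Expansion along that column leaves r p, and the ratios telescope
to C p (s+1) because C p 0 = 1. -/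
theorem stairMinor_succ {s p : ℕ} {r u : ℕ → ℂ} {x : ℂ} (hC : ∀ p j, C p j ≠ 0)
    (hC0 : C p 0 = 1)
    (hrec : ∀ j ≤ s, ∀ m, C p j * b p j m = C p (j + 1) * (b (p + 1) j m + b p (j + 1) m))
    (hzero : ∀ j ≤ s, b (p + 1) j p = 0) (hu : u p = 0)
    (hr : ∀ m, b p (s + 1) m = u m + x * r m) :
    stairMinor b (s + 1) p r =
      r p * C p (s + 1) * stairMinor b s (p + 1) (fun m => b (p + 1) s m + u m) := by
  have hdiv : ∀ j ≤ s, ∀ m, b p j m = C p (j + 1) / C p j * (b (p + 1) j m + b p (j + 1) m) := by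
    intro j hj m
    have := hrec j hj m
    have := hC p j
    field_simp
    linear_combination hrec j hj m
  let D : Fin (s + 1) → ℕ → ℂ :=
    Fin.cons (fun m => b (p + 1) s m + u m) fun (a : Fin s) m => b (p + 1) (s - 1 - a.val) m
  let v : Fin (s + 1) → ℂ := fun a => C p (s - a.val + 1) / C p (s - a.val)
  let B : Matrix (Fin (s + 1 + 1)) (Fin (s + 1 + 1)) ℂ :=
    Matrix.of (Fin.cons (fun m => r (p + m.val)) fun a m => v a * D a (p + m.val))
  have hD0 : ∀ a, D a p = 0 := by
    intro a
    refine Fin.cases ?_ (fun a => ?_) a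
    · simp [D, hzero s le_rfl, hu]
    · simp only [D, Fin.cons_succ]
      exact hzero _ (by omega)
  have hB : stairMinor b (s + 1) p r = B.det := by
    refine Matrix.det_eq_of_forall_row_eq_smul_add_pred
      (Fin.cons (v 0 * x) fun a : Fin s => v a.succ) ?_ ?_
    · intro m
      simp [B]
    · intro i m
      refine Fin.cases ?_ (fun a => ?_) i
      · simp only [Matrix.of_apply, Fin.cons_succ, Fin.cons_zero, Fin.castSucc_zero, B, v, D]
        simp only [Fin.val_zero, add_tsub_cancel_right, tsub_zero]
        rw [hdiv s le_rfl, hr]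
        ring
      · simp only [Matrix.of_apply, Fin.cons_succ, Fin.castSucc_succ, B, v, D]
        simp only [Fin.val_succ, Fin.val_castSucc, add_tsub_cancel_right]
        have h1 : s - (a.val + 1) = s - 1 - a.val := by omega
        have h2 : s - a.val = s - 1 - a.val + 1 := by omega
        rw [h1, h2, hdiv (s - 1 - a.val) (by omega)]
        ring
  have hprod : ∏ a, v a = C p (s + 1) := by
    have : ∀ s, ∏ a : Fin (s + 1), (C p (s - a.val + 1) / C p (s - a.val)) = C p (s + 1) := by
      intro s
      induction s with
      | zero => simp [hC0]
      | succ s ih =>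
        rw [Fin.prod_univ_succ]
        simp only [Fin.val_succ, Nat.add_sub_add_right, Fin.val_zero, tsub_zero]
        rw [ih]
        exact div_mul_cancel₀ _ (hC p _)
    exact this s
  rw [hB, Matrix.det_succ_column_zero, Finset.sum_eq_single 0]
  · have h1 : (B.submatrix (Fin.succAbove 0) Fin.succ).det = (∏ a, v a) *
        stairMinor b s (p + 1) (fun m => b (p + 1) s m + u m) := by
      rw [stairMinor, ← Matrix.det_mul_column]
      congr 1
      ext a m
      simp only [Matrix.submatrix_apply, Fin.succAbove_zero, B, Matrix.of_apply, Fin.cons_succ,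
        Fin.val_succ]
      congr 1
      rw [show p + (m.val + 1) = p + 1 + m.val by ring]
      refine Fin.cases ?_ (fun a => ?_) a <;> simp [D]
    rw [h1, hprod]
    simp [B]
    ring
  · intro a _ ha
    obtain ⟨a, rfl⟩ := Fin.exists_succ_eq.2 ha
    simp [B, hD0]
  · simp

variable {n : ℕ}

/-- With no gap between the top row and the next, r p = 1 / C p (s+1) cancels the factor C p (s+1),
and the smaller minor again has no gap. -/
theorem stairMinor_eq_one (hC : ∀ p j, C p j ≠ 0) (hC0 : ∀ p, C p 0 = 1)
    (hrec : ∀ p < n, ∀ j, j + 1 < n → ∀ m,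
      C p j * b p j m = C p (j + 1) * (b (p + 1) j m + b p (j + 1) m))
    (hzero : ∀ p j, j < n → ∀ m < p, m < n → b p j m = 0)
    (hone : ∀ p < n, ∀ j < n, C p j * b p j p = 1) (s p : ℕ) (hs : p + s < n) :
    stairMinor b s p (b p s) = 1 := by
  induction s generalizing p with
  | zero =>
    have := hone p (by omega) 0 (by omega)
    simpa [stairMinor, hC0] using this
  | succ s ih =>
    rw [stairMinor_succ (u := 0) (x := 1) hC (hC0 p)
      (fun j hj => hrec p (by omega) j (by omega))
      (fun j hj => hzero (p + 1) j (by omega) p (by omega) (by omega)) rfl (by simp)]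
    have := hone p (by omega) (s + 1) (by omega)
    simp only [Pi.zero_apply, add_zero]
    rw [ih (p + 1) (by omega), mul_one, mul_comm, this]

/-- The top row now skips the index s. After one reduction the new top row is a combination of b
(p+1) s, giving a minor without gap, equal to 1, and of b (p+1) (s+1), giving the minor with the
same gap at p + 1. The first has coefficient C p (s+1) / C p (s+2), the new summand; the second has
coefficient 1. -/
theorem stairMinor_eq_sum (hC : ∀ p j, C p j ≠ 0) (hC0 : ∀ p, C p 0 = 1)
    (hrec : ∀ p < n, ∀ j, j + 1 < n → ∀ m,
      C p j * b p j m = C p (j + 1) * (b (p + 1) j m + b p (j + 1) m))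
    (hzero : ∀ p j, j < n → ∀ m < p, m < n → b p j m = 0)
    (hone : ∀ p < n, ∀ j < n, C p j * b p j p = 1) (s p : ℕ) (hs : p + s + 1 < n) :
    stairMinor b s p (b p (s + 1)) = 1 / C (p + s) 1 +
      ∑ j ∈ Finset.range s, C (p + j) (s - j) / C (p + j) (s - j + 1) := by
  induction s generalizing p with
  | zero =>
    have := hone p (by omega) 1 (by omega)
    have h1 := hC p 1
    have h0 : stairMinor b 0 p (b p (0 + 1)) = b p 1 p := by simp [stairMinor]
    simp only [h0, Finset.range_zero, Finset.sum_empty, add_zero]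
    field_simp
    linear_combination this
  | succ s ih =>
    have hne := hC p (s + 1)
    have hne' := hC p (s + 1 + 1)
    -- The skipped row is recovered from the recursion at index s + 1, which expresses it through
    -- the top row b p (s+2) and a row for p + 1.
    rw [stairMinor_succ (u := fun m => C p (s + 1 + 1) / C p (s + 1) * b (p + 1) (s + 1) m)
      (x := C p (s + 1 + 1) / C p (s + 1)) hC (hC0 p)
      (fun j hj => hrec p (by omega) j (by omega))
      (fun j hj => hzero (p + 1) j (by omega) p (by omega) (by omega)) ?_ ?_]
    · have h1 := hone p (by omega) (s + 1 + 1) (by omega)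
      rw [stairMinor_add_smul, stairMinor_eq_one hC hC0 hrec hzero hone s (p + 1) (by omega),
        ih (p + 1) (by omega), Finset.sum_range_succ']
      have h2 : ∀ j, C (p + (j + 1)) (s + 1 - (j + 1)) / C (p + (j + 1)) (s + 1 - (j + 1) + 1) =
          C (p + 1 + j) (s - j) / C (p + 1 + j) (s - j + 1) := by
        intro j
        rw [Nat.add_sub_add_right, show p + (j + 1) = p + 1 + j by ring]
      have h3 : b p (s + 1 + 1) p = 1 / C p (s + 1 + 1) := by
        field_simp
        linear_combination h1
      simp only [h2, h3, add_zero, tsub_zero]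
      rw [show p + (s + 1) = p + 1 + s by ring]
      field_simp
      ring
    · simp only [hzero (p + 1) (s + 1) (by omega) p (by omega) (by omega), mul_zero]
    · intro m
      have := hrec p (by omega) (s + 1) (by omega) m
      field_simp
      linear_combination this

end Determinant

/-! ### Row operations performed by the factors of Θ⁻ -/

section RowAction

/-- The action of `𝐲_i(c)` on the rows of a matrix in `V(Λ_1)`. -/
noncomputable def rowStep (i : Fin n) (c : ℂ) (X : VecIdx n → ℂ) : VecIdx n → ℂ
  | .inl j =>
    if j = i then (if i.val + 1 < n then c⁻¹ else c⁻¹ ^ 2) * X (.inl j)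
    else if j.val = i.val + 1 then c * X (.inl j) + X (.inl i) else X (.inl j)
  | .inr (.inl _) =>
    if i.val + 1 = n then X (.inr (.inl ())) + c⁻¹ * X (.inl i) else X (.inr (.inl ()))
  | .inr (.inr j) =>
    if j = i then
      if h : i.val + 1 < n then c * X (.inr (.inr j)) + X (.inr (.inr ⟨i.val + 1, h⟩))
      else c ^ 2 * X (.inr (.inr j)) + 2 * c * X (.inr (.inl ())) + X (.inl i)
    else if j.val = i.val + 1 then c⁻¹ * X (.inr (.inr j)) else X (.inr (.inr j))

theorem lower_mul_apply {α : Type*} [Fintype α] [DecidableEq α] {σ : α → α} {d : α → ℤ}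
    (hσ : ∀ b, σ (σ b) = b) (hdσ : ∀ b, d (σ b) = -d b) (A : Matrix α α ℂ) (a b : α) :
    (lower σ d * A) a b = if d a = -1 then A (σ a) b else 0 := by
  have h : ∀ e, lower σ d a e = if e = σ a then if d a = -1 then 1 else 0 else 0 := by
    intro e
    simp only [lower, Matrix.of_apply]
    by_cases he : e = σ a
    · subst he
      simp [hσ, hdσ, neg_eq_iff_eq_neg]
    · rw [if_neg he, if_neg]
      rintro ⟨-, rfl⟩
      exact he (hσ e).symm
  simp only [Matrix.mul_apply, h]
  simp

theorem yBold_val (i : Fin n) (c : ℂˣ) : (yBold i c : Ambient n).val =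
    expQuad (genF i) c * diagPow (fun b => wt b i) (c : ℂ)⁻¹ := by
  simp only [yBold, Subgroup.coe_mul, Units.val_mul, y_val, coroot_val, Units.val_inv_eq_inv_val]

theorem expQuad_genF_mul_apply (i : Fin n) (t : ℂ) (X : Matrix (Idx n) (Idx n) ℂ) (a : VecIdx n)
    (b : Idx n) : (expQuad (genF i) t * X) (.inl a) b = ∑ e, expQuad (vecF i) t a e * X (.inl e) b := by
  rw [genF, expQuad_fromBlocks]
  simp [Matrix.mul_apply, Fintype.sum_sum_type]

theorem expQuad_vecF_of_lt {i : Fin n} (h : i.val + 1 < n) (t : ℂ) (X : VecIdx n → ℂ)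
    (a : VecIdx n) : ∑ e, expQuad (vecF i) t a e * X e =
      X a + t * if vecWt i a = -1 then X (vecSwap i a) else 0 := by
  have h1 := lower_mul_apply (vecSwap_vecSwap i) (vecWt_vecSwap i) (Matrix.of fun e _ => X e) a a
  rw [Matrix.mul_apply, ← vecF_eq_lower h] at h1
  simp only [Matrix.of_apply] at h1
  have h2 : vecF i * vecF i = 0 := by
    rw [vecF_eq_lower h]
    exact lower_mul_lower (vecWt_vecSwap i)
  rw [← h1, Finset.mul_sum]
  simp only [expQuad, h2, smul_zero, Matrix.add_apply, add_mul, Finset.sum_add_distrib,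
    Matrix.smul_apply, smul_eq_mul, mul_assoc, Matrix.one_apply]
  simp

theorem expQuad_vecF_of_last {i : Fin n} (h : i.val + 1 = n) (t : ℂ) (X : VecIdx n → ℂ)
    (a : VecIdx n) : ∑ e, expQuad (vecF i) t a e * X e =
      X a + (match a with
        | .inl _ => 0
        | .inr (.inl _) => t * X (.inl i)
        | .inr (.inr j) => if j = i then t ^ 2 * X (.inl i) + 2 * t * X (.inr (.inl ())) else 0) := by
  rw [vecF_eq_unitsThree h, expQuad_unitsThree (shortNode_injective i), expQuad_lowerThree]
  simp only [Matrix.add_apply, add_mul, Finset.sum_add_distrib, Matrix.one_apply, unitsThree_apply]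
  rcases a with a | a | a
  · simp [shortNode, Fin.sum_univ_three]
  · simp [shortNode, Fin.sum_univ_three]
  · simp [shortNode, Fin.sum_univ_three]

theorem yBold_mul_apply (i : Fin n) (c : ℂˣ) (X : Matrix (Idx n) (Idx n) ℂ) (a : VecIdx n)
    (b : Idx n) : ((yBold i c : Ambient n).val * X) (.inl a) b =
      rowStep i c (fun e => X (.inl e) b) a := by
  have hc := c.ne_zero
  rw [yBold_val, mul_assoc, expQuad_genF_mul_apply]
  simp only [diagPow, Matrix.diagonal_mul, wt, Sum.elim_inl]
  by_cases h : i.val + 1 < n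
  · have hn : i.val + 1 ≠ n := h.ne
    have hi : (⟨i.val + 1, h⟩ : Fin n) ≠ i := by simp [Fin.ext_iff]
    rw [expQuad_vecF_of_lt h c (fun e => (c : ℂ)⁻¹ ^ vecWt i e * X (.inl e) b)]
    rcases a with j | u | j
    · by_cases h1 : j = i
      · simp [rowStep, vecWt, h, h1]
      · by_cases h2 : j.val = i.val + 1
        · simp [rowStep, vecWt, vecSwap, h, h1, h2, nodeSwap_apply h, hc]
        · simp [rowStep, vecWt, h1, h2]
    · simp [rowStep, vecWt, hn]
    · by_cases h1 : j = i
      · simp [rowStep, vecWt, vecSwap, h, h1, nodeSwap_apply h, hc, hi]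
      · by_cases h2 : j.val = i.val + 1
        · simp [rowStep, vecWt, h1, h2]
        · simp [rowStep, vecWt, h1, h2]
  · have hn : i.val + 1 = n := by omega
    rw [expQuad_vecF_of_last hn c (fun e => (c : ℂ)⁻¹ ^ vecWt i e * X (.inl e) b)]
    have h2 : ∀ j : Fin n, j.val ≠ i.val + 1 := by omega
    rcases a with j | u | j
    · by_cases h1 : j = i
      · simp [rowStep, vecWt, h, h1]
      · simp [rowStep, vecWt, h1, h2]
    · simp [rowStep, vecWt, hn]
      field_simp
    · by_cases h1 : j = i
      · simp [rowStep, vecWt, h, h1]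
        field_simp
        norm_cast
        push_cast
        ring
      · simp [rowStep, vecWt, h1, h2]

end RowAction

/-! ### The effect of one block -/

section Block

variable {c : Fin n → ℂˣ} {W : ℕ → VecIdx n → ℂ}

/-- The sequence `1, c_1, …, c_n, 1, 1, …`. -/
noncomputable def paddedCoeff (c : Fin n → ℂˣ) (j : ℕ) : ℂ :=
  if j = 0 then 1 else if h : j - 1 < n then (c ⟨j - 1, h⟩ : ℂ) else 1

theorem paddedCoeff_zero (c : Fin n → ℂˣ) : paddedCoeff c 0 = 1 := if_pos rfl

theorem paddedCoeff_succ (c : Fin n → ℂˣ) {j : ℕ} (h : j < n) :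
    paddedCoeff c (j + 1) = c ⟨j, h⟩ := by
  simp [paddedCoeff, h]

theorem paddedCoeff_ne_zero (c : Fin n → ℂˣ) (j : ℕ) : paddedCoeff c j ≠ 0 := by
  unfold paddedCoeff
  split_ifs <;> simp

/-- The factors act from the right end of the block, so W n is the column fed into the block, W i
the column after the factors with index at least i, and W 0 the result. -/
theorem block_eq_of_untouched
    (hW : ∀ i (h : i < n), W i = rowStep ⟨i, h⟩ (c ⟨i, h⟩) (W (i + 1))) {a : VecIdx n} {s t : ℕ}
    (hst : s ≤ t) (ht : t ≤ n)
    (ha : ∀ (i : Fin n) (x : ℂ) X, s ≤ i.val → i.val < t → rowStep i x X a = X a) :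
    W s a = W t a := by
  induction t, hst using Nat.le_induction with
  | base => rfl
  | succ t hst ih =>
    rw [ih (by omega) fun i x X h1 h2 => ha i x X h1 (by omega), hW t (by omega)]
    exact ha ⟨t, by omega⟩ _ _ hst (Nat.lt_succ_self t)

theorem block_bar_first
    (hW : ∀ i (h : i < n), W i = rowStep ⟨i, h⟩ (c ⟨i, h⟩) (W (i + 1))) {j : ℕ} (hj : j < n) :
    paddedCoeff c j * W 0 (.inr (.inr ⟨j, hj⟩)) = W j (.inr (.inr ⟨j, hj⟩)) := by
  cases j with
  | zero => rw [paddedCoeff_zero, one_mul]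
  | succ j =>
    have h1 : W 0 (.inr (.inr ⟨j + 1, hj⟩)) = W j (.inr (.inr ⟨j + 1, hj⟩)) := by
      refine block_eq_of_untouched hW (Nat.zero_le _) (by omega) fun i x X _ hi => ?_
      have e1 : (⟨j + 1, hj⟩ : Fin n) ≠ i := by simp [Fin.ext_iff]; omega
      have e2 : j ≠ i.val := by omega
      simp [rowStep, e1, e2]
    rw [h1, hW j (by omega), paddedCoeff_succ c (by omega : j < n)]
    simp [rowStep]

theorem block_bar_last
    (hW : ∀ i (h : i < n), W i = rowStep ⟨i, h⟩ (c ⟨i, h⟩) (W (i + 1))) {j : ℕ} (hj : j < n) :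
    W (j + 1) (.inr (.inr ⟨j, hj⟩)) = W n (.inr (.inr ⟨j, hj⟩)) := by
  refine block_eq_of_untouched hW (by omega) le_rfl fun i x X hi _ => ?_
  have e1 : (⟨j, hj⟩ : Fin n) ≠ i := by simp [Fin.ext_iff]; omega
  have e2 : j ≠ i.val + 1 := by omega
  simp [rowStep, e1, e2]

/-- Row \bar j is touched twice: factor j replaces it by c_j times itself plus row \overline{j+1},
and factor j − 1, applied later, divides it by its own variable. Factor j likewise divides row
\overline{j+1} by c_j, and this is final, so the row added is c_j times its value in W 0. The first
row is never divided, whence the initial 1 in `paddedCoeff`. -/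
theorem block_bar (hW : ∀ i (h : i < n), W i = rowStep ⟨i, h⟩ (c ⟨i, h⟩) (W (i + 1))) {j : ℕ}
    (hj : j + 1 < n) : paddedCoeff c j * W 0 (.inr (.inr ⟨j, by omega⟩)) =
      paddedCoeff c (j + 1) * (W n (.inr (.inr ⟨j, by omega⟩)) + W 0 (.inr (.inr ⟨j + 1, hj⟩))) := by
  rw [block_bar_first hW, mul_add, block_bar_first hW, ← block_bar_last hW,
    hW j (by omega), paddedCoeff_succ c (by omega : j < n)]
  simp [rowStep, hj]

theorem block_bar_end (hW : ∀ i (h : i < n), W i = rowStep ⟨i, h⟩ (c ⟨i, h⟩) (W (i + 1))) {j : ℕ}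
    (hj : j + 1 = n) : paddedCoeff c j * W 0 (.inr (.inr ⟨j, by omega⟩)) =
      (c ⟨j, by omega⟩ : ℂ) ^ 2 * W n (.inr (.inr ⟨j, by omega⟩)) +
        2 * c ⟨j, by omega⟩ * W n (.inr (.inl ())) + W n (.inl ⟨j, by omega⟩) := by
  rw [block_bar_first hW, hW j (by omega), hj]
  simp [rowStep, hj]

theorem block_zero (hW : ∀ i (h : i < n), W i = rowStep ⟨i, h⟩ (c ⟨i, h⟩) (W (i + 1))) {j : ℕ}
    (hj : j + 1 = n) : W 0 (.inr (.inl ())) =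
      W n (.inr (.inl ())) + (c ⟨j, by omega⟩ : ℂ)⁻¹ * W n (.inl ⟨j, by omega⟩) := by
  have h1 : W 0 (.inr (.inl ())) = W j (.inr (.inl ())) := by
    refine block_eq_of_untouched hW (Nat.zero_le _) (by omega) fun i x X _ hi => ?_
    have e2 : i.val + 1 ≠ n := by omega
    simp [rowStep, e2]
  rw [h1, hW j (by omega), hj]
  simp [rowStep, hj]

theorem block_last (hW : ∀ i (h : i < n), W i = rowStep ⟨i, h⟩ (c ⟨i, h⟩) (W (i + 1))) {j : ℕ}
    (hj : j < n) : W (j + 1) (.inl ⟨j, hj⟩) = W n (.inl ⟨j, hj⟩) := by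
  refine block_eq_of_untouched hW (by omega) le_rfl fun i x X hi _ => ?_
  have e1 : (⟨j, hj⟩ : Fin n) ≠ i := by simp [Fin.ext_iff]; omega
  have e2 : j ≠ i.val + 1 := by omega
  simp [rowStep, e1, e2]

theorem block_inl_self (hW : ∀ i (h : i < n), W i = rowStep ⟨i, h⟩ (c ⟨i, h⟩) (W (i + 1))) {j : ℕ}
    (hj : j < n) : ∃ x : ℂ, W j (.inl ⟨j, hj⟩) = x * W n (.inl ⟨j, hj⟩) := by
  rw [hW j hj, ← block_last hW]
  exact ⟨_, by simp only [rowStep, if_true]; rfl⟩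

theorem block_inl_succ (hW : ∀ i (h : i < n), W i = rowStep ⟨i, h⟩ (c ⟨i, h⟩) (W (i + 1))) {j : ℕ}
    (hj : j + 1 < n) : ∃ x : ℂ, W 0 (.inl ⟨j + 1, hj⟩) =
      x * W n (.inl ⟨j + 1, hj⟩) + W n (.inl ⟨j, by omega⟩) := by
  have h1 : W 0 (.inl ⟨j + 1, hj⟩) = W j (.inl ⟨j + 1, hj⟩) := by
    refine block_eq_of_untouched hW (Nat.zero_le _) (by omega) fun i x X _ hi => ?_
    have e1 : (⟨j + 1, hj⟩ : Fin n) ≠ i := by simp [Fin.ext_iff]; omega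
    have e2 : j ≠ i.val := by omega
    simp [rowStep, e1, e2]
  obtain ⟨x, hx⟩ := block_inl_self hW hj
  refine ⟨c ⟨j, by omega⟩ * x, ?_⟩
  rw [h1, hW j (by omega), mul_assoc, ← hx, ← block_last hW]
  simp [rowStep]

end Block

/-! ### Triangularity of the partial products of Θ⁻ -/

section Theta

variable (c : Fin n → Fin n → ℂˣ)

/-- The product of the last `n - p` blocks of `Θ⁻`. -/
noncomputable def thetaTail (p : ℕ) : Matrix (Idx n) (Idx n) ℂ :=
  ((((List.ofFn fun p => (List.ofFn fun i => yBold i (c p i)).prod).drop p).prod : grp n) :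
    Ambient n).val

theorem thetaTail_last : thetaTail c n = 1 := by
  simp [thetaTail, List.drop_of_length_le]

/-- The rows of the partial products of a block applied to `thetaTail c (p + 1)`. -/
noncomputable def blockRows (p : Fin n) (m : Fin n) (i : ℕ) (a : VecIdx n) : ℂ :=
  (((((List.ofFn fun i => yBold i (c p i)).drop i).prod : grp n) : Ambient n).val *
    thetaTail c (p.val + 1)) (.inl a) (.inl (.inl m))

theorem blockRows_zero (p m : Fin n) (a : VecIdx n) :
    blockRows c p m 0 a = thetaTail c p (.inl a) (.inl (.inl m)) := by
  have : thetaTail c p = (((List.ofFn fun i => yBold i (c p i)).prod : grp n) : Ambient n).val *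
      thetaTail c (p.val + 1) := by
    rw [thetaTail, List.drop_eq_getElem_cons (by simp), List.prod_cons, Subgroup.coe_mul,
      Units.val_mul, List.getElem_ofFn]
    rfl
  rw [this]
  rfl

theorem blockRows_last (p m : Fin n) (a : VecIdx n) :
    blockRows c p m n a = thetaTail c (p + 1) (.inl a) (.inl (.inl m)) := by
  simp [blockRows, List.drop_of_length_le]

theorem blockRows_step (p m : Fin n) (i : ℕ) (h : i < n) :
    blockRows c p m i = rowStep ⟨i, h⟩ (c p ⟨i, h⟩) (blockRows c p m (i + 1)) := by
  funext a
  rw [blockRows, List.drop_eq_getElem_cons (by simpa using h), List.prod_cons, Subgroup.coe_mul,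
    Units.val_mul, List.getElem_ofFn, mul_assoc, yBold_mul_apply]
  rfl

/-- Each block passes row v_j on to row v_{j+1} with coefficient 1 and no further, so after r blocks
column m reaches row m + r first, with entry 1. -/
theorem thetaTail_inl {r p : ℕ} (hrp : p + r = n) (j m : Fin n) (hm : m.val + r ≤ j.val) :
    thetaTail c p (.inl (.inl j)) (.inl (.inl m)) = if m.val + r = j.val then 1 else 0 := by
  induction r generalizing p j with
  | zero =>
    obtain rfl : p = n := by omega
    rw [thetaTail_last, Matrix.one_apply]
    simp [Fin.ext_iff, eq_comm]
  | succ r ih =>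
    have hp : p < n := by omega
    obtain ⟨j, hj⟩ := j
    obtain _ | j := j
    · simp at hm
    · obtain ⟨x, hx⟩ := block_inl_succ (blockRows_step c ⟨p, hp⟩ m) hj
      rw [blockRows_zero, blockRows_last, blockRows_last] at hx
      simp only at hx hm
      rw [hx, ih (by omega) ⟨j + 1, hj⟩ (by simp only; omega),
        ih (by omega) ⟨j, by omega⟩ (by simp only; omega), if_neg (by simp only; omega)]
      simp only [mul_zero, zero_add, ← add_assoc, add_left_inj]

theorem thetaTail_zero_row {r p : ℕ} (hrp : p + r = n) (m : Fin n) (hm : m.val < p) :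
    thetaTail c p (.inl (.inr (.inl ()))) (.inl (.inl m)) = 0 := by
  induction r generalizing p with
  | zero =>
    obtain rfl : p = n := by omega
    simp [thetaTail_last]
  | succ r ih =>
    have hp : p < n := by omega
    have h1 := block_zero (blockRows_step c ⟨p, hp⟩ m) (j := n - 1) (by omega)
    rw [blockRows_zero, blockRows_last, blockRows_last] at h1
    simp only at h1
    rw [h1, ih (by omega) (by omega), thetaTail_inl c (r := r) (by omega) _ _ (by simp only; omega),
      if_neg (by simp only; omega)]
    simp

/-- With the old barred rows zero, `block_bar` says that C_j times the new entry does not depend on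
j. At the last node its value is the entry of row v_n in the later blocks, which is 1 exactly for m
= p. -/
theorem thetaTail_bar_step {p : ℕ} (hp : p < n) (m : Fin n) (hm : m.val ≤ p)
    (h0 : ∀ j, thetaTail c (p + 1) (.inl (.inr (.inr j))) (.inl (.inl m)) = 0) (d : ℕ) {j : ℕ}
    (hj : j + 1 + d = n) : paddedCoeff (c ⟨p, hp⟩) j *
      thetaTail c p (.inl (.inr (.inr ⟨j, by omega⟩))) (.inl (.inl m)) =
        if m.val = p then 1 else 0 := by
  induction d generalizing j with
  | zero =>
    have h1 := block_bar_end (blockRows_step c ⟨p, hp⟩ m) hj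
    rw [blockRows_zero, blockRows_last, blockRows_last, blockRows_last] at h1
    simp only at h1
    rw [h1, h0, thetaTail_zero_row c (r := n - (p + 1)) (by omega) m (by omega),
      thetaTail_inl c (r := n - (p + 1)) (by omega) _ _ (by simp only; omega)]
    simp only [mul_zero, zero_add]
    congr 1
    apply propext
    omega
  | succ d ih =>
    have h1 := block_bar (blockRows_step c ⟨p, hp⟩ m) (j := j) (by omega)
    rw [blockRows_zero, blockRows_last, blockRows_zero] at h1
    simp only at h1
    rw [h1, h0, zero_add, ih (by omega)]

theorem thetaTail_bar_eq_zero {r p : ℕ} (hrp : p + r = n) (m : Fin n) (hm : m.val < p) (j : Fin n) :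
    thetaTail c p (.inl (.inr (.inr j))) (.inl (.inl m)) = 0 := by
  induction r generalizing p j with
  | zero =>
    obtain rfl : p = n := by omega
    simp [thetaTail_last]
  | succ r ih =>
    have hp : p < n := by omega
    have h1 := thetaTail_bar_step c hp m hm.le (fun j => ih (by omega) (by omega) j)
      (n - (j.val + 1)) (j := j.val) (by omega)
    rw [if_neg hm.ne] at h1
    exact (mul_eq_zero.1 h1).resolve_left (paddedCoeff_ne_zero _ _)

/-- The entries of `thetaTail` in the rows `v_{j̄}` and the columns `v_m`. -/
noncomputable def barEntry (p j m : ℕ) : ℂ :=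
  if h : j < n ∧ m < n then
    thetaTail c p (.inl (.inr (.inr ⟨j, h.1⟩))) (.inl (.inl ⟨m, h.2⟩))
  else 0

/-- The variables `c p j`, shifted by one and preceded by `1`, for all natural numbers. -/
noncomputable def barCoeff (p j : ℕ) : ℂ :=
  if h : p < n then paddedCoeff (c ⟨p, h⟩) j else 1

theorem stairMinor_barEntry {k : ℕ} (hk : k + 1 < n) :
    stairMinor (barEntry c) k 0 (barEntry c 0 (k + 1)) =
      1 / (c ⟨k, by omega⟩ ⟨0, by omega⟩ : ℂ) + ∑ j : Fin k,
        (c ⟨j.val, by omega⟩ ⟨k - j.val - 1, by omega⟩ : ℂ) /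
          (c ⟨j.val, by omega⟩ ⟨k - j.val, by omega⟩ : ℂ) := by
  have hpad : ∀ p (hp : p < n) j (hj : j < n), barCoeff c p (j + 1) = c ⟨p, hp⟩ ⟨j, hj⟩ := by
    intro p hp j hj
    rw [barCoeff, dif_pos hp, paddedCoeff_succ _ hj]
  rw [stairMinor_eq_sum (n := n) (C := barCoeff c) ?_ ?_ ?_ ?_ ?_ k 0 (by omega), zero_add,
    hpad k (by omega) 0 (by omega), Finset.sum_range]
  · congr 1
    refine Finset.sum_congr rfl fun j _ => ?_
    rw [zero_add, hpad j (by omega) (k - j) (by omega)]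
    have h1 := hpad j (by omega) (k - j - 1) (by omega)
    rw [Nat.sub_add_cancel (by omega : 1 ≤ k - j.val)] at h1
    rw [h1]
  · intro p j
    unfold barCoeff
    split_ifs
    · exact paddedCoeff_ne_zero _ _
    · exact one_ne_zero
  · intro p
    unfold barCoeff
    split_ifs
    · exact paddedCoeff_zero _
    · rfl
  · intro p hp j hj m
    by_cases hm : m < n
    · have h1 := block_bar (blockRows_step c ⟨p, hp⟩ ⟨m, hm⟩) hj
      rw [blockRows_zero, blockRows_last, blockRows_zero] at h1
      rw [barEntry, barEntry, barEntry, barCoeff, barCoeff, dif_pos hp, dif_pos hp,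
        dif_pos ⟨by omega, hm⟩, dif_pos ⟨by omega, hm⟩, dif_pos ⟨hj, hm⟩]
      exact h1
    · simp [barEntry, hm]
  · intro p j hj m hmp hm
    rw [barEntry, dif_pos ⟨hj, hm⟩]
    by_cases hp : p ≤ n
    · exact thetaTail_bar_eq_zero c (r := n - p) (by omega) _ hmp _
    · have : thetaTail c p = 1 := by
        simp [thetaTail, List.drop_of_length_le, le_of_not_ge hp]
      simp [this]
  · intro p hp j hj
    rw [barEntry, dif_pos ⟨hj, hp⟩, barCoeff, dif_pos hp]
    have h1 := thetaTail_bar_step c hp ⟨p, hp⟩ le_rfl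
      (fun j => thetaTail_bar_eq_zero c (r := n - (p + 1)) (by omega) _ (Nat.lt_succ_self p) j)
      (n - (j + 1)) (j := j) (by omega)
    rwa [if_pos rfl] at h1

end Theta

/-! ### The lifts of simple reflections as signed permutations of the basis of V(Λ_1) -/

section SignedWord

/-- The sign with which `\bar s_i` acts on the basis vectors of `V(Λ_1)`. -/
def vecSign (i : Fin n) (b : VecIdx n) : ℂ :=
  if i.val + 1 < n then (if vecWt i b = -1 then -1 else 1)
  else match b with
    | .inr (.inl _) => -1
    | _ => 1

theorem vecSign_mul_self (i : Fin n) (b : VecIdx n) : vecSign i b * vecSign i b = 1 := by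
  unfold vecSign
  split_ifs
  · simp
  · simp
  · rcases b with b | b | b <;> simp

/-- The action of `\bar s_i` on families of vectors indexed like the basis of `V(Λ_1)`. -/
def signAct {m : Type*} (i : Fin n) (φ : VecIdx n → m → ℂ) (b : VecIdx n) (p : m) : ℂ :=
  vecSign i b * φ (vecSwap i b) p

/-- The iterated action of a word. -/
def signWord {m : Type*} : List (Fin n) → (VecIdx n → m → ℂ) → VecIdx n → m → ℂ
  | [], φ => φ
  | i :: ω, φ => signWord ω (signAct i φ)

theorem vecSwap_of_vecWt_eq_zero {i : Fin n} {b : VecIdx n} (h : vecWt i b = 0) :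
    vecSwap i b = b := by
  have key : ∀ j : Fin n, vecWt i (.inl j) = 0 → j ≠ i ∧ (i.val + 1 < n → nodeSwap i j = j) := by
    intro j hj
    simp only [vecWt] at hj
    have h1 : j ≠ i := by
      intro h1
      rw [if_pos h1] at hj
      split_ifs at hj <;> omega
    refine ⟨h1, fun hi => ?_⟩
    rw [if_neg h1] at hj
    have h2 : j.val ≠ i.val + 1 := by
      intro h2
      rw [if_pos h2] at hj
      omega
    rw [nodeSwap_apply hi, if_neg h1, if_neg h2]
  rcases b with j | u | j
  · obtain ⟨h1, h2⟩ := key j h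
    by_cases h3 : i.val + 1 < n
    · simp [vecSwap, h3, h2 h3]
    · simp [vecSwap, h3, h1]
  · rfl
  · obtain ⟨h1, h2⟩ := key j (by rw [vecWt_inr] at h; omega)
    by_cases h3 : i.val + 1 < n
    · simp [vecSwap, h3, h2 h3]
    · simp [vecSwap, h3, h1]

theorem sBar_val (i : Fin n) : (sBar i : Ambient n).val =
    Matrix.fromBlocks (expQuad (vecE i) (-1) * expQuad (vecF i) 1 * expQuad (vecE i) (-1)) 0 0
      (expQuad (spinE i) (-1) * expQuad (spinF i) 1 * expQuad (spinE i) (-1)) := by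
  simp only [sBar, Subgroup.coe_mul, Units.val_mul, x_val, y_val, genE, genF, expQuad_fromBlocks,
    Matrix.fromBlocks_multiply, Matrix.mul_zero, Matrix.zero_mul, add_zero, zero_add]

/-- On a two-dimensional block the product is !![0, -1; 1, 0], so the minus sign sits on weight −1;
on the adjoint block of the short root it sits on v_0 only. -/
theorem sBar_vec_apply (i : Fin n) (a b : VecIdx n) :
    (expQuad (vecE i) (-1) * expQuad (vecF i) 1 * expQuad (vecE i) (-1)) a b =
      if a = vecSwap i b then vecSign i b else 0 := by
  by_cases h : i.val + 1 < n
  · have hd := vecWt_vecSwap i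
    have hσ := vecSwap_vecSwap i
    have h1 := raise_mul_lower_mul_raise hσ hd
    have h2 := lower_mul_raise_mul_lower hσ hd
    have he := raise_mul_raise (σ := vecSwap i) hd
    have hf := lower_mul_lower (σ := vecSwap i) hd
    rw [vecE_eq_raise h, vecF_eq_lower h, expQuad_e_two (f := lower (vecSwap i) (vecWt i)) he,
      expQuad_f_two (e := raise (vecSwap i) (vecWt i)) hf, one_add_unitsTwo_mul he hf h1 h2,
      one_add_unitsTwo_mul he hf h1 h2]
    simp only [unitsTwo, raise_mul_lower hσ hd, lower_mul_raise hσ hd]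
    simp only [Matrix.add_apply, Matrix.smul_apply, smul_eq_mul, Matrix.one_apply, Matrix.diagonal_apply, raise, lower,
      Matrix.of_apply, vecSign, if_pos h]
    have hcases : vecWt i b = -1 ∨ vecWt i b = 0 ∨ vecWt i b = 1 := by
      rcases b with j | u | j <;> simp only [vecWt, h, if_true]
      · split_ifs <;> simp
      · simp
      · split_ifs <;> simp
    have hne : vecWt i b ≠ 0 → vecSwap i b ≠ b := by
      intro h0 heq
      have := hd b
      rw [heq] at this
      omega
    by_cases hab : a = b
    · subst hab
      rcases hcases with h3 | h3 | h3
      · simp [h3, (hne (by omega)).symm]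
      · simp [h3, vecSwap_of_vecWt_eq_zero h3]
      · simp [h3, (hne (by omega)).symm]
    · rcases hcases with h3 | h3 | h3
      · simp [h3, hab]
      · simp [h3, vecSwap_of_vecWt_eq_zero h3, hab]
      · simp [h3, hab]
  · have hi : i.val + 1 = n := by omega
    have hι := shortNode_injective i
    rw [vecE_eq_unitsThree hi, vecF_eq_unitsThree hi, expQuad_unitsThree hι,
      expQuad_unitsThree hι, one_add_unitsThree_mul hι, one_add_unitsThree_mul hι,
      expQuad_raiseThree, expQuad_lowerThree]
    have hM : !![1, 2 * (-1 : ℂ), (-1) ^ 2; 0, 1, -1; 0, 0, 1] * !![1, 0, 0; 1, 1, 0; 1 ^ 2, 2 * 1, 1] *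
        !![1, 2 * (-1 : ℂ), (-1) ^ 2; 0, 1, -1; 0, 0, 1] - 1 =
          !![-1, 0, 1; 0, -2, 0; 1, 0, -1] := by
      ext a b
      fin_cases a <;> fin_cases b <;> norm_num [Matrix.mul_apply, Fin.sum_univ_three]
    rw [hM, Matrix.add_apply, unitsThree_apply]
    rcases a with a | a | a <;> rcases b with b | b | b <;>
      by_cases hb : b = i <;>
      simp [Matrix.one_apply, shortNode, Fin.sum_univ_three, vecSwap, vecSign, h, hb]
    all_goals (try split_ifs) <;> norm_num

theorem mul_sBar_apply (i : Fin n) (X : Matrix (Idx n) (Idx n) ℂ) (a : Idx n) (b : VecIdx n) :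
    (X * (sBar i : Ambient n).val) a (.inl b) = vecSign i b * X a (.inl (vecSwap i b)) := by
  rw [sBar_val, Matrix.mul_apply, Fintype.sum_sum_type]
  simp [sBar_vec_apply, mul_comm]

theorem vecSwap_injective (i : Fin n) : Function.Injective (vecSwap i) :=
  Function.LeftInverse.injective (vecSwap_vecSwap i)

/-- A signed permutation matrix is orthogonal, so its inverse acts on rows exactly as it acts on
columns; one `signWord` then serves both sides of the minor. -/
theorem sBar_inv_mul_apply (i : Fin n) (Y : Matrix (Idx n) (Idx n) ℂ) (a : Idx n) (b : VecIdx n) :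
    ((sBar i : Ambient n)⁻¹.val * Y) (.inl b) a = vecSign i b * Y (.inl (vecSwap i b)) a := by
  set Z := (sBar i : Ambient n)⁻¹.val * Y with hZ
  have hY : Y = (sBar i : Ambient n).val * Z := by rw [hZ, Units.mul_inv_cancel_left]
  have h : Y (.inl (vecSwap i b)) a = vecSign i b * Z (.inl b) a := by
    rw [hY, sBar_val, Matrix.mul_apply, Fintype.sum_sum_type]
    simp [sBar_vec_apply, (vecSwap_injective i).eq_iff]
  rw [h, ← mul_assoc, vecSign_mul_self, one_mul]

theorem mul_wordLift_apply {m : Type*} (ω : List (Fin n)) (X : Matrix (Idx n) (Idx n) ℂ)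
    (r : m → Idx n) (b : VecIdx n) (p : m) :
    (X * ((ω.map sBar).prod : Ambient n).val) (r p) (.inl b) =
      signWord ω (fun b p => X (r p) (.inl b)) b p := by
  induction ω generalizing X with
  | nil => simp [signWord]
  | cons i ω ih =>
    rw [List.map_cons, List.prod_cons, Subgroup.coe_mul, Units.val_mul, ← mul_assoc, ih, signWord]
    simp only [mul_sBar_apply]
    rfl

theorem wordLift_inv_mul_apply {m : Type*} (ω : List (Fin n)) (Y : Matrix (Idx n) (Idx n) ℂ)
    (r : m → Idx n) (b : VecIdx n) (p : m) :
    (((ω.map sBar).prod : Ambient n)⁻¹.val * Y) (.inl b) (r p) =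
      signWord ω (fun b p => Y (.inl b) (r p)) b p := by
  induction ω generalizing Y with
  | nil => simp [signWord]
  | cons i ω ih =>
    rw [List.map_cons, List.prod_cons, Subgroup.coe_mul, mul_inv_rev, Units.val_mul, mul_assoc, ih,
      signWord]
    simp only [sBar_inv_mul_apply]
    rfl

end SignedWord

/-! ### Extremal vectors in exterior powers and their signs -/

section Support

/-- The position of a basis vector in the order `v_1, …, v_n, v_0, v_{n̄}, …, v_{1̄}`. -/
def vecRank : VecIdx n → ℕ
  | .inl j => j.val
  | .inr (.inl _) => n
  | .inr (.inr j) => 2 * n - j.val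

/-- The basis vectors which occur in an extremal vector of weight `½ ∑ x_j ε_j`. -/
def vecSupp (x : Fin n → ℤ) : VecIdx n → Prop
  | .inl j => x j = 2
  | .inr (.inl _) => False
  | .inr (.inr j) => x j = -2

theorem vecRank_injective : Function.Injective (vecRank (n := n)) := by
  rintro (a | a | a) (b | b | b) h <;> simp only [vecRank] at h
  · rw [Fin.ext h]
  · omega
  · omega
  · omega
  · rfl
  · omega
  · omega
  · omega
  · rw [Fin.ext (by omega : a.val = b.val)]

/-- A reflection of a long simple root moves a vector to the neighbouring position, and that of the
short one moves v_n to v_{n̄}, jumping over v_0. -/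
theorem vecRank_vecSwap {i : Fin n} {b : VecIdx n} (h : 0 ≤ vecWt i b) :
    (vecRank (vecSwap i b) : ℤ) = vecRank b + vecWt i b := by
  by_cases h0 : vecWt i b = 0
  · rw [vecSwap_of_vecWt_eq_zero h0, h0, add_zero]
  · by_cases hi : i.val + 1 < n
    · rcases b with j | u | j
      · simp only [vecWt, hi, if_true] at h h0 ⊢
        simp only [vecSwap, hi, if_true, nodeSwap_apply hi, vecRank, Fin.ext_iff] at h h0 ⊢
        split_ifs at h h0 ⊢ <;> first | omega | (simp only; omega)
      · exact absurd rfl h0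
      · simp only [vecWt, hi, if_true] at h h0 ⊢
        simp only [vecSwap, hi, if_true, nodeSwap_apply hi, vecRank, Fin.ext_iff] at h h0 ⊢
        split_ifs at h h0 ⊢ <;> omega
    · rcases b with j | u | j
      · simp only [vecWt, hi, if_false] at h h0 ⊢
        by_cases hj : j = i
        · subst hj
          simp only [vecSwap, hi, if_false, if_true, vecRank]
          omega
        · simp only [hj, if_false] at h h0
          split_ifs at h h0 <;> omega
      · exact absurd rfl h0
      · simp only [vecWt, hi, if_false] at h h0
        split_ifs at h h0 <;> omega

theorem vecWt_le_one_or {i : Fin n} (b : VecIdx n) :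
    vecWt i b ≤ 1 ∨ (vecWt i b = 2 ∧ vecRank b + 1 = n) := by
  rcases b with j | u | j
  · by_cases hj : j = i
    · subst hj
      simp only [vecWt, vecRank, if_true]
      split_ifs <;> omega
    · simp only [vecWt, hj, if_false]
      split_ifs <;> omega
  · simp [vecWt]
  · simp only [vecWt]
    split_ifs <;> omega

theorem vecSupp_epsReflection (i : Fin n) (x : Fin n → ℤ) (b : VecIdx n) :
    vecSupp (epsReflection i x) b ↔ vecSupp x (vecSwap i b) := by
  by_cases hi : i.val + 1 < n
  · rw [epsReflection_of_lt hi]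
    rcases b with j | u | j <;> simp [vecSupp, vecSwap, hi]
  · rw [epsReflection_of_not_lt hi]
    rcases b with j | u | j
    · by_cases hj : j = i
      · simp [vecSupp, vecSwap, hi, hj, neg_eq_iff_eq_neg]
      · simp [vecSupp, vecSwap, hi, hj]
    · simp [vecSupp, vecSwap]
    · by_cases hj : j = i
      · simp [vecSupp, vecSwap, hi, hj]
      · simp [vecSupp, vecSwap, hi, hj]

theorem epsAct_fundEps_mem (ω : List (Fin n)) (k j : Fin n) :
    epsAct ω (fundEps k) j = 2 ∨ epsAct ω (fundEps k) j = 0 ∨ epsAct ω (fundEps k) j = -2 := by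
  induction ω generalizing j with
  | nil =>
    change fundEps k j = 2 ∨ fundEps k j = 0 ∨ fundEps k j = -2
    unfold fundEps
    split_ifs <;> simp
  | cons i ω ih =>
    rw [epsAct_cons]
    by_cases hi : i.val + 1 < n
    · rw [epsReflection_of_lt hi]
      exact ih _
    · rw [epsReflection_of_not_lt hi]
      have := ih j
      dsimp only
      split_ifs <;> omega

theorem vecSign_of_nonneg {i : Fin n} {x : Fin n → ℤ} {b : VecIdx n} (hb : vecSupp x b)
    (h : vecWt i b ≠ -1) : vecSign i b = 1 := by
  unfold vecSign
  split_ifs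
  · rfl
  · rcases b with b | b | b
    · rfl
    · exact hb.elim
    · rfl

/-- How `\bar s_i` permutes the support of an extremal vector with `⟨h_i, wt⟩ ≥ 0`. -/
theorem support_cases {i : Fin n} {x : Fin n → ℤ} (hx : ∀ j, x j = 2 ∨ x j = 0 ∨ x j = -2)
    (h : 0 ≤ epsDir i ⬝ᵥ x) :
    (∀ b, vecSupp x b → 0 ≤ vecWt i b) ∨
      (epsReflection i x = x ∧ ∃ u v, vecSupp x u ∧ vecSupp x v ∧ vecSwap i u = v ∧
        vecWt i u = 1 ∧ vecSign i v = -1 ∧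
        ∀ b, vecSupp x b → b ≠ u → b ≠ v → vecWt i b = 0) := by
  by_cases hi : i.val + 1 < n
  · rw [epsDir_dot_of_lt hi] at h
    set i' : Fin n := ⟨i.val + 1, hi⟩ with hi'
    have hne : i' ≠ i := by simp [hi', Fin.ext_iff]
    have hval : ∀ j : Fin n, j.val = i.val + 1 ↔ j = i' := by simp [hi', Fin.ext_iff]
    by_cases heq : x i = x i'
    · have hfix : epsReflection i x = x := by
        rw [epsReflection_of_lt hi]
        ext j
        simp only [Function.comp_apply, nodeSwap_apply hi, hval]
        split_ifs with h1 h2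
        · rw [h1, heq]
        · rw [h2, heq]
        · rfl
      rcases hx i with hxi | hxi | hxi
      · refine Or.inr ⟨hfix, .inl i, .inl i', hxi, heq.symm.trans hxi, ?_, ?_, ?_, ?_⟩
        · simp [vecSwap, hi, nodeSwap_apply hi, hi']
        · simp [vecWt, hi]
        · simp [vecSign, vecWt, hi, hne, hval]
        · rintro (j | u | j) hj h1 h2
          · have h1' : j ≠ i := fun hc => h1 (by rw [hc])
            have h2' : j ≠ i' := fun hc => h2 (by rw [hc])
            simp [vecWt, h1', h2', hval]
          · rfl
          · have hj' : x j = -2 := hj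
            have h1' : j ≠ i := by rintro rfl; omega
            have h2' : j ≠ i' := by rintro rfl; omega
            simp [vecWt, h1', h2', hval]
      · left
        rintro (j | u | j) hj
        · have hj' : x j = 2 := hj
          have h1' : j ≠ i := by rintro rfl; omega
          have h2' : j ≠ i' := by rintro rfl; omega
          simp [vecWt, h1', h2', hval]
        · exact le_rfl
        · have hj' : x j = -2 := hj
          have h1' : j ≠ i := by rintro rfl; omega
          have h2' : j ≠ i' := by rintro rfl; omega
          simp [vecWt, h1', h2', hval]
      · refine Or.inr ⟨hfix, .inr (.inr i'), .inr (.inr i), heq.symm.trans hxi, hxi, ?_, ?_, ?_, ?_⟩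
        · simp only [vecSwap, hi, if_true, nodeSwap_apply hi, hval, hne, if_false]
        · simp [vecWt, hne, hval]
        · simp [vecSign, vecWt, hi]
        · rintro (j | u | j) hj h1 h2
          · have hj' : x j = 2 := hj
            have h1' : j ≠ i := by rintro rfl; omega
            have h2' : j ≠ i' := by rintro rfl; omega
            simp [vecWt, h1', h2', hval]
          · rfl
          · have h1' : j ≠ i' := fun hc => h1 (by rw [hc])
            have h2' : j ≠ i := fun hc => h2 (by rw [hc])
            simp [vecWt, h1', h2', hval]
    · left
      have hxi := hx i
      have hxi' := hx i'
      rintro (j | u | j) hj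
      · have hj' : x j = 2 := hj
        have h2' : j ≠ i' := by rintro rfl; omega
        simp only [vecWt, hi, hval, h2', if_true, if_false]
        split_ifs <;> simp
      · exact le_rfl
      · have hj' : x j = -2 := hj
        have h2' : j ≠ i := by rintro rfl; omega
        simp only [vecWt, hval, h2', if_false]
        split_ifs <;> simp
  · rw [epsDir_dot_of_not_lt hi] at h
    left
    have hval : ∀ j : Fin n, j.val ≠ i.val + 1 := by omega
    rintro (j | u | j) hj
    · simp only [vecWt, hi, hval, if_false]
      split_ifs <;> simp
    · exact le_rfl
    · have hj' : x j = -2 := hj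
      have h2' : j ≠ i := by rintro rfl; omega
      simp [vecWt, hval, h2']

theorem mem_range_inl_iff_vecSupp (k : Fin n) (b : VecIdx n) :
    b ∈ Set.range (fun a : Fin (k.val + 1) => (.inl ⟨a.val, by omega⟩ : VecIdx n)) ↔
      vecSupp (fundEps k) b := by
  rcases b with j | u | j
  · constructor
    · rintro ⟨a, ha⟩
      simp only [Sum.inl.injEq] at ha
      subst ha
      exact if_pos (Fin.le_def.2 (Nat.lt_succ_iff.1 a.isLt))
    · intro h
      have : j ≤ k := by
        by_contra hc
        simp [vecSupp, fundEps, hc] at h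
      exact ⟨⟨j.val, Nat.lt_succ_of_le (Fin.le_def.1 this)⟩, rfl⟩
  · simp [vecSupp]
  · simp only [Set.mem_range, reduceCtorEq, exists_false, vecSupp, fundEps, false_iff]
    split_ifs <;> decide

/-- Extending a reduced word on the left keeps the wedge increasing with sign +1. By
`epsDir_dot_nonneg_of_reduced` only two cases arise: either all vectors of the support move weakly
down the order, without signs, or two of them are exchanged and the minus sign of one cancels the
sign of the transposition. -/
theorem exists_sorted_support (k : Fin n) (ω : List (Fin n))
    (hω : ω.length = length (wordProd ω)) :
    ∃ S : Fin (k.val + 1) → VecIdx n, StrictMono (fun a => vecRank (S a)) ∧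
      (∀ b, b ∈ Set.range S ↔ vecSupp (epsAct ω (fundEps k)) b) ∧
      ∀ φ : VecIdx n → Fin (k.val + 1) → ℂ,
        (Matrix.of fun a => signWord ω φ (.inl ⟨a.val, by omega⟩)).det =
          (Matrix.of fun a => φ (S a)).det := by
  induction ω with
  | nil =>
    exact ⟨fun a => .inl ⟨a.val, by omega⟩, fun a b hab => hab, mem_range_inl_iff_vecSupp k,
      fun φ => rfl⟩
  | cons i ω ih =>
    obtain ⟨S, hmono, hrange, hdet⟩ := ih (reduced_tail hω)
    have hinj : Function.Injective S := fun a b hab =>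
      hmono.injective (congrArg vecRank hab)
    have hsupp : ∀ a, vecSupp (epsAct ω (fundEps k)) (S a) := fun a => (hrange _).1 ⟨a, rfl⟩
    have hstep : ∀ φ : VecIdx n → Fin (k.val + 1) → ℂ,
        (Matrix.of fun a => signWord (i :: ω) φ (.inl ⟨a.val, by omega⟩)).det =
          (∏ a, vecSign i (S a)) * (Matrix.of fun a => φ (vecSwap i (S a))).det := by
      intro φ
      rw [← Matrix.det_mul_column]
      exact hdet (signAct i φ)
    rw [epsAct_cons]
    rcases support_cases (epsAct_fundEps_mem ω k) (epsDir_dot_nonneg_of_reduced hω k) with h |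
      ⟨hfix, u, v, hu, hv, huv, hwu, hsv, hrest⟩
    · refine ⟨fun a => vecSwap i (S a), ?_, ?_, ?_⟩
      · intro a b hab
        have h1 : vecRank (S a) < vecRank (S b) := hmono hab
        have h2 := h _ (hsupp a)
        have h3 := h _ (hsupp b)
        have h4 := vecRank_vecSwap h2
        have h5 := vecRank_vecSwap h3
        have h6 : S b ≠ vecSwap i (S a) := by
          intro hc
          have h7 := vecWt_vecSwap i (S a)
          rw [← hc] at h7 h4
          omega
        have h7 : vecRank (S b) ≠ vecRank (vecSwap i (S a)) := fun hc => h6 (vecRank_injective hc)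
        -- No vector of the support is v_0, so the jump of v_n by two positions overtakes nothing.
        have h8 : vecRank (S b) ≠ n := by
          intro hc
          have := vecRank_injective (a₁ := S b) (a₂ := .inr (.inl ())) hc
          have h9 := hsupp b
          rw [this] at h9
          exact h9
        have h9 := vecWt_le_one_or (i := i) (S a)
        show vecRank (vecSwap i (S a)) < vecRank (vecSwap i (S b))
        omega
      · intro b
        rw [vecSupp_epsReflection, ← hrange]
        constructor
        · rintro ⟨a, rfl⟩
          exact ⟨a, (vecSwap_vecSwap i _).symm⟩
        · rintro ⟨a, ha⟩
          exact ⟨a, by simp only [ha, vecSwap_vecSwap]⟩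
      · intro φ
        rw [hstep, Finset.prod_eq_one, one_mul]
        intro a _
        refine vecSign_of_nonneg (hsupp a) ?_
        have := h _ (hsupp a)
        omega
    · refine ⟨S, hmono, by rwa [hfix], fun φ => ?_⟩
      obtain ⟨a₀, rfl⟩ := (hrange u).2 hu
      obtain ⟨a₁, rfl⟩ := (hrange v).2 hv
      have hne : a₀ ≠ a₁ := by
        rintro rfl
        have := vecWt_vecSwap i (S a₀)
        rw [huv] at this
        omega
      -- In the second case s_i exchanges two rows of the minor and fixes the others.
      have hperm : (Matrix.of fun a => φ (vecSwap i (S a))) =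
          (Matrix.of fun a => φ (S a)).submatrix (Equiv.swap a₀ a₁) id := by
        ext a p
        simp only [Matrix.of_apply, Matrix.submatrix_apply, id]
        by_cases h0 : a = a₀
        · rw [h0, Equiv.swap_apply_left, huv]
        · by_cases h1 : a = a₁
          · rw [h1, Equiv.swap_apply_right, ← huv, vecSwap_vecSwap]
          · rw [Equiv.swap_apply_of_ne_of_ne h0 h1, vecSwap_of_vecWt_eq_zero]
            exact hrest _ (hsupp a) (fun hc => h0 (hinj hc)) (fun hc => h1 (hinj hc))
      have hprod : ∏ a, vecSign i (S a) = -1 := by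
        rw [Finset.prod_eq_single a₁, hsv]
        · intro a _ ha
          refine vecSign_of_nonneg (hsupp a) ?_
          by_cases h0 : a = a₀
          · rw [h0, hwu]
            decide
          · rw [hrest _ (hsupp a) (fun hc => h0 (hinj hc)) (fun hc => ha (hinj hc))]
            decide
        · simp
      rw [hstep, hperm, hprod, Matrix.det_permute, Equiv.Perm.sign_swap hne]
      simp

end Support

/-! ### The generalized minor as a minor of the vector representation -/

section GeneralizedMinor

/-- An increasing enumeration is determined by its range, so the outcome depends only on the
extremal weight, neither on the reduced word nor on the Weyl group element that produces the weight.
-/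
theorem det_signWord {k : Fin n} {ω : List (Fin n)} (hω : ω.length = length (wordProd ω))
    {S : Fin (k.val + 1) → VecIdx n} (hS : StrictMono fun a => vecRank (S a))
    (hS' : ∀ b, b ∈ Set.range S ↔ vecSupp (epsAct ω (fundEps k)) b)
    (φ : VecIdx n → Fin (k.val + 1) → ℂ) :
    (Matrix.of fun a : Fin (k.val + 1) => signWord ω φ (.inl ⟨a.val, by omega⟩)).det =
      (Matrix.of fun a => φ (S a)).det := by
  obtain ⟨S', h1, h2, h3⟩ := exists_sorted_support k ω hω
  have h4 : Set.range S = Set.range S' := by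
    ext b
    rw [hS', h2]
  have h5 : (fun a => vecRank (S a)) = fun a => vecRank (S' a) := by
    rw [← StrictMono.range_inj hS h1]
    change Set.range (vecRank ∘ S) = Set.range (vecRank ∘ S')
    rw [Set.range_comp, Set.range_comp, h4]
  have h6 : S = S' := funext fun a => vecRank_injective (congrFun h5 a)
  rw [h6]
  exact h3 φ

theorem leadingMinor_wordLift {k : Fin n} {ω ω' : List (Fin n)}
    (hω : ω.length = length (wordProd ω)) (hω' : ω'.length = length (wordProd ω'))
    {S S' : Fin (k.val + 1) → VecIdx n}
    (hS : StrictMono fun a => vecRank (S a)) (hS' : StrictMono fun a => vecRank (S' a))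
    (h : ∀ b, b ∈ Set.range S ↔ vecSupp (epsAct ω (fundEps k)) b)
    (h' : ∀ b, b ∈ Set.range S' ↔ vecSupp (epsAct ω' (fundEps k)) b)
    (A : Matrix (Idx n) (Idx n) ℂ) :
    leadingMinor k (((ω.map sBar).prod : Ambient n)⁻¹.val * A *
        ((ω'.map sBar).prod : Ambient n).val) =
      (A.submatrix (fun a => .inl (S a)) fun a => .inl (S' a)).det := by
  have h1 : ((((ω.map sBar).prod : Ambient n)⁻¹.val * A *
      ((ω'.map sBar).prod : Ambient n).val).submatrix (topIdx k) (topIdx k)) =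
        Matrix.of fun a : Fin (k.val + 1) => signWord ω (fun b p => (A *
          ((ω'.map sBar).prod : Ambient n).val) (.inl b) (topIdx k p)) (.inl ⟨a.val, by omega⟩) := by
    ext a p
    rw [Matrix.submatrix_apply, mul_assoc]
    exact wordLift_inv_mul_apply ω _ (topIdx k) _ p
  have h2 : (Matrix.of fun a : Fin (k.val + 1) => fun p => (A *
      ((ω'.map sBar).prod : Ambient n).val) (.inl (S a)) (topIdx k p)).transpose =
        Matrix.of fun a : Fin (k.val + 1) => signWord ω' (fun b p => A (.inl (S p)) (.inl b))
          (.inl ⟨a.val, by omega⟩) := by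
    ext a p
    exact mul_wordLift_apply ω' A (fun p => .inl (S p)) _ p
  rw [leadingMinor, h1, det_signWord hω hS h, ← Matrix.det_transpose, h2, det_signWord hω' hS' h',
    ← Matrix.det_transpose]
  rfl

/-- The basis vectors of the extremal vector of weight `w₀ s_k Λ_k`, in increasing order. -/
def barSupport (k : Fin n) (hk : k.val + 1 < n) : Fin (k.val + 1) → VecIdx n :=
  Fin.cons (.inr (.inr ⟨k.val + 1, hk⟩)) fun a => .inr (.inr ⟨k.val - 1 - a.val, by omega⟩)

theorem strictMono_vecRank_barSupport (k : Fin n) (hk : k.val + 1 < n) :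
    StrictMono fun a => vecRank (barSupport k hk a) := by
  intro a b
  refine Fin.cases ?_ (fun a => ?_) a <;> refine Fin.cases ?_ (fun b => ?_) b
  · simp
  · intro _
    simp only [barSupport, Fin.cons_zero, Fin.cons_succ, vecRank]
    omega
  · intro hab
    exact absurd hab (Fin.not_lt_zero _)
  · intro hab
    rw [Fin.succ_lt_succ_iff, Fin.lt_def] at hab
    simp only [barSupport, Fin.cons_succ, vecRank]
    omega

theorem mem_range_barSupport {k : Fin n} (hk : k.val + 1 < n) (b : VecIdx n) :
    b ∈ Set.range (barSupport k hk) ↔ vecSupp (-epsReflection k (fundEps k)) b := by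
  have key : ∀ j : Fin n, epsReflection k (fundEps k) j =
      if j.val < k.val ∨ j.val = k.val + 1 then 2 else 0 := by
    intro j
    rw [epsReflection_of_lt hk, Function.comp_apply, nodeSwap_apply hk, fundEps]
    by_cases h1 : j = k
    · rw [if_pos h1, if_neg (by rw [Fin.le_def]; simp), if_neg (by rw [h1]; omega)]
    · by_cases h2 : j.val = k.val + 1
      · rw [if_neg h1, if_pos h2, if_pos le_rfl, if_pos (Or.inr h2)]
      · have h3 : j ≤ k ↔ j.val < k.val ∨ j.val = k.val + 1 := by
          rw [Fin.le_def]
          rw [Fin.ext_iff] at h1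
          omega
        simp only [h1, h2, if_false, h3]
  rw [barSupport, Fin.range_cons, Set.mem_insert_iff, Set.mem_range]
  rcases b with j | u | j
  · simp only [vecSupp, Pi.neg_apply, key]
    split_ifs <;> simp
  · simp [vecSupp]
  · simp only [vecSupp, Pi.neg_apply, key, Sum.inr.injEq, Fin.ext_iff]
    constructor
    · rintro (h | ⟨a, h⟩)
      · rw [if_pos (Or.inr h)]
      · rw [if_pos (Or.inl (by omega))]
    · intro h
      by_cases hj : j.val = k.val + 1
      · exact Or.inl hj
      · by_cases hj' : j.val < k.val
        · exact Or.inr ⟨⟨k.val - 1 - j.val, by omega⟩, by simp only; omega⟩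
        · rw [if_neg (by omega)] at h
          exact absurd h (by decide)

theorem epsAct_fundEps_eq {k : Fin n} (hk : k.val + 1 < n) {ω : List (Fin n)} {x : Fin n → ℤ}
    (h : epsPairing n x = (2 : ℤ) • (wordProd ω).1 (fundWeight k)) :
    epsAct ω (fundEps k) = x :=
  epsPairing_injective ((epsPairing_epsAct (epsPairing_fundEps hk) ω).trans h.symm)

theorem epsPairing_longest {k : Fin n} (hk : k.val + 1 < n) {w₀ : weylGroup n}
    (hw₀ : IsLongest w₀) : epsPairing n (-epsReflection k (fundEps k)) =
      (2 : ℤ) • (w₀ * simple k).1 (fundWeight k) := by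
  obtain ⟨ω, rfl⟩ := exists_wordProd w₀
  rw [← epsAct_eq_neg_of_isLongest hw₀]
  exact epsPairing_epsAct (epsPairing_epsReflection (epsPairing_fundEps hk) k) ω

theorem wordProd_reducedWord (w : weylGroup n) : wordProd (reducedWord w) = w :=
  (exists_reduced w).choose_spec.1

theorem length_reducedWord (w : weylGroup n) :
    (reducedWord w).length = length (wordProd (reducedWord w)) := by
  rw [wordProd_reducedWord]
  exact (exists_reduced w).choose_spec.2

end GeneralizedMinor

end TypeB

/-- The index `k : Fin n` stands for `k + 1 ∈ {1, …, n - 1}`, and likewise for `j` and for the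
indices of `c`, where `c p i` is the variable `c^{(p+1)}_{i+1}`. -/
theorem mainTheorem6 (n : ℕ) (k : Fin n) (hk : k.val + 1 < n)
    (w₀ : TypeB.weylGroup n) (hw₀ : TypeB.IsLongest w₀) (c : Fin n → Fin n → ℂˣ) :
    TypeB.genMinor (TypeB.fundWeight k)
        ((w₀ * TypeB.simple k).1 (TypeB.fundWeight k)) (TypeB.fundWeight k) (TypeB.theta c) =
      1 / (c k ⟨0, by omega⟩ : ℂ) +
        ∑ j : Fin k.val,
          (c ⟨j.val, by omega⟩ ⟨k.val - j.val - 1, by omega⟩ : ℂ) /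
            (c ⟨j.val, by omega⟩ ⟨k.val - j.val, by omega⟩ : ℂ) := by
  have h : (∃ u : TypeB.weylGroup n, u.1 (TypeB.fundWeight k) =
      (w₀ * TypeB.simple k).1 (TypeB.fundWeight k)) ∧
        ∃ v : TypeB.weylGroup n, v.1 (TypeB.fundWeight k) = TypeB.fundWeight k :=
    ⟨⟨_, rfl⟩, ⟨1, rfl⟩⟩
  rw [TypeB.genMinor, dif_pos h, TypeB.principalMinor_fundWeight hk]
  have hu := h.1.choose_spec
  have hv := h.2.choose_spec
  -- All that is known of the chosen u and v is where they send Λ_k; this determines the supports,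
  -- and hence the minor.
  generalize h.1.choose = u at hu
  generalize h.2.choose = v at hv
  have hu' : TypeB.epsAct (TypeB.reducedWord u) (TypeB.fundEps k) =
      -TypeB.epsReflection k (TypeB.fundEps k) := by
    refine TypeB.epsAct_fundEps_eq hk ?_
    rw [TypeB.wordProd_reducedWord, hu, TypeB.epsPairing_longest hk hw₀]
  have hv' : TypeB.epsAct (TypeB.reducedWord v) (TypeB.fundEps k) = TypeB.fundEps k := by
    refine TypeB.epsAct_fundEps_eq hk ?_
    rw [TypeB.wordProd_reducedWord, hv, TypeB.epsPairing_fundEps hk]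
  refine (TypeB.leadingMinor_wordLift (TypeB.length_reducedWord u) (TypeB.length_reducedWord v)
    (TypeB.strictMono_vecRank_barSupport k hk)
    (S' := fun a => .inl ⟨a.val, by omega⟩) (fun a b hab => hab)
    (fun b => by rw [hu', TypeB.mem_range_barSupport])
    (fun b => by rw [hv', ← TypeB.mem_range_inl_iff_vecSupp]) _).trans ?_
  refine Eq.trans ?_ (TypeB.stairMinor_barEntry c hk)
  rw [TypeB.stairMinor]
  congr 1
  ext a m
  refine Fin.cases ?_ (fun a => ?_) a
  · simp only [Matrix.submatrix_apply, Matrix.of_apply, TypeB.barSupport, Fin.cons_zero, zero_add]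
    rw [TypeB.barEntry, dif_pos ⟨hk, by omega⟩]
    rfl
  · simp only [Matrix.submatrix_apply, Matrix.of_apply, TypeB.barSupport, Fin.cons_succ, zero_add]
    rw [TypeB.barEntry, dif_pos ⟨by omega, by omega⟩]
    rfl
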